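/- **Theorem 5.3.** Let $\mathcal N$ be a smooth $\mathfrak n$-dimensional manifold ($\mathfrak n\ge 1$) with null hypersurface data: a symmetric $2$-covariant tensor $\gamma$, a covector $\boldsymbol\ell$, a function $\ell^{(2)}$ and a symmetric $2$-covariant tensor $\mathbf Y$, all smooth, such that the form $\mathcal A((W,a),(Z,b))=\gamma(W,Z)+a\,\boldsymbol\ell(Z)+b\,\boldsymbol\ell(W)+ab\,\ell^{(2)}$ on $T_p\mathcal N\times\mathbb R$ is non-degenerate at every $p$. Write its inverse, on $T_p^*\mathcal N\times\mathbb R$, as $P(\boldsymbol\alpha,\boldsymbol\beta)+a\,\boldsymbol\beta(n)+b\,\boldsymbol\alpha(n)+ab\,n^{(2)}$; the data being null means that $n^{(2)}=0$ everywhere. Put $$\mathbf F=\tfrac12 d\boldsymbol\ell,\quad \boldsymbol s=\mathbf F(n,\cdot),\quad \mathbf U=\tfrac12\pounds_n\gamma,\quad \boldsymbol r=\mathbf Y(n,\cdot),\quad \kappa_n=-\mathbf Y(n,n).$$ Let $\overset{\circ}{\nabla}$ be the unique torsion-free connection with $(\overset{\circ}{\nabla}_X\gamma)(Z,W)=-\mathbf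 U(X,Z)\boldsymbol\ell(W)-\mathbf U(X,W)\boldsymbol\ell(Z)$ and $(\overset{\circ}{\nabla}_X\boldsymbol\ell)(Z)+(\overset{\circ}{\nabla}_Z\boldsymbol\ell)(X)=-2\ell^{(2)}\mathbf U(X,Z)$, let $\overset{\circ}{R}_{bd}=\overset{\circ}{R}{}^{a}{}_{bad}$ be its Ricci tensor, with $R(X,W)Z=(D_XD_W-D_WD_X-D_{[X,W]})Z$ and $\overset{\circ}{R}{}^{a}{}_{bcd}$ the components of $\boldsymbol\alpha(R(X,W)Z)$ in the order $(\boldsymbol\alpha,Z,X,W)$, and define the constraint tensor $$\begin{aligned}\mathcal R_{ab}=\;&\overset{\circ}{R}_{(ab)}-2\pounds_n Y_{ab}-(2\kappa_n+\mathrm{tr}_P\mathbf U)Y_{ab}+\overset{\circ}{\nabla}_{(a}(s_{b)}+2r_{b)})-2r_ar_b+4r_{(a}s_{b)}-s_as_b\\&-(\mathrm{tr}_P\mathbf Y)U_{ab}+2P^{cd}U_{d(a}(2Y_{b)c}+F_{b)c}).\end{aligned}$$ Let $\psi:S\hookrightarrow\mathcal N$ be a smoothly embedded $(\mathfrak n-1)$-dimensional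 manifold to which $n$ is everywhere transverse. Then $h=\psi^*\gamma$ is a (non-degenerate) metric on $S$; let $\nabla^h$, $R^h_{AB}$ be its Levi-Civita connection and Ricci tensor. Put $\boldsymbol\ell_\parallel=\psi^*\boldsymbol\ell$, $\mathbf U_\parallel=\psi^*\mathbf U$, $\mathbf Y_\parallel=\psi^*\mathbf Y$; capital indices denote components of pull-backs to $S$ in a basis of $TS$, raised with $h^{AB}$, and $\ell^{(2)}_\parallel=h^{AB}\ell_A\ell_B$; parentheses around indices denote symmetrization (over $A,B$ below). Then, without any restriction on the gauge, the pull-back of $\mathcal R$ to $S$ is $$\begin{aligned}\mathcal R_{AB}=\;&R^h_{AB}+2\nabla^h_{(A}(s_{B)}+r_{B)})-2(r_A-s_A)(r_B-s_B)+(\ell^{(2)}-\ell^{(2)}_\parallel)(\pounds_n\mathbf U)_{AB}-2(\pounds_n\mathbf Y)_{AB}\\&-(2\kappa_n+\mathrm{tr}_h\mathbf U_\parallel)(Y_{AB}-\nabla^h_{(A}\ell_{B)})\\&+\Big(n(\ell^{(2)})+2\ell^C\ell^DU_{CD}-4\ell^Cs_C+(\mathrm{tr}_h\mathbf U_\parallel+\kappa_n)(\ell^{(2)}-\ell^{(2)}_\parallel)-\mathrm{tr}_h\mathbf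 Y_\parallel+\nabla^h_C\ell^C\Big)U_{AB}\\&+2\ell^C\Big(\nabla^h_CU_{AB}-\nabla^h_{(A}U_{B)C}-\big(2(r_{(A}-s_{(A})+\ell^DU_{D(A}\big)U_{B)C}\Big)\\&+2h^{CD}\Big(2Y_{D(A}-\nabla^h_D\ell_{(A}-(\ell^{(2)}-\ell^{(2)}_\parallel)U_{D(A}\Big)U_{B)C}.\end{aligned}$$ -/

import Mathlib

open scoped Manifold ContDiff

attribute [-instance] TopCat.of.chartedSpace

noncomputable section

/-- The coordinate space `ℝᵏ`. -/
abbrev Coord (k : ℕ) : Type := EuclideanSpace ℝ (Fin k)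

/-! ## Tensor calculus in coordinates

A tensor field on an open set of `ℝᵏ` is given by its component functions; the order of the
arguments is the order of the indices, followed by the point. -/

/-- Partial derivative `∂ₐ f`. -/
def pd {k : ℕ} (a : Fin k) (f : Coord k → ℝ) (x : Coord k) : ℝ :=
  fderiv ℝ f x (EuclideanSpace.single a 1)

/-- `(∇θ)`: `covDer₁ Γ θ a b = ∇ₐ θ_b = ∂ₐ θ_b - Γᶜₐ_b θ_c`, where `Γ c a b` is `Γᶜₐ_b`,
that is `∇_{∂ₐ} ∂_b = Γᶜₐ_b ∂_c`. -/
def covDer₁ {k : ℕ} (Γ : Fin k → Fin k → Fin k → Coord k → ℝ) (θ : Fin k → Coord k → ℝ)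
    (a b : Fin k) (x : Coord k) : ℝ :=
  pd a (θ b) x - ∑ c, Γ c a b x * θ c x

/-- `covDer₂ Γ T a b c = ∇ₐ T_bc`. -/
def covDer₂ {k : ℕ} (Γ : Fin k → Fin k → Fin k → Coord k → ℝ) (T : Fin k → Fin k → Coord k → ℝ)
    (a b c : Fin k) (x : Coord k) : ℝ :=
  pd a (T b c) x - ∑ d, Γ d a b x * T d c x - ∑ d, Γ d a c x * T b d x

/-- The divergence `∇_c Vᶜ = ∂_c Vᶜ + Γᶜ_cd Vᵈ`. -/
def divergence {k : ℕ} (Γ : Fin k → Fin k → Fin k → Coord k → ℝ) (V : Fin k → Coord k → ℝ)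
    (x : Coord k) : ℝ :=
  ∑ c, (pd c (V c) x + ∑ d, Γ c c d x * V d x)

/-- Lie derivative of a `2`-covariant tensor,
`(£_V T)_ab = Vᶜ ∂_c T_ab + T_cb ∂ₐ Vᶜ + T_ac ∂_b Vᶜ`. -/
def lieDer₂ {k : ℕ} (V : Fin k → Coord k → ℝ) (T : Fin k → Fin k → Coord k → ℝ)
    (a b : Fin k) (x : Coord k) : ℝ :=
  ∑ c, (V c x * pd c (T a b) x + T c b x * pd a (V c) x + T a c x * pd b (V c) x)

/-- The curvature `riemann Γ a b c d = Rᵃ_bcd`, the `∂ₐ`-component of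
`(D_{∂_c} D_{∂_d} - D_{∂_d} D_{∂_c}) ∂_b`. -/
def riemann {k : ℕ} (Γ : Fin k → Fin k → Fin k → Coord k → ℝ) (a b c d : Fin k)
    (x : Coord k) : ℝ :=
  pd c (Γ a d b) x - pd d (Γ a c b) x + ∑ f, (Γ a c f x * Γ f d b x - Γ a d f x * Γ f c b x)

/-- The Ricci tensor `R_bd = Rᵃ_bad`. -/
def ricci {k : ℕ} (Γ : Fin k → Fin k → Fin k → Coord k → ℝ) (b d : Fin k) (x : Coord k) : ℝ :=
  ∑ a, riemann Γ a b a d x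

/-- `½ (∂ₐ g_bd + ∂_b g_ad - ∂_d g_ab)`. -/
def christoffelFirst {k : ℕ} (g : Fin k → Fin k → Coord k → ℝ) (a b d : Fin k)
    (x : Coord k) : ℝ :=
  (pd a (g b d) x + pd b (g a d) x - pd d (g a b) x) / 2

/-- The contravariant metric `gᵃᵇ` of a metric `g`. -/
def inverseMetric {k : ℕ} (g : Fin k → Fin k → Coord k → ℝ) (a b : Fin k) (x : Coord k) : ℝ :=
  (Matrix.of fun c d => g c d x)⁻¹ a b

/-- The Christoffel symbols `Γᶜₐ_b` of the Levi-Civita connection of a metric `g`. -/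
def leviCivita {k : ℕ} (g : Fin k → Fin k → Coord k → ℝ) (c a b : Fin k) (x : Coord k) : ℝ :=
  ∑ d, inverseMetric g c d x * christoffelFirst g a b d x

/-! ## Hypersurface data -/

section MetricHypersurfaceData

variable {k : ℕ} {N : Type*} [TopologicalSpace N] [ChartedSpace (Coord k) N]
  [IsManifold (𝓡 k) ∞ N]

/-- The symmetric form
`𝒜((W,a),(Z,b)) = γ(W,Z) + a ℓ(Z) + b ℓ(W) + a b ℓ⁽²⁾` on `T_pN × ℝ`. -/
def ambientForm {p : N} (γ : TangentSpace (𝓡 k) p →L[ℝ] TangentSpace (𝓡 k) p →L[ℝ] ℝ)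
    (ℓ : TangentSpace (𝓡 k) p →L[ℝ] ℝ) (ℓ2 : ℝ) :
    LinearMap.BilinForm ℝ (TangentSpace (𝓡 k) p × ℝ) :=
  LinearMap.mk₂ ℝ (fun w z => γ w.1 z.1 + w.2 * ℓ z.1 + z.2 * ℓ w.1 + w.2 * z.2 * ℓ2)
    (fun _ _ _ => by simp; ring) (fun _ _ _ => by simp; ring)
    (fun _ _ _ => by simp; ring) (fun _ _ _ => by simp; ring)

variable (k N) in
/-- Metric hypersurface data `{N, γ, ℓ, ℓ⁽²⁾}` on a smooth `k`-dimensional manifold. -/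
structure MetricHypersurfaceData where
  /-- the symmetric `2`-covariant tensor field `γ` -/
  γ : ∀ p : N, TangentSpace (𝓡 k) p →L[ℝ] TangentSpace (𝓡 k) p →L[ℝ] ℝ
  γ_symm : ∀ (p : N) (W Z : TangentSpace (𝓡 k) p), γ p W Z = γ p Z W
  γ_smooth : ContMDiff (𝓡 k) ((𝓡 k).prod 𝓘(ℝ, Coord k →L[ℝ] Coord k →L[ℝ] ℝ)) ∞
    (fun p => Bundle.TotalSpace.mk' (Coord k →L[ℝ] Coord k →L[ℝ] ℝ) p (γ p))
  /-- the covector field `ℓ` -/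
  ell : ∀ p : N, TangentSpace (𝓡 k) p →L[ℝ] ℝ
  ell_smooth : ContMDiff (𝓡 k) ((𝓡 k).prod 𝓘(ℝ, Coord k →L[ℝ] ℝ)) ∞
    (fun p => Bundle.TotalSpace.mk' (Coord k →L[ℝ] ℝ) p (ell p))
  /-- the scalar `ℓ⁽²⁾` -/
  ell2 : N → ℝ
  ell2_smooth : ContMDiff (𝓡 k) 𝓘(ℝ, ℝ) ∞ ell2
  nondegenerate : ∀ p : N, (ambientForm (γ p) (ell p) (ell2 p)).Nondegenerate

variable (k N) in
/-- Hypersurface data `{N, γ, ℓ, ℓ⁽²⁾, Y}`. -/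
structure HypersurfaceData extends MetricHypersurfaceData k N where
  /-- the symmetric `2`-covariant tensor field `Y` -/
  Y : ∀ p : N, TangentSpace (𝓡 k) p →L[ℝ] TangentSpace (𝓡 k) p →L[ℝ] ℝ
  Y_symm : ∀ (p : N) (W Z : TangentSpace (𝓡 k) p), Y p W Z = Y p Z W
  Y_smooth : ContMDiff (𝓡 k) ((𝓡 k).prod 𝓘(ℝ, Coord k →L[ℝ] Coord k →L[ℝ] ℝ)) ∞
    (fun p => Bundle.TotalSpace.mk' (Coord k →L[ℝ] Coord k →L[ℝ] ℝ) p (Y p))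

namespace MetricHypersurfaceData

variable (D : MetricHypersurfaceData k N)

/-- The vector of `T_pN × ℝ` that corresponds through `𝒜` to the covector
`(α, a) : (W, c) ↦ α(W) + a c` of `T_pN × ℝ`. -/
def sharp (p : N) (α : TangentSpace (𝓡 k) p →L[ℝ] ℝ) (a : ℝ) : TangentSpace (𝓡 k) p × ℝ :=
  haveI : FiniteDimensional ℝ (TangentSpace (𝓡 k) p) :=
    inferInstanceAs (FiniteDimensional ℝ (Coord k))
  ((ambientForm (D.γ p) (D.ell p) (D.ell2 p)).toDual (D.nondegenerate p)).symm
    ((α : TangentSpace (𝓡 k) p →ₗ[ℝ] ℝ).coprod (a • LinearMap.id))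

/-- The inverse contravariant form
`𝒜♯((α,a),(β,b)) = P(α,β) + a n(β) + b n(α) + a b n⁽²⁾`, here `(β,b)` applied to the
vector that corresponds to `(α,a)`. -/
def inverseForm (p : N) (α : TangentSpace (𝓡 k) p →L[ℝ] ℝ) (a : ℝ)
    (β : TangentSpace (𝓡 k) p →L[ℝ] ℝ) (b : ℝ) : ℝ :=
  β (D.sharp p α a).1 + b * (D.sharp p α a).2

/-- `P(α,β) = 𝒜♯((α,0),(β,0))`. -/
def P (p : N) (α β : TangentSpace (𝓡 k) p →L[ℝ] ℝ) : ℝ := D.inverseForm p α 0 β 0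

/-- The vector field `n`, with `β(n) = 𝒜♯((0,1),(β,0))` for every covector `β`. -/
def n (p : N) : TangentSpace (𝓡 k) p := (D.sharp p 0 1).1

/-- The scalar `n⁽²⁾ = 𝒜♯((0,1),(0,1))`. -/
def n2 (p : N) : ℝ := D.inverseForm p 0 1 0 1

/-- The data are null: `n⁽²⁾` vanishes everywhere. -/
def IsNull : Prop := ∀ p : N, D.n2 p = 0

end MetricHypersurfaceData

/-! ### Components in a chart -/

/-- The coordinate vector `∂ₐ` of the chart `φ` at the point with coordinates `x`. -/
def coordVector (φ : OpenPartialHomeomorph N (Coord k)) (a : Fin k) (x : Coord k) :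
    TangentSpace (𝓡 k) (φ.symm x) :=
  mfderiv (𝓡 k) (𝓡 k) φ.symm x (EuclideanSpace.single a 1 : Coord k)

/-- The coordinate covector `dxᵃ` of the chart `φ` at the point `p`. -/
def coordCovector (φ : OpenPartialHomeomorph N (Coord k)) (a : Fin k) (p : N) :
    TangentSpace (𝓡 k) p →L[ℝ] ℝ :=
  (EuclideanSpace.proj a : Coord k →L[ℝ] ℝ).comp (mfderiv (𝓡 k) (𝓡 k) φ p)

end MetricHypersurfaceData

/-- The components of hypersurface data and of `n`, `P`, `n⁽²⁾` in a coordinate system. -/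
structure CoordData (k : ℕ) where
  /-- `γ_ab` -/
  γ : Fin k → Fin k → Coord k → ℝ
  /-- `ℓ_a` -/
  ell : Fin k → Coord k → ℝ
  /-- `ℓ⁽²⁾` -/
  ell2 : Coord k → ℝ
  /-- `Y_ab` -/
  Y : Fin k → Fin k → Coord k → ℝ
  /-- `nᵃ` -/
  n : Fin k → Coord k → ℝ
  /-- `Pᵃᵇ` -/
  P : Fin k → Fin k → Coord k → ℝ
  /-- `n⁽²⁾` -/
  n2 : Coord k → ℝ

/-- The components of hypersurface data in the chart `φ`. -/
def HypersurfaceData.inChart {k : ℕ} {N : Type*} [TopologicalSpace N] [ChartedSpace (Coord k) N]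
    [IsManifold (𝓡 k) ∞ N] (D : HypersurfaceData k N)
    (φ : OpenPartialHomeomorph N (Coord k)) : CoordData k where
  γ a b x := D.γ (φ.symm x) (coordVector φ a x) (coordVector φ b x)
  ell a x := D.ell (φ.symm x) (coordVector φ a x)
  ell2 x := D.ell2 (φ.symm x)
  Y a b x := D.Y (φ.symm x) (coordVector φ a x) (coordVector φ b x)
  n a x := coordCovector φ a (φ.symm x) (D.n (φ.symm x))
  P a b x := D.P (φ.symm x) (coordCovector φ a (φ.symm x)) (coordCovector φ b (φ.symm x))
  n2 x := D.n2 (φ.symm x)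

namespace CoordData

variable {k : ℕ} (L : CoordData k)

/-- `F = ½ dℓ`. -/
def F (a b : Fin k) (x : Coord k) : ℝ := (pd a (L.ell b) x - pd b (L.ell a) x) / 2

/-- `s = F(n, ·)`. -/
def s (b : Fin k) (x : Coord k) : ℝ := ∑ a, L.n a x * L.F a b x

/-- `U = ½ £_n γ + ℓ ⊗ₛ dn⁽²⁾`. -/
def U (a b : Fin k) (x : Coord k) : ℝ :=
  lieDer₂ L.n L.γ a b x / 2 + (L.ell a x * pd b L.n2 x + L.ell b x * pd a L.n2 x) / 2

/-- `r = Y(n, ·)`. -/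
def r (b : Fin k) (x : Coord k) : ℝ := ∑ a, L.n a x * L.Y a b x

/-- `κ_n = -Y(n, n)`. -/
def κ (x : Coord k) : ℝ := -∑ a, ∑ b, L.n a x * L.n b x * L.Y a b x

/-- Coefficients `G` are, at the point `x`, those of a torsion-free connection that satisfies the
two equations which define the metric hypersurface connection,
`(∇_X γ)(Z,W) = -U(X,Z) ℓ(W) - U(X,W) ℓ(Z)` and `(∇_X ℓ)(Z) + (∇_Z ℓ)(X) = -2 ℓ⁽²⁾ U(X,Z)`. -/
def IsMHConnectionAt (G : Fin k → Fin k → Fin k → Coord k → ℝ)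
    (x : Coord k) : Prop :=
  (∀ c a b, G c a b x = G c b a x) ∧
  (∀ a b c, covDer₂ G L.γ a b c x = -L.U a b x * L.ell c x - L.U a c x * L.ell b x) ∧
  ∀ a b, covDer₁ G L.ell a b x + covDer₁ G L.ell b a x = -2 * L.ell2 x * L.U a b x

/-- The metric hypersurface connection, as connection coefficients `Γᶜₐ_b`. For the components of
hypersurface data in a chart these coefficients are the only solution of `IsMHConnectionAt` at each
point of the chart domain, see `HypersurfaceData.isMHConnectionAt_iff`. -/
def mhConnection (c a b : Fin k) (x : Coord k) : ℝ :=
  ∑ f, L.P c f x * christoffelFirst L.γ a b f x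
    + L.n c x * ((pd a (L.ell b) x + pd b (L.ell a) x) / 2)

/-- The trace `tr_P T = Pᵃᵇ T_ab`. -/
def trP (T : Fin k → Fin k → Coord k → ℝ) (x : Coord k) : ℝ := ∑ a, ∑ b, L.P a b x * T a b x

/-- `n(f)`. -/
def nDeriv (f : Coord k → ℝ) (x : Coord k) : ℝ := ∑ a, L.n a x * pd a f x

/-- The constraint tensor `ℛ_bd`. -/
def constraint (b d : Fin k) (x : Coord k) : ℝ :=
  (ricci L.mhConnection b d x + ricci L.mhConnection d b x) / 2
    - 2 * lieDer₂ L.n L.Y b d x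
    - (2 * L.κ x + L.trP L.U x - L.n2 x * (L.nDeriv L.ell2 x - L.trP L.Y x)) * L.Y b d x
    + (covDer₁ L.mhConnection (fun c y => L.s c y + 2 * L.r c y) b d x
        + covDer₁ L.mhConnection (fun c y => L.s c y + 2 * L.r c y) d b x) / 2
    - 2 * L.r b x * L.r d x
    + 2 * (L.r b x * L.s d x + L.r d x * L.s b x)
    - L.s b x * L.s d x
    - L.trP L.Y x * L.U b d x
    + ∑ a, ∑ c, L.P a c x * (L.U a b x * (2 * L.Y d c x + L.F d c x)
        + L.U a d x * (2 * L.Y b c x + L.F b c x))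
    + L.n2 x * (((L.s b x - 3 * L.r b x) * pd d L.ell2 x
          + (L.s d x - 3 * L.r d x) * pd b L.ell2 x) / 2
        + ∑ a, ∑ c, L.P a c x * (L.Y a b x + L.F a b x) * (L.Y c d x + L.F c d x))

end CoordData

/-! ### Submanifolds -/

/-- The local expression `φ ∘ ψ ∘ χ⁻¹` of a map in charts. -/
def localExpr {m k : ℕ} {S N : Type*} [TopologicalSpace S] [TopologicalSpace N]
    (φ : OpenPartialHomeomorph N (Coord k)) (ψ : S → N) (χ : OpenPartialHomeomorph S (Coord m))
    (y : Coord m) : Coord k :=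
  φ (ψ (χ.symm y))

/-- The components `v_Aᵃ = ∂_A fᵃ` of the push-forward of the coordinate vector `∂_A`. -/
def pushCoord {m k : ℕ} (f : Coord m → Coord k) (A : Fin m) (a : Fin k) (y : Coord m) : ℝ :=
  pd A (fun z => f z a) y

/-- Pull-back of a covector. -/
def pull₁ {m k : ℕ} (f : Coord m → Coord k) (θ : Fin k → Coord k → ℝ) (A : Fin m)
    (y : Coord m) : ℝ :=
  ∑ a, pushCoord f A a y * θ a (f y)

/-- Pull-back of a `2`-covariant tensor. -/
def pull₂ {m k : ℕ} (f : Coord m → Coord k) (T : Fin k → Fin k → Coord k → ℝ) (A B : Fin m)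
    (y : Coord m) : ℝ :=
  ∑ a, ∑ b, pushCoord f A a y * pushCoord f B b y * T a b (f y)

/-- `S`, embedded by `ψ`, is a transverse submanifold: `ψ` is a smooth embedding and `n` is
nowhere tangent to its image (the codimension is one). -/
def IsTransverseSubmanifold {m : ℕ} {S N : Type*} [TopologicalSpace S] [ChartedSpace (Coord m) S]
    [IsManifold (𝓡 m) ∞ S] [TopologicalSpace N] [ChartedSpace (Coord (m + 1)) N]
    [IsManifold (𝓡 (m + 1)) ∞ N] (D : MetricHypersurfaceData (m + 1) N) (ψ : S → N) : Prop :=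
  Manifold.IsSmoothEmbedding (𝓡 m) (𝓡 (m + 1)) ∞ ψ ∧
    ∀ p : S, ∀ X : TangentSpace (𝓡 m) p, mfderiv (𝓡 m) (𝓡 (m + 1)) ψ p X ≠ D.n (ψ p)

/-! ## The defining equations of the metric hypersurface connection -/

namespace CoordData
/-- The relations between the components of `γ, ℓ, ℓ⁽²⁾` and `P, n, n⁽²⁾` near a point, with
the differentiability of the components at that point. -/
structure IsRegularAt {k : ℕ} (L : CoordData k) (x : Coord k) : Prop where
  γ_symm : ∀ᶠ y in nhds x, ∀ a b, L.γ a b y = L.γ b a y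
  P_symm : ∀ a b, L.P a b x = L.P b a x
  prod1 : ∀ᶠ y in nhds x, ∀ a, ∑ b, L.γ a b y * L.n b y + L.n2 y * L.ell a y = 0
  prod2 : ∑ a, L.ell a x * L.n a x + L.n2 x * L.ell2 x = 1
  prod3 : ∀ a, ∑ b, L.P a b x * L.ell b x + L.ell2 x * L.n a x = 0
  prod4 : ∀ a c, ∑ b, L.P a b x * L.γ b c x + L.n a x * L.ell c x = if a = c then 1 else 0
  γ_diff : ∀ a b, DifferentiableAt ℝ (L.γ a b) x
  ell_diff : ∀ a, DifferentiableAt ℝ (L.ell a) x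
  n_diff : ∀ a, DifferentiableAt ℝ (L.n a) x
  n2_diff : DifferentiableAt ℝ L.n2 x

variable {k : ℕ} {L : CoordData k} {x : Coord k}

theorem IsRegularAt.contract (h : L.IsRegularAt x) (a b : Fin k) :
    ∑ g, L.n g x * christoffelFirst L.γ a b g x
      + L.n2 x * ((pd a (L.ell b) x + pd b (L.ell a) x) / 2) = -L.U a b x := by
  have key : ∀ a b, ∑ g, (pd a (L.γ b g) x * L.n g x + L.γ b g x * pd a (L.n g) x)
      + (pd a L.n2 x * L.ell b x + L.n2 x * pd a (L.ell b) x) = 0 := by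
    intro a b
    have e : (fun y => ∑ g, L.γ b g y * L.n g y + L.n2 y * L.ell b y) =ᶠ[nhds x] fun _ => 0 := by
      filter_upwards [h.prod1] with y hy using hy b
    have hd : HasFDerivAt (fun y => ∑ g, L.γ b g y * L.n g y + L.n2 y * L.ell b y)
        (∑ g, (L.γ b g x • fderiv ℝ (L.n g) x + L.n g x • fderiv ℝ (L.γ b g) x)
          + (L.n2 x • fderiv ℝ (L.ell b) x + L.ell b x • fderiv ℝ L.n2 x)) x := by
      refine HasFDerivAt.add ?_ ((h.n2_diff.hasFDerivAt).mul (h.ell_diff b).hasFDerivAt)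
      exact HasFDerivAt.fun_sum fun g _ =>
        ((h.γ_diff b g).hasFDerivAt).mul (h.n_diff g).hasFDerivAt
    have h0 := Filter.EventuallyEq.fderiv_eq (𝕜 := ℝ) e
    rw [hd.fderiv] at h0
    have h1 : (∑ g, (L.γ b g x • fderiv ℝ (L.n g) x + L.n g x • fderiv ℝ (L.γ b g) x)
          + (L.n2 x • fderiv ℝ (L.ell b) x + L.ell b x • fderiv ℝ L.n2 x))
          (EuclideanSpace.single a 1) = 0 := by
      rw [h0]; simp
    rw [add_apply, sum_apply] at h1
    simp only [pd]
    rw [← h1]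
    congr 1
    · refine Finset.sum_congr rfl fun g _ => ?_
      simp only [ContinuousLinearMap.add_apply, ContinuousLinearMap.smul_apply, smul_eq_mul]
      ring
    · simp only [ContinuousLinearMap.add_apply, ContinuousLinearMap.smul_apply, smul_eq_mul]
      ring
  have sγ : ∀ c a b, pd c (L.γ a b) x = pd c (L.γ b a) x := by
    intro c a b
    have : L.γ a b =ᶠ[nhds x] L.γ b a := by filter_upwards [h.γ_symm] with y hy using hy a b
    simp only [pd, this.fderiv_eq]
  have hs := fun a b => h.γ_symm.self_of_nhds a b
  have k1 := key a b
  have k2 := key b a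
  have e1 : ∑ g, L.n g x * christoffelFirst L.γ a b g x
      = (∑ g, pd a (L.γ b g) x * L.n g x + ∑ g, pd b (L.γ a g) x * L.n g x
        - ∑ g, L.n g x * pd g (L.γ a b) x) / 2 := by
    rw [← Finset.sum_add_distrib, ← Finset.sum_sub_distrib, Finset.sum_div]
    exact Finset.sum_congr rfl fun g _ => by simp only [christoffelFirst]; ring
  have e2 : lieDer₂ L.n L.γ a b x = ∑ g, L.n g x * pd g (L.γ a b) x
      + ∑ g, L.γ b g x * pd a (L.n g) x + ∑ g, L.γ a g x * pd b (L.n g) x := by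
    rw [← Finset.sum_add_distrib, ← Finset.sum_add_distrib]
    exact Finset.sum_congr rfl fun g _ => by rw [hs g b]
  rw [Finset.sum_add_distrib] at k1 k2
  rw [U, e1, e2]
  linarith

theorem IsRegularAt.γ_mhConnection (h : L.IsRegularAt x) (a b f : Fin k) :
    ∑ c, L.mhConnection c a b x * L.γ c f x
      = christoffelFirst L.γ a b f x + L.U a b x * L.ell f x := by
  have hp1 := h.prod1.self_of_nhds f
  have hs := fun a b => h.γ_symm.self_of_nhds a b
  have hn : ∑ c, L.n c x * L.γ c f x = - (L.n2 x * L.ell f x) := by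
    rw [← eq_neg_iff_add_eq_zero] at hp1
    rw [← hp1]
    exact Finset.sum_congr rfl fun c _ => by rw [hs c f]; ring
  simp only [mhConnection, add_mul, Finset.sum_add_distrib, Finset.sum_mul]
  rw [Finset.sum_comm]
  have : ∀ g, ∑ c, L.P c g x * christoffelFirst L.γ a b g x * L.γ c f x
      = ((if g = f then 1 else 0) - L.n g x * L.ell f x) * christoffelFirst L.γ a b g x := by
    intro g
    rw [← h.prod4 g f, add_sub_cancel_right, Finset.sum_mul]
    exact Finset.sum_congr rfl fun c _ => by rw [h.P_symm c g]; ring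
  simp only [this, sub_mul, Finset.sum_sub_distrib, ite_mul, one_mul, zero_mul,
    Finset.sum_ite_eq', Finset.mem_univ, if_true]
  have e1 : ∑ c, L.n c x * ((pd a (L.ell b) x + pd b (L.ell a) x) / 2) * L.γ c f x
      = (pd a (L.ell b) x + pd b (L.ell a) x) / 2 * -(L.n2 x * L.ell f x) := by
    rw [← hn, Finset.mul_sum]
    exact Finset.sum_congr rfl fun c _ => by ring
  have e2 : ∑ g, L.n g x * L.ell f x * christoffelFirst L.γ a b g x
      = L.ell f x * ∑ g, L.n g x * christoffelFirst L.γ a b g x := by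
    rw [Finset.mul_sum]
    exact Finset.sum_congr rfl fun c _ => by ring
  rw [e1, e2]
  linear_combination (-L.ell f x) * h.contract a b

theorem IsRegularAt.ell_mhConnection (h : L.IsRegularAt x) (a b : Fin k) :
    ∑ c, L.mhConnection c a b x * L.ell c x
      = (pd a (L.ell b) x + pd b (L.ell a) x) / 2 + L.ell2 x * L.U a b x := by
  simp only [mhConnection, add_mul, Finset.sum_add_distrib, Finset.sum_mul]
  rw [Finset.sum_comm]
  have : ∀ g, ∑ c, L.P c g x * christoffelFirst L.γ a b g x * L.ell c x
      = -L.ell2 x * (L.n g x * christoffelFirst L.γ a b g x) := by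
    intro g
    have h3 := h.prod3 g
    rw [← eq_neg_iff_add_eq_zero] at h3
    rw [← mul_assoc, neg_mul, ← h3, Finset.sum_mul]
    exact Finset.sum_congr rfl fun c _ => by rw [h.P_symm c g]; ring
  simp only [this, ← Finset.mul_sum]
  have e1 : ∑ c, L.n c x * ((pd a (L.ell b) x + pd b (L.ell a) x) / 2) * L.ell c x
      = (pd a (L.ell b) x + pd b (L.ell a) x) / 2 * (1 - L.n2 x * L.ell2 x) := by
    rw [← h.prod2, add_sub_cancel_right, Finset.mul_sum]
    exact Finset.sum_congr rfl fun c _ => by ring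
  rw [e1]
  linear_combination (-L.ell2 x) * h.contract a b

/-- The coefficients `mhConnection` are the only ones that satisfy the defining equations of the
metric hypersurface connection. -/
theorem IsRegularAt.isMHConnectionAt_iff (h : L.IsRegularAt x)
    (G : Fin k → Fin k → Fin k → Coord k → ℝ) :
    L.IsMHConnectionAt G x ↔ ∀ c a b, G c a b x = L.mhConnection c a b x := by
  have sγ : ∀ c a b, pd c (L.γ a b) x = pd c (L.γ b a) x := by
    intro c a b
    have : L.γ a b =ᶠ[nhds x] L.γ b a := by filter_upwards [h.γ_symm] with y hy using hy a b
    simp only [pd, this.fderiv_eq]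
  have hs := fun a b => h.γ_symm.self_of_nhds a b
  have symm0 : ∀ c a b, L.mhConnection c a b x = L.mhConnection c b a x := by
    intro c a b
    simp only [mhConnection]
    congr 1
    · refine Finset.sum_congr rfl fun f _ => ?_
      simp only [christoffelFirst]
      rw [sγ f b a]; ring
    · ring
  have sU : ∀ a b, L.U a b x = L.U b a x := by
    intro a b
    have h1 := h.contract a b
    have h2 := h.contract b a
    have : ∀ g, christoffelFirst L.γ a b g x = christoffelFirst L.γ b a g x := by
      intro g; simp only [christoffelFirst]; rw [sγ g b a]; ring
    simp only [this] at h1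
    linarith
  have swap : ∀ (G : Fin k → Fin k → Fin k → Coord k → ℝ) a b c,
      ∑ d, G d a c x * L.γ b d x = ∑ d, G d a c x * L.γ d b x := fun G a b c =>
    Finset.sum_congr rfl fun d _ => by rw [hs b d]
  constructor
  · rintro ⟨t, h1, h2⟩ c a b
    have lowγ : ∀ f, ∑ d, G d a b x * L.γ d f x
        = christoffelFirst L.γ a b f x + L.U a b x * L.ell f x := by
      intro f
      have p := h1 a b f
      have q := h1 b f a
      have w := h1 f a b
      simp only [covDer₂, swap] at p q w
      simp only [fun d => t d b f, fun d => t d f a, fun d => t d b a] at p q w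
      simp only [christoffelFirst]
      rw [sU b f, sU b a] at q
      rw [sU f a] at w
      rw [sγ b a f]
      simp only [fun d => t d f b] at p q w
      linarith
    have lowℓ : ∑ d, G d a b x * L.ell d x
        = (pd a (L.ell b) x + pd b (L.ell a) x) / 2 + L.ell2 x * L.U a b x := by
      have p := h2 a b
      simp only [covDer₁, fun d => t d b a] at p
      linarith
    have expand : ∀ V : Fin k → ℝ, V c = ∑ f, L.P c f x * (∑ d, V d * L.γ d f x)
        + L.n c x * ∑ d, V d * L.ell d x := by
      intro V
      simp only [Finset.mul_sum]
      rw [Finset.sum_comm, ← Finset.sum_add_distrib]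
      have : ∀ d, ∑ f, L.P c f x * (V d * L.γ d f x) + L.n c x * (V d * L.ell d x)
          = V d * (if c = d then 1 else 0) := by
        intro d
        rw [← h.prod4 c d, mul_add, Finset.mul_sum]
        congr 1
        · exact Finset.sum_congr rfl fun f _ => by rw [hs d f]; ring
        · ring
      simp [this]
    rw [expand (fun d => G d a b x), expand (fun d => L.mhConnection d a b x)]
    simp only [lowγ, lowℓ, h.γ_mhConnection, h.ell_mhConnection]
  · intro hG
    refine ⟨fun c a b => by rw [hG, hG, symm0], fun a b c => ?_, fun a b => ?_⟩
    · simp only [covDer₂, swap, hG, h.γ_mhConnection, christoffelFirst]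
      rw [sγ a c b, sγ b a c]
      ring
    · simp only [covDer₁, hG, h.ell_mhConnection, sU b a]
      ring
end CoordData

section Bridge
variable {k : ℕ} {N : Type*} [TopologicalSpace N] [ChartedSpace (Coord k) N]
  [IsManifold (𝓡 k) ∞ N]

namespace MetricHypersurfaceData
variable (D : MetricHypersurfaceData k N)

theorem ambientForm_sharp (p : N) (α : TangentSpace (𝓡 k) p →L[ℝ] ℝ) (a : ℝ)
    (Z : TangentSpace (𝓡 k) p) (b : ℝ) :
    D.γ p (D.sharp p α a).1 Z + (D.sharp p α a).2 * D.ell p Z + b * D.ell p (D.sharp p α a).1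
      + (D.sharp p α a).2 * b * D.ell2 p = α Z + a * b := by
  have : FiniteDimensional ℝ (TangentSpace (𝓡 k) p) :=
    inferInstanceAs (FiniteDimensional ℝ (Coord k))
  have h := LinearMap.BilinForm.apply_toDual_symm_apply
    (B := ambientForm (D.γ p) (D.ell p) (D.ell2 p)) (hB := D.nondegenerate p)
    ((α : TangentSpace (𝓡 k) p →ₗ[ℝ] ℝ).coprod (a • LinearMap.id)) (Z, b)
  have h1 : D.γ p (D.sharp p α a).1 Z + (D.sharp p α a).2 * D.ell p Z
      + b * D.ell p (D.sharp p α a).1 + (D.sharp p α a).2 * b * D.ell2 p = α Z + a • b := h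
  simpa using h1

theorem n2_eq (p : N) : D.n2 p = (D.sharp p 0 1).2 := by simp [n2, inverseForm]

theorem γ_n (p : N) (Z : TangentSpace (𝓡 k) p) :
    D.γ p (D.n p) Z + D.n2 p * D.ell p Z = 0 := by
  simpa [n, n2_eq] using D.ambientForm_sharp p 0 1 Z 0

theorem ell_n (p : N) : D.ell p (D.n p) + D.n2 p * D.ell2 p = 1 := by
  simpa [n, n2_eq] using D.ambientForm_sharp p 0 1 0 1

theorem P_eq (p : N) (α β : TangentSpace (𝓡 k) p →L[ℝ] ℝ) :
    D.P p α β = β (D.sharp p α 0).1 := by simp [P, inverseForm]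

theorem ell_sharp (p : N) (α : TangentSpace (𝓡 k) p →L[ℝ] ℝ) :
    D.ell p (D.sharp p α 0).1 + (D.sharp p α 0).2 * D.ell2 p = 0 := by
  simpa using D.ambientForm_sharp p α 0 0 1

theorem γ_sharp (p : N) (α : TangentSpace (𝓡 k) p →L[ℝ] ℝ) (Z : TangentSpace (𝓡 k) p) :
    D.γ p (D.sharp p α 0).1 Z + (D.sharp p α 0).2 * D.ell p Z = α Z := by
  simpa using D.ambientForm_sharp p α 0 Z 0

theorem sharp_snd (p : N) (α : TangentSpace (𝓡 k) p →L[ℝ] ℝ) :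
    (D.sharp p α 0).2 = α (D.n p) := by
  have h1 := D.γ_sharp p α (D.n p)
  have h2 := D.γ_n p (D.sharp p α 0).1
  rw [D.γ_symm] at h2
  linear_combination h1 - h2 - (D.sharp p α 0).2 * D.ell_n p + D.n2 p * D.ell_sharp p α

theorem P_symm (p : N) (α β : TangentSpace (𝓡 k) p →L[ℝ] ℝ) : D.P p α β = D.P p β α := by
  rw [P_eq, P_eq, ← D.γ_sharp p α, ← D.γ_sharp p β, D.γ_symm]
  linear_combination (D.sharp p β 0).2 * D.ell_sharp p α - (D.sharp p α 0).2 * D.ell_sharp p β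

end MetricHypersurfaceData

variable {φ : OpenPartialHomeomorph N (Coord k)}

theorem chart_mdifferentiable (hφ : φ ∈ IsManifold.maximalAtlas (𝓡 k) ∞ N) :
    φ.MDifferentiable (𝓡 k) (𝓡 k) :=
  ⟨(contMDiffOn_of_mem_maximalAtlas hφ).mdifferentiableOn (by simp),
    (contMDiffOn_symm_of_mem_maximalAtlas hφ).mdifferentiableOn (by simp)⟩

theorem expand_coordVector (hφ : φ ∈ IsManifold.maximalAtlas (𝓡 k) ∞ N) {x : Coord k}
    (hx : x ∈ φ.target) (V : TangentSpace (𝓡 k) (φ.symm x)) :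
    V = ∑ b, coordCovector φ b (φ.symm x) V • coordVector φ b x := by
  have hd := chart_mdifferentiable hφ
  have h1 := hd.symm_comp_deriv (φ.map_target hx)
  rw [φ.right_inv hx] at h1
  have h2 := congrArg (fun l => l V) h1
  have h3 : ∀ w : Coord k, w = ∑ b, w b • (EuclideanSpace.single b 1 : Coord k) := by
    intro w
    ext i
    simp [Finset.sum_apply, Pi.single_apply]
  have h4 : mfderiv (𝓡 k) (𝓡 k) φ.symm x (mfderiv (𝓡 k) (𝓡 k) φ (φ.symm x) V) = V := h2
  conv_lhs => rw [← h4]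
  have h5 := h3 (mfderiv (𝓡 k) (𝓡 k) φ (φ.symm x) V)
  have h6 := congrArg (mfderiv (𝓡 k) (𝓡 k) φ.symm x : Coord k → _) h5
  refine h6.trans ?_
  erw [map_sum]
  refine Finset.sum_congr rfl fun b _ => ?_
  erw [map_smul]
  rfl

theorem coordCovector_coordVector (hφ : φ ∈ IsManifold.maximalAtlas (𝓡 k) ∞ N) {x : Coord k}
    (hx : x ∈ φ.target) (a b : Fin k) :
    coordCovector φ a (φ.symm x) (coordVector φ b x) = if a = b then 1 else 0 := by
  have hd := chart_mdifferentiable hφ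
  have h1 := hd.comp_symm_deriv hx
  have h2 := congrArg (fun l => l (EuclideanSpace.single b 1 : Coord k)) h1
  have h4 : mfderiv (𝓡 k) (𝓡 k) φ (φ.symm x) (coordVector φ b x)
      = (EuclideanSpace.single b 1 : Coord k) := h2
  have h5 := congrArg (fun w : Coord k => w a) h4
  refine Eq.trans h5 ?_
  simp [Pi.single_apply]

theorem contMDiffAt_coordVector (hφ : φ ∈ IsManifold.maximalAtlas (𝓡 k) ∞ N) {x : Coord k}
    (hx : x ∈ φ.target) (a : Fin k) :
    ContMDiffAt (𝓡 k) ((𝓡 k).prod 𝓘(ℝ, Coord k)) ∞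
      (fun y => Bundle.TotalSpace.mk' (Coord k) (E := fun p : N => TangentSpace (𝓡 k) p)
        (φ.symm y) (coordVector φ a y)) x := by
  have h1 : ContMDiffOn (𝓡 k).tangent (𝓡 k).tangent ∞ (tangentMap (𝓡 k) (𝓡 k) φ.symm)
      (Bundle.TotalSpace.proj ⁻¹' φ.target) := by
    have := (contMDiffOn_symm_of_mem_maximalAtlas hφ).contMDiffOn_tangentMapWithin
      (m := ∞) (by simp) φ.open_target.uniqueMDiffOn
    refine this.congr fun v hv => ?_
    rw [tangentMapWithin_eq_tangentMap (φ.open_target.uniqueMDiffOn _ hv)]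
    exact (chart_mdifferentiable hφ).mdifferentiableAt_symm hv
  have h2 : ContMDiffAt (𝓡 k) (𝓡 k).tangent ∞
      (fun y : Coord k => (⟨y, (EuclideanSpace.single a 1 : Coord k)⟩ :
        TangentBundle (𝓡 k) (Coord k))) x := by
    exact contMDiffAt_vectorSpace_iff_contDiffAt.2 contDiffAt_const
  have h3 := (h1.contMDiffAt ((φ.open_target.preimage
    (FiberBundle.continuous_proj _ _)).mem_nhds (x := ⟨x, (EuclideanSpace.single a 1 : Coord k)⟩)
      hx)).comp x h2
  exact h3

theorem contDiffAt_comp₂ (hφ : φ ∈ IsManifold.maximalAtlas (𝓡 k) ∞ N) {x : Coord k}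
    (hx : x ∈ φ.target)
    {T : ∀ p : N, TangentSpace (𝓡 k) p →L[ℝ] TangentSpace (𝓡 k) p →L[ℝ] ℝ}
    (hT : ContMDiff (𝓡 k) ((𝓡 k).prod 𝓘(ℝ, Coord k →L[ℝ] Coord k →L[ℝ] ℝ)) ∞
      (fun p => Bundle.TotalSpace.mk' (Coord k →L[ℝ] Coord k →L[ℝ] ℝ) p (T p))) (a b : Fin k) :
    ContDiffAt ℝ ∞ (fun y => T (φ.symm y) (coordVector φ a y) (coordVector φ b y)) x := by
  have hs := (contMDiffOn_symm_of_mem_maximalAtlas hφ).contMDiffAt (φ.open_target.mem_nhds hx)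
  have h := ContMDiffAt.clm_bundle_apply₂ (F₁ := Coord k) (F₂ := Coord k) (F₃ := ℝ)
    (E₃ := Bundle.Trivial N ℝ) (b := φ.symm)
    ((hT.contMDiffAt (x := φ.symm x)).comp x hs) (contMDiffAt_coordVector hφ hx a)
    (contMDiffAt_coordVector hφ hx b)
  rw [Bundle.contMDiffAt_totalSpace] at h
  exact h.2.contDiffAt

theorem contDiffAt_comp₁ (hφ : φ ∈ IsManifold.maximalAtlas (𝓡 k) ∞ N) {x : Coord k}
    (hx : x ∈ φ.target)
    {T : ∀ p : N, TangentSpace (𝓡 k) p →L[ℝ] ℝ}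
    (hT : ContMDiff (𝓡 k) ((𝓡 k).prod 𝓘(ℝ, Coord k →L[ℝ] ℝ)) ∞
      (fun p => Bundle.TotalSpace.mk' (Coord k →L[ℝ] ℝ) p (T p))) (a : Fin k) :
    ContDiffAt ℝ ∞ (fun y => T (φ.symm y) (coordVector φ a y)) x := by
  have hs := (contMDiffOn_symm_of_mem_maximalAtlas hφ).contMDiffAt (φ.open_target.mem_nhds hx)
  have h := ContMDiffAt.clm_bundle_apply (F₁ := Coord k) (F₂ := ℝ)
    (E₂ := Bundle.Trivial N ℝ) (b := φ.symm)
    ((hT.contMDiffAt (x := φ.symm x)).comp x hs) (contMDiffAt_coordVector hφ hx a)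
  rw [Bundle.contMDiffAt_totalSpace] at h
  exact h.2.contDiffAt

namespace HypersurfaceData
variable (D : HypersurfaceData k N)

theorem inChart_isRegularAt (hφ : φ ∈ IsManifold.maximalAtlas (𝓡 k) ∞ N) {x : Coord k}
    (hx : x ∈ φ.target) : (D.inChart φ).IsRegularAt x := by
  have near : ∀ᶠ y in nhds x, y ∈ φ.target := φ.open_target.mem_nhds hx
  have ex1 : ∀ {y} (_ : y ∈ φ.target) (θ : TangentSpace (𝓡 k) (φ.symm y) →L[ℝ] ℝ)
      (V : TangentSpace (𝓡 k) (φ.symm y)),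
      ∑ b, θ (coordVector φ b y) * coordCovector φ b (φ.symm y) V = θ V := by
    intro y hy θ V
    conv_rhs => rw [expand_coordVector hφ hy V]
    simp [mul_comm]
  have p1 : ∀ {y} (_ : y ∈ φ.target) a, ∑ b, (D.inChart φ).γ a b y * (D.inChart φ).n b y
      + (D.inChart φ).n2 y * (D.inChart φ).ell a y = 0 := by
    intro y hy a
    refine Eq.trans ?_ (D.γ_n (φ.symm y) (coordVector φ a y))
    rw [D.γ_symm]
    exact congrArg (· + _) (ex1 hy (D.γ (φ.symm y) (coordVector φ a y)) (D.n (φ.symm y)))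
  have p2 : ∀ {y} (_ : y ∈ φ.target), ∑ a, (D.inChart φ).ell a y * (D.inChart φ).n a y
      + (D.inChart φ).n2 y * (D.inChart φ).ell2 y = 1 := by
    intro y hy
    refine Eq.trans ?_ (D.ell_n (φ.symm y))
    exact congrArg (· + _) (ex1 hy (D.ell (φ.symm y)) (D.n (φ.symm y)))
  have sP : ∀ y a b, (D.inChart φ).P a b y = (D.inChart φ).P b a y :=
    fun y a b => D.P_symm _ _ _
  have sγ : ∀ y a b, (D.inChart φ).γ a b y = (D.inChart φ).γ b a y :=
    fun y a b => D.γ_symm _ _ _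
  have exP : ∀ {y} (_ : y ∈ φ.target) (θ : TangentSpace (𝓡 k) (φ.symm y) →L[ℝ] ℝ) a,
      ∑ b, (D.inChart φ).P a b y * θ (coordVector φ b y)
        = θ (D.sharp (φ.symm y) (coordCovector φ a (φ.symm y)) 0).1 := by
    intro y hy θ a
    rw [← ex1 hy θ]
    refine Finset.sum_congr rfl fun b _ => ?_
    rw [mul_comm]
    exact congrArg (_ * ·) (D.P_eq _ _ _)
  have p3 : ∀ {y} (_ : y ∈ φ.target) a, ∑ b, (D.inChart φ).P a b y * (D.inChart φ).ell b y
      + (D.inChart φ).ell2 y * (D.inChart φ).n a y = 0 := by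
    intro y hy a
    have h := D.ell_sharp (φ.symm y) (coordCovector φ a (φ.symm y))
    rw [D.sharp_snd, mul_comm] at h
    exact Eq.trans (congrArg (· + _) (exP hy (D.ell (φ.symm y)) a)) h
  have p4 : ∀ {y} (_ : y ∈ φ.target) a c, ∑ b, (D.inChart φ).P a b y * (D.inChart φ).γ b c y
      + (D.inChart φ).n a y * (D.inChart φ).ell c y = if a = c then 1 else 0 := by
    intro y hy a c
    have h := D.γ_sharp (φ.symm y) (coordCovector φ a (φ.symm y)) (coordVector φ c y)
    rw [D.sharp_snd, coordCovector_coordVector hφ hy, D.γ_symm] at h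
    refine Eq.trans (congrArg (· + _) ?_) h
    rw [← exP hy (D.γ (φ.symm y) (coordVector φ c y)) a]
    exact Finset.sum_congr rfl fun b _ => congrArg (_ * ·) (D.γ_symm _ _ _)
  have dγ : ∀ a b, DifferentiableAt ℝ ((D.inChart φ).γ a b) x := fun a b =>
    (contDiffAt_comp₂ hφ hx D.γ_smooth a b).differentiableAt (by simp)
  have dℓ : ∀ a, DifferentiableAt ℝ ((D.inChart φ).ell a) x := fun a =>
    (contDiffAt_comp₁ hφ hx D.ell_smooth a).differentiableAt (by simp)
  have dℓ2 : DifferentiableAt ℝ (D.inChart φ).ell2 x := by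
    have hs := (contMDiffOn_symm_of_mem_maximalAtlas hφ).contMDiffAt (φ.open_target.mem_nhds hx)
    exact ((D.ell2_smooth.contMDiffAt (x := φ.symm x)).comp x hs).contDiffAt.differentiableAt
      (by simp)
  -- `n` and `n⁽²⁾` are entries of the inverse of the matrix of `𝒜`
  let M : Coord k → Matrix (Fin k ⊕ Unit) (Fin k ⊕ Unit) ℝ := fun y =>
    Matrix.fromBlocks (Matrix.of fun a b => (D.inChart φ).γ a b y)
      (Matrix.of fun a _ => (D.inChart φ).ell a y) (Matrix.of fun _ b => (D.inChart φ).ell b y)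
      (Matrix.of fun _ _ => (D.inChart φ).ell2 y)
  let W : Coord k → Matrix (Fin k ⊕ Unit) (Fin k ⊕ Unit) ℝ := fun y =>
    Matrix.fromBlocks (Matrix.of fun a b => (D.inChart φ).P a b y)
      (Matrix.of fun a _ => (D.inChart φ).n a y) (Matrix.of fun _ b => (D.inChart φ).n b y)
      (Matrix.of fun _ _ => (D.inChart φ).n2 y)
  have hMW : ∀ {y} (_ : y ∈ φ.target), W y * M y = 1 := by
    intro y hy
    ext i j
    rcases i with a | _ <;> rcases j with c | _
    · simpa [M, W, Matrix.fromBlocks_multiply, Matrix.mul_apply, Matrix.one_apply] using p4 hy a c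
    · simpa [M, W, Matrix.fromBlocks_multiply, Matrix.mul_apply, Matrix.one_apply, mul_comm]
        using p3 hy a
    · have := p1 hy c
      simp only [sγ y c] at this
      simpa [M, W, Matrix.fromBlocks_multiply, Matrix.mul_apply, Matrix.one_apply, mul_comm]
        using this
    · simpa [M, W, Matrix.fromBlocks_multiply, Matrix.mul_apply, Matrix.one_apply, mul_comm]
        using p2 hy
  have dM : ∀ i j, DifferentiableAt ℝ (fun y => M y i j) x := by
    rintro (a | _) (b | _)
    · exact dγ a b
    · exact dℓ a
    · exact dℓ b
    · exact dℓ2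
  have ddet : ∀ F : Coord k → Matrix (Fin k ⊕ Unit) (Fin k ⊕ Unit) ℝ,
      (∀ i j, DifferentiableAt ℝ (fun y => F y i j) x) →
      DifferentiableAt ℝ (fun y => (F y).det) x := by
    intro F hF
    simp only [Matrix.det_apply']
    refine DifferentiableAt.fun_sum fun σ _ => ?_
    refine (differentiableAt_const _).mul ?_
    exact (HasFDerivAt.finsetProd fun i _ => (hF (σ i) i).hasFDerivAt).differentiableAt
  have dinv : ∀ i j, DifferentiableAt ℝ (fun y => (M y)⁻¹ i j) x := by
    intro i j
    simp only [Matrix.inv_def, Matrix.smul_apply, smul_eq_mul, Ring.inverse_eq_inv',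
      Matrix.adjugate_apply]
    refine DifferentiableAt.mul ((ddet M dM).inv ?_) (ddet _ ?_)
    · intro h0
      have := congrArg Matrix.det (hMW hx)
      rw [Matrix.det_mul, h0] at this
      simp at this
    · intro a b
      by_cases hab : a = j
      · subst hab; simp
      · simpa [Matrix.updateRow_apply, hab] using dM a b
  have eqW : ∀ i j, (fun y => W y i j) =ᶠ[nhds x] fun y => (M y)⁻¹ i j := by
    intro i j
    filter_upwards [near] with y hy
    rw [Matrix.inv_eq_left_inv (hMW hy)]
  exact
    { γ_symm := Filter.Eventually.of_forall fun y a b => sγ y a b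
      P_symm := fun a b => sP x a b
      prod1 := by filter_upwards [near] with y hy using p1 hy
      prod2 := p2 hx
      prod3 := p3 hx
      prod4 := p4 hx
      γ_diff := dγ
      ell_diff := dℓ
      n_diff := fun a => (eqW (Sum.inl a) (Sum.inr ())).symm.differentiableAt_iff.1
        (dinv (Sum.inl a) (Sum.inr ()))
      n2_diff := (eqW (Sum.inr ()) (Sum.inr ())).symm.differentiableAt_iff.1
        (dinv (Sum.inr ()) (Sum.inr ())) }

/-- In a chart, the coefficients `mhConnection` are the only ones that satisfy the defining
equations of the metric hypersurface connection. -/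
theorem isMHConnectionAt_iff (hφ : φ ∈ IsManifold.maximalAtlas (𝓡 k) ∞ N) {x : Coord k}
    (hx : x ∈ φ.target) (G : Fin k → Fin k → Fin k → Coord k → ℝ) :
    (D.inChart φ).IsMHConnectionAt G x ↔ ∀ c a b, G c a b x = (D.inChart φ).mhConnection c a b x :=
  (D.inChart_isRegularAt hφ hx).isMHConnectionAt_iff G

end HypersurfaceData
end Bridge

end

/-!
The constraint tensor is evaluated on vectors tangent to the submanifold `f : S → N`, and every term
is expressed by tensors on `S`. All terms but the symmetrized Ricci tensor of the metric
hypersurface connection `∇°` are easy, once the second fundamental form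
`W(v, w) = ∇°_v (df w) - df (∇ʰ_v w)` is known. The covariant derivatives `∇°γ` and `∇°ℓ` determine
it (`NullStructure.Slice.second_eq`):
`W = U ⊗ ℓ♯ + Q ⊗ n`, with `Q_AB = ∇ʰ_(A ℓ_B) + (ℓ⁽²⁾ - ℓ⁽²⁾_∥) U_AB`, where `ℓ♯` is the pull-back
of `ℓ` with its index raised by `h`. This gives the covariant derivatives of `s` and `r` along `S`,
and the contractions with `P` follow from
`P = h⁻¹ - n ⊗ ℓ♯ - ℓ♯ ⊗ n - (ℓ⁽²⁾ - ℓ⁽²⁾_∥) n ⊗ n` (`NullStructure.Slice.IsInverse.sum_P`).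

The Ricci tensor is the trace of `V ↦ R(V, Y) Z`, taken in a frame that consists of a basis of `TS`
and `n` (`NullStructure.Slice.IsInverse.trace_eq`). Its tangential part is the `h`-trace of the
Gauss equation (`NullStructure.Slice.γ_curvature`), which comes from the Gauss–Codazzi identity
`curvature_map` and the form of `W`. Its transverse part is `q (R(n, Y) Z)` for the covector
`q = ℓ - γ(ℓ♯, ·)` that annihilates `TS` and satisfies `q(n) = 1`. Only its symmetrization in `Y, Z`
is needed, and this is expressed by first derivatives of `U`, `s`, `ℓ⁽²⁾`, `ℓ` and `n`: the
Ricci identity for `γ` and the Bianchi identity determine `γ(R(n, Y) Z, ·)`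
(`NullStructure.metric_curvature_n`), and the Ricci identity for `ℓ` determines `ℓ(R(n, Y) Z)`
(`NullStructure.ell_curvature_n`). The sum of both parts is
`NullStructure.Slice.IsInverse.ricciTensor_pullback`; with it the claim is an identity of
polynomials in tensors on `S` (`CoordData.IsTransverseMap.constraint_pullback`).

These computations use fields of continuous multilinear maps on open subsets of normed spaces
instead of components. The components in charts are compared with such fields at the end, where the
immersion property of the embedding and the transversality of `n` make `h` non-degenerate.
-/

noncomputable section

set_option maxSynthPendingDepth 3

/-! ### Covariant derivatives, curvature and the Ricci identities -/

section Calculus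

variable {E F : Type*} [NormedAddCommGroup E] [NormedSpace ℝ E] [NormedAddCommGroup F]
  [NormedSpace ℝ F]

/-- The covariant derivative `(∇_v θ)(w)` of a covector field, for the connection
`∇_v V = ∂_v V + Γ(v, V)` on a normed space. -/
def covDerivOne (Γ : E → E →L[ℝ] E →L[ℝ] E) (θ : E → E →L[ℝ] ℝ) (x v w : E) : ℝ :=
  fderiv ℝ θ x v w - θ x (Γ x v w)

/-- The covariant derivative `(∇_v T)(u, w)` of a `2`-covariant tensor field. -/
def covDerivTwo (Γ : E → E →L[ℝ] E →L[ℝ] E) (T : E → E →L[ℝ] E →L[ℝ] ℝ) (x v u w : E) : ℝ :=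
  fderiv ℝ T x v u w - T x (Γ x v u) w - T x u (Γ x v w)

/-- The covariant derivative `∇_v V` of a vector field. -/
def covDerivVec (Γ : E → E →L[ℝ] E →L[ℝ] E) (V : E → E) (x v : E) : E :=
  fderiv ℝ V x v + Γ x v (V x)

/-- The Lie derivative `(£_V T)(u, w)` of a `2`-covariant tensor field. -/
def lieDerivTwo (V : E → E) (T : E → E →L[ℝ] E →L[ℝ] ℝ) (x u w : E) : ℝ :=
  fderiv ℝ T x (V x) u w + T x (fderiv ℝ V x u) w + T x u (fderiv ℝ V x w)

/-- The curvature `R(v, w) u = ∇_v ∇_w u - ∇_w ∇_v u` of the connection `∇_v V = ∂_v V + Γ(v, V)`,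
for constant vector fields `v`, `w`, `u`. -/
def curvature (Γ : E → E →L[ℝ] E →L[ℝ] E) (x v w u : E) : E :=
  fderiv ℝ Γ x v w u - fderiv ℝ Γ x w v u + Γ x v (Γ x w u) - Γ x w (Γ x v u)

variable {Γ : E → E →L[ℝ] E →L[ℝ] E} {x : E}

theorem curvature_swap (v w u : E) : curvature Γ x v w u = -curvature Γ x w v u := by
  simp only [curvature]; abel

theorem fderiv_connection_symm (hΓ : DifferentiableAt ℝ Γ x)
    (hs : ∀ᶠ y in nhds x, ∀ v w, Γ y v w = Γ y w v) (z v w : E) :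
    fderiv ℝ Γ x z v w = fderiv ℝ Γ x z w v := by
  have h1 := (hΓ.hasFDerivAt.clm_apply (hasFDerivAt_const v x)).clm_apply (hasFDerivAt_const w x)
  have h2 := (hΓ.hasFDerivAt.clm_apply (hasFDerivAt_const w x)).clm_apply (hasFDerivAt_const v x)
  have h3 := h1.unique (h2.congr_of_eventuallyEq (hs.mono fun y hy => hy v w))
  simpa using congrArg (fun l => l z) h3

/-- The first Bianchi identity. -/
theorem curvature_bianchi (hΓ : DifferentiableAt ℝ Γ x)
    (hs : ∀ᶠ y in nhds x, ∀ v w, Γ y v w = Γ y w v) (v w u : E) :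
    curvature Γ x v w u + curvature Γ x w u v + curvature Γ x u v w = 0 := by
  have d := fderiv_connection_symm hΓ hs
  have s := hs.self_of_nhds
  simp only [curvature]
  rw [d v w u, d w v u, d u w v, s w u, s v u, s w v]
  abel

theorem fderiv_lin_apply {H : Type*} [NormedAddCommGroup H] [NormedSpace ℝ H]
    {T : E → F →L[ℝ] H} {a : E → F}
    (hT : DifferentiableAt ℝ T x) (ha : DifferentiableAt ℝ a x)
    (v : E) : fderiv ℝ (fun y => T y (a y)) x v
      = fderiv ℝ T x v (a x) + T x (fderiv ℝ a x v) := by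
  rw [(hT.hasFDerivAt.clm_apply ha.hasFDerivAt).fderiv]
  simp [add_comm]

theorem fderiv_bilin_apply {H : Type*} [NormedAddCommGroup H] [NormedSpace ℝ H]
    {F' : Type*} [NormedAddCommGroup F'] [NormedSpace ℝ F']
    {T : E → F →L[ℝ] F' →L[ℝ] H} {a : E → F} {b : E → F'}
    (hT : DifferentiableAt ℝ T x) (ha : DifferentiableAt ℝ a x) (hb : DifferentiableAt ℝ b x)
    (v : E) : fderiv ℝ (fun y => T y (a y) (b y)) x v
      = fderiv ℝ T x v (a x) (b x) + T x (fderiv ℝ a x v) (b x) + T x (a x) (fderiv ℝ b x v) := by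
  rw [((hT.hasFDerivAt.clm_apply ha.hasFDerivAt).clm_apply hb.hasFDerivAt).fderiv]
  simp
  abel

/-- The Ricci identity for a covector field `θ`. The tensor field `K` is `∇θ`, taken with values in
continuous bilinear forms so that it can be differentiated again. -/
theorem apply_curvature (hΓ : DifferentiableAt ℝ Γ x) (hs : ∀ v w, Γ x v w = Γ x w v)
    {θ : E → E →L[ℝ] ℝ} (hθ : ContDiffAt ℝ 2 θ x) {K : E → E →L[ℝ] E →L[ℝ] ℝ}
    (hK : DifferentiableAt ℝ K x)
    (e : ∀ᶠ y in nhds x, ∀ v w, covDerivOne Γ θ y v w = K y v w) (v w u : E) :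
    θ x (curvature Γ x v w u) = covDerivTwo Γ K x w v u - covDerivTwo Γ K x v w u := by
  have dθ : DifferentiableAt ℝ θ x := hθ.differentiableAt (by simp)
  have ddθ : DifferentiableAt ℝ (fderiv ℝ θ) x :=
    (hθ.fderiv_right (m := 1) (by norm_num)).differentiableAt (by simp)
  have key : ∀ v w u, fderiv ℝ K x v w u = fderiv ℝ (fderiv ℝ θ) x v w u
      - fderiv ℝ θ x v (Γ x w u) - θ x (fderiv ℝ Γ x v w u) := by
    intro v w u
    have h1 := congrArg (fun l => l v)
      (Filter.EventuallyEq.fderiv_eq (𝕜 := ℝ) (e.mono fun y hy => hy w u))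
    have c1 := differentiableAt_const (𝕜 := ℝ) (x := x) w
    have c2 := differentiableAt_const (𝕜 := ℝ) (x := x) u
    have d1 : DifferentiableAt ℝ (fun y => fderiv ℝ θ y w u) x := (ddθ.clm_apply c1).clm_apply c2
    have d2 : DifferentiableAt ℝ (fun y => Γ y w u) x := (hΓ.clm_apply c1).clm_apply c2
    have e2 := fderiv_bilin_apply hK c1 c2 v
    simp only [covDerivOne] at h1
    rw [fderiv_fun_sub d1 (dθ.clm_apply d2), sub_apply, fderiv_bilin_apply ddθ c1 c2,
      fderiv_lin_apply dθ d2, fderiv_bilin_apply hΓ c1 c2, e2] at h1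
    simp at h1
    linarith
  have sy : fderiv ℝ (fderiv ℝ θ) x v w u = fderiv ℝ (fderiv ℝ θ) x w v u := by
    have := (hθ.isSymmSndFDerivAt (by simp)) v w
    rw [this]
  have e0 := e.self_of_nhds
  simp only [covDerivOne] at e0
  simp only [covDerivTwo, curvature, key, ← e0, map_add, map_sub, hs w v, sy]
  ring

/-- The Ricci identity for a `2`-covariant tensor field `γ` with
`(∇_v γ)(u, z) = -U(v, u) ℓ(z) - U(v, z) ℓ(u)`. -/
theorem bilin_curvature_add (hΓ : DifferentiableAt ℝ Γ x) (hs : ∀ v w, Γ x v w = Γ x w v)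
    {γ : E → E →L[ℝ] E →L[ℝ] ℝ} (hγ : ContDiffAt ℝ 2 γ x) {U : E → E →L[ℝ] E →L[ℝ] ℝ}
    (hU : DifferentiableAt ℝ U x) {ℓ : E → E →L[ℝ] ℝ} (hℓ : DifferentiableAt ℝ ℓ x)
    (e : ∀ᶠ y in nhds x, ∀ v u w, covDerivTwo Γ γ y v u w = -U y v u * ℓ y w - U y v w * ℓ y u)
    (v w u z : E) :
    γ x (curvature Γ x v w u) z + γ x u (curvature Γ x v w z)
      = (covDerivTwo Γ U x v w u * ℓ x z + U x w u * covDerivOne Γ ℓ x v z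
          + covDerivTwo Γ U x v w z * ℓ x u + U x w z * covDerivOne Γ ℓ x v u)
        - (covDerivTwo Γ U x w v u * ℓ x z + U x v u * covDerivOne Γ ℓ x w z
          + covDerivTwo Γ U x w v z * ℓ x u + U x v z * covDerivOne Γ ℓ x w u) := by
  have dγ : DifferentiableAt ℝ γ x := hγ.differentiableAt (by simp)
  have c0 : ∀ w : E, DifferentiableAt ℝ (fun _ : E => w) x := fun w => differentiableAt_const w
  have hg : ContDiffAt ℝ 2 (fun y => γ y u z) x :=
    (hγ.clm_apply contDiffAt_const).clm_apply contDiffAt_const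
  have ddg : DifferentiableAt ℝ (fderiv ℝ fun y => γ y u z) x :=
    (hg.fderiv_right (m := 1) (by norm_num)).differentiableAt (by simp)
  have key : ∀ v w, fderiv ℝ (fderiv ℝ fun y => γ y u z) x v w =
      fderiv ℝ γ x v (Γ x w u) z + γ x (fderiv ℝ Γ x v w u) z
      + fderiv ℝ γ x v u (Γ x w z) + γ x u (fderiv ℝ Γ x v w z)
      - (fderiv ℝ U x v w u * ℓ x z + U x w u * fderiv ℝ ℓ x v z)
      - (fderiv ℝ U x v w z * ℓ x u + U x w z * fderiv ℝ ℓ x v u) := by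
    intro v w
    have e' : ∀ᶠ y in nhds x, fderiv ℝ (fun y => γ y u z) y w = γ y (Γ y w u) z + γ y u (Γ y w z)
        - U y w u * ℓ y z - U y w z * ℓ y u := by
      filter_upwards [e, hγ.eventually (by simp)] with y hy hd
      have h := hy w u z
      rw [fderiv_bilin_apply (hd.differentiableAt (by simp)) (differentiableAt_const u)
        (differentiableAt_const z)]
      simp only [covDerivTwo] at h
      simp
      linarith
    have h1 := congrArg (fun l => l v) (Filter.EventuallyEq.fderiv_eq (𝕜 := ℝ) e')
    have d2 : ∀ u, DifferentiableAt ℝ (fun y => Γ y w u) x :=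
      fun u => (hΓ.clm_apply (c0 w)).clm_apply (c0 u)
    have d4 : DifferentiableAt ℝ (fun y => γ y (Γ y w u) z) x :=
      (dγ.clm_apply (d2 u)).clm_apply (c0 z)
    have d5 : DifferentiableAt ℝ (fun y => γ y u (Γ y w z)) x :=
      (dγ.clm_apply (c0 u)).clm_apply (d2 z)
    have d6 : ∀ u, DifferentiableAt ℝ (fun y => U y w u) x :=
      fun u => (hU.clm_apply (c0 w)).clm_apply (c0 u)
    have d8 : ∀ u, DifferentiableAt ℝ (fun y => ℓ y u) x := fun u => hℓ.clm_apply (c0 u)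
    rw [fderiv_fun_sub ((d4.fun_add d5).fun_sub ((d6 u).fun_mul (d8 z))) ((d6 z).fun_mul (d8 u)),
      fderiv_fun_sub (d4.fun_add d5) ((d6 u).fun_mul (d8 z)), fderiv_fun_add d4 d5,
      fderiv_fun_mul (d6 u) (d8 z), fderiv_fun_mul (d6 z) (d8 u)] at h1
    simp only [add_apply, sub_apply, smul_apply] at h1
    rw [fderiv_lin_apply ddg (c0 w), fderiv_bilin_apply dγ (d2 u) (c0 z),
      fderiv_bilin_apply dγ (c0 u) (d2 z),
      fderiv_bilin_apply hΓ (c0 w) (c0 u), fderiv_bilin_apply hΓ (c0 w) (c0 z),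
      fderiv_bilin_apply hU (c0 w) (c0 u), fderiv_bilin_apply hU (c0 w) (c0 z),
      fderiv_lin_apply hℓ (c0 u), fderiv_lin_apply hℓ (c0 z)] at h1
    simp at h1
    linarith
  have sy := (hg.isSymmSndFDerivAt (by simp)) v w
  rw [key, key] at sy
  have e0 := e.self_of_nhds
  simp only [covDerivTwo] at e0
  have f1 := e0 v (Γ x w u) z
  have f2 := e0 v u (Γ x w z)
  have f3 := e0 w (Γ x v u) z
  have f4 := e0 w u (Γ x v z)
  simp only [covDerivTwo, covDerivOne, curvature, map_add, map_sub, add_apply, sub_apply, hs w v]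
  linear_combination sy - f1 - f2 + f3 + f4

end Calculus

/-! ### Submanifolds of a space with a connection -/

section Immersions

variable {E F : Type*} [NormedAddCommGroup E] [NormedSpace ℝ E] [NormedAddCommGroup F]
  [NormedSpace ℝ F]

/-- The second fundamental form `D_v (df w) - df (∇_v w)` of a map `f` between spaces with
connections `Γ` (on the target) and `Γh` (on the source). -/
def secondForm (Γ : E → E →L[ℝ] E →L[ℝ] E) (Γh : F → F →L[ℝ] F →L[ℝ] F) (f : F → E)
    (z v w : F) : E :=
  fderiv ℝ (fderiv ℝ f) z v w + Γ (f z) (fderiv ℝ f z v) (fderiv ℝ f z w)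
    - fderiv ℝ f z (Γh z v w)

variable {Γ : E → E →L[ℝ] E →L[ℝ] E} {Γh : F → F →L[ℝ] F →L[ℝ] F} {f : F → E} {z : F}

theorem secondForm_symm (hf : ContDiffAt ℝ 2 f z) (hΓ : ∀ v w, Γ (f z) v w = Γ (f z) w v)
    (hΓh : ∀ v w, Γh z v w = Γh z w v) (v w : F) :
    secondForm Γ Γh f z v w = secondForm Γ Γh f z w v := by
  have := (hf.isSymmSndFDerivAt (by simp)) v w
  rw [secondForm, secondForm, this, hΓ, hΓh]

/-- The covariant derivative of the pull-back of a covector field differs from the pull-back of the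
covariant derivative by a contraction with the second fundamental form. -/
theorem covDerivOne_pullback (hf : ContDiffAt ℝ 2 f z) {T : E → E →L[ℝ] ℝ}
    (hT : DifferentiableAt ℝ T (f z)) {TS : F → F →L[ℝ] ℝ} (hTS : DifferentiableAt ℝ TS z)
    (e : ∀ᶠ y in nhds z, ∀ v, TS y v = T (f y) (fderiv ℝ f y v)) (v w : F) :
    covDerivOne Γh TS z v w = covDerivOne Γ T (f z) (fderiv ℝ f z v) (fderiv ℝ f z w)
      + T (f z) (secondForm Γ Γh f z v w) := by
  have df : DifferentiableAt ℝ f z := hf.differentiableAt (by simp)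
  have ddf : DifferentiableAt ℝ (fderiv ℝ f) z :=
    (hf.fderiv_right (m := 1) (by norm_num)).differentiableAt (by simp)
  have c (u : F) := differentiableAt_const (𝕜 := ℝ) (x := z) u
  have h1 := congrArg (fun l => l v)
    (Filter.EventuallyEq.fderiv_eq (𝕜 := ℝ) (e.mono fun y hy => hy w))
  have h2 : HasFDerivAt (fun y => T (f y)) ((fderiv ℝ T (f z)).comp (fderiv ℝ f z)) z :=
    hT.hasFDerivAt.comp z df.hasFDerivAt
  rw [fderiv_lin_apply hTS (c w), fderiv_lin_apply h2.differentiableAt (ddf.clm_apply (c w)),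
    fderiv_lin_apply ddf (c w), h2.fderiv] at h1
  simp at h1
  have e0 := e.self_of_nhds
  simp only [covDerivOne, secondForm, h1, e0, map_add, map_sub]
  ring

theorem covDerivTwo_pullback (hf : ContDiffAt ℝ 2 f z) {T : E → E →L[ℝ] E →L[ℝ] ℝ}
    (hT : DifferentiableAt ℝ T (f z)) {TS : F → F →L[ℝ] F →L[ℝ] ℝ} (hTS : DifferentiableAt ℝ TS z)
    (e : ∀ᶠ y in nhds z, ∀ v w, TS y v w = T (f y) (fderiv ℝ f y v) (fderiv ℝ f y w))
    (v u w : F) :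
    covDerivTwo Γh TS z v u w
      = covDerivTwo Γ T (f z) (fderiv ℝ f z v) (fderiv ℝ f z u) (fderiv ℝ f z w)
        + T (f z) (secondForm Γ Γh f z v u) (fderiv ℝ f z w)
        + T (f z) (fderiv ℝ f z u) (secondForm Γ Γh f z v w) := by
  have df : DifferentiableAt ℝ f z := hf.differentiableAt (by simp)
  have ddf : DifferentiableAt ℝ (fderiv ℝ f) z :=
    (hf.fderiv_right (m := 1) (by norm_num)).differentiableAt (by simp)
  have c (u : F) := differentiableAt_const (𝕜 := ℝ) (x := z) u
  have h1 := congrArg (fun l => l v)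
    (Filter.EventuallyEq.fderiv_eq (𝕜 := ℝ) (e.mono fun y hy => hy u w))
  have h2 : HasFDerivAt (fun y => T (f y)) ((fderiv ℝ T (f z)).comp (fderiv ℝ f z)) z :=
    hT.hasFDerivAt.comp z df.hasFDerivAt
  rw [fderiv_bilin_apply hTS (c u) (c w), fderiv_bilin_apply h2.differentiableAt
    (ddf.clm_apply (c u)) (ddf.clm_apply (c w)),
    fderiv_lin_apply ddf (c w), fderiv_lin_apply ddf (c u), h2.fderiv] at h1
  simp at h1
  have e0 := e.self_of_nhds
  simp only [covDerivTwo, secondForm, h1, e0, map_add, map_sub, add_apply, sub_apply]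
  ring

theorem differentiableAt_secondForm (hf : ContDiffAt ℝ 3 f z) (hΓ : DifferentiableAt ℝ Γ (f z))
    (hΓh : DifferentiableAt ℝ Γh z) (w u : F) :
    DifferentiableAt ℝ (fun y => secondForm Γ Γh f y w u) z := by
  have df : DifferentiableAt ℝ f z := hf.differentiableAt (by simp)
  have cdf : ContDiffAt ℝ 2 (fderiv ℝ f) z := hf.fderiv_right (m := 2) (by norm_num)
  have ddf : DifferentiableAt ℝ (fderiv ℝ f) z := cdf.differentiableAt (by simp)
  have dddf : DifferentiableAt ℝ (fderiv ℝ (fderiv ℝ f)) z :=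
    (cdf.fderiv_right (m := 1) (by norm_num)).differentiableAt (by simp)
  have c (u : F) := differentiableAt_const (𝕜 := ℝ) (x := z) u
  have hc : HasFDerivAt (fun y => Γ (f y)) ((fderiv ℝ Γ (f z)).comp (fderiv ℝ f z)) z :=
    hΓ.hasFDerivAt.comp z df.hasFDerivAt
  have d1 (u : F) : DifferentiableAt ℝ (fun y => fderiv ℝ f y u) z := ddf.clm_apply (c u)
  exact (((dddf.clm_apply (c w)).clm_apply (c u)).add
    ((hc.differentiableAt.clm_apply (d1 w)).clm_apply (d1 u))).sub
    (ddf.clm_apply ((hΓh.clm_apply (c w)).clm_apply (c u)))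

/-- The covariant derivative `(D_v W)(w, u)` of the second fundamental form `W` of a map. -/
def covDerivSecondForm (Γ : E → E →L[ℝ] E →L[ℝ] E) (Γh : F → F →L[ℝ] F →L[ℝ] F) (f : F → E)
    (z v w u : F) : E :=
  fderiv ℝ (fun y => secondForm Γ Γh f y w u) z v
    + Γ (f z) (fderiv ℝ f z v) (secondForm Γ Γh f z w u)
    - secondForm Γ Γh f z (Γh z v w) u - secondForm Γ Γh f z w (Γh z v u)

/-- The Gauss–Codazzi identity: `R(df v, df w) df u` is the image of the curvature of the source
plus the exterior covariant derivative of the second fundamental form. -/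
theorem curvature_map (hf : ContDiffAt ℝ 3 f z) (hΓ : DifferentiableAt ℝ Γ (f z))
    (hΓh : DifferentiableAt ℝ Γh z) (hΓhs : ∀ v w, Γh z v w = Γh z w v) (v w u : F) :
    curvature Γ (f z) (fderiv ℝ f z v) (fderiv ℝ f z w) (fderiv ℝ f z u)
      = fderiv ℝ f z (curvature Γh z v w u)
        + covDerivSecondForm Γ Γh f z v w u - covDerivSecondForm Γ Γh f z w v u := by
  have df : DifferentiableAt ℝ f z := hf.differentiableAt (by simp)
  have cdf : ContDiffAt ℝ 2 (fderiv ℝ f) z := hf.fderiv_right (m := 2) (by norm_num)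
  have ddf : DifferentiableAt ℝ (fderiv ℝ f) z := cdf.differentiableAt (by simp)
  have dddf : DifferentiableAt ℝ (fderiv ℝ (fderiv ℝ f)) z :=
    (cdf.fderiv_right (m := 1) (by norm_num)).differentiableAt (by simp)
  have c (u : F) := differentiableAt_const (𝕜 := ℝ) (x := z) u
  have hg : ContDiffAt ℝ 2 (fun y => fderiv ℝ f y u) z := cdf.clm_apply contDiffAt_const
  have ddg : DifferentiableAt ℝ (fderiv ℝ fun y => fderiv ℝ f y u) z :=
    (hg.fderiv_right (m := 1) (by norm_num)).differentiableAt (by simp)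
  have hc : HasFDerivAt (fun y => Γ (f y)) ((fderiv ℝ Γ (f z)).comp (fderiv ℝ f z)) z :=
    hΓ.hasFDerivAt.comp z df.hasFDerivAt
  have d1 (u : F) : DifferentiableAt ℝ (fun y => fderiv ℝ f y u) z := ddf.clm_apply (c u)
  have key : ∀ v w, fderiv ℝ (fun y => secondForm Γ Γh f y w u) z v
      = fderiv ℝ (fderiv ℝ fun y => fderiv ℝ f y u) z v w
      + fderiv ℝ Γ (f z) (fderiv ℝ f z v) (fderiv ℝ f z w) (fderiv ℝ f z u)
      + Γ (f z) (fderiv ℝ (fderiv ℝ f) z v w) (fderiv ℝ f z u)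
      + Γ (f z) (fderiv ℝ f z w) (fderiv ℝ (fderiv ℝ f) z v u)
      - fderiv ℝ (fderiv ℝ f) z v (Γh z w u) - fderiv ℝ f z (fderiv ℝ Γh z v w u) := by
    intro v w
    have e' : (fun y => secondForm Γ Γh f y w u) =ᶠ[nhds z]
        fun y => fderiv ℝ (fun y => fderiv ℝ f y u) y w
        + Γ (f y) (fderiv ℝ f y w) (fderiv ℝ f y u) - fderiv ℝ f y (Γh y w u) := by
      filter_upwards [cdf.eventually (by simp)] with y hd
      rw [fderiv_lin_apply (hd.differentiableAt (by simp)) (differentiableAt_const u)]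
      simp [secondForm]
    have d2 : DifferentiableAt ℝ (fun y => Γ (f y) (fderiv ℝ f y w) (fderiv ℝ f y u)) z :=
      (hc.differentiableAt.clm_apply (d1 w)).clm_apply (d1 u)
    have d3 : DifferentiableAt ℝ (fun y => Γh y w u) z := (hΓh.clm_apply (c w)).clm_apply (c u)
    rw [e'.fderiv_eq, fderiv_fun_sub ((ddg.clm_apply (c w)).fun_add d2) (ddf.clm_apply d3),
      fderiv_fun_add (ddg.clm_apply (c w)) d2]
    simp only [add_apply, sub_apply]
    rw [fderiv_lin_apply ddg (c w), fderiv_lin_apply ddf d3,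
      fderiv_bilin_apply hc.differentiableAt (d1 w) (d1 u), hc.fderiv,
      fderiv_bilin_apply hΓh (c w) (c u), fderiv_lin_apply ddf (c w),
      fderiv_lin_apply ddf (c u) v]
    simp
    abel
  have sy := (hg.isSymmSndFDerivAt (by simp)) v w
  have sf := (hf.of_le (m := 2) (by norm_num)).isSymmSndFDerivAt (by simp)
  rw [covDerivSecondForm, covDerivSecondForm, key, key, sy, sf.eq v w, hΓhs w v]
  simp only [secondForm, curvature, map_add, map_sub]
  rw [sf.eq w (Γh z v u), sf.eq v (Γh z w u)]
  rw [sf.eq (Γh z v u) w, sf.eq (Γh z w u) v]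
  abel

end Immersions

/-! ### Null metric hypersurface data and the curvature in the direction `n` -/

section Null

variable {E : Type*} [NormedAddCommGroup E] [NormedSpace ℝ E]

/-- Null metric hypersurface data on an open set `Ω` of a normed space, together with the vector
field `n`, the metric hypersurface connection `Γ`, the tensor `U = ½ £_n γ` and the covector
`s = F(n, ·)`. The tensor fields take values in continuous multilinear forms, and only their values
on `Ω` are relevant. -/
structure NullStructure (Ω : Set E) where
  /-- the degenerate metric -/
  γ : E → E →L[ℝ] E →L[ℝ] ℝ
  /-- the covector field `ℓ` -/
  ell : E → E →L[ℝ] ℝ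
  /-- the scalar `ℓ⁽²⁾` -/
  ell2 : E → ℝ
  /-- the null generator, which spans the radical of `γ` -/
  n : E → E
  /-- the connection coefficients -/
  Γ : E → E →L[ℝ] E →L[ℝ] E
  /-- half the Lie derivative of `γ` along `n` -/
  U : E → E →L[ℝ] E →L[ℝ] ℝ
  /-- the covector field `½ dℓ(n, ·)` -/
  s : E → E →L[ℝ] ℝ
  isOpen : IsOpen Ω
  γ_smooth : ∀ x ∈ Ω, ContDiffAt ℝ ∞ γ x
  ell_smooth : ∀ x ∈ Ω, ContDiffAt ℝ ∞ ell x
  ell2_smooth : ∀ x ∈ Ω, ContDiffAt ℝ ∞ ell2 x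
  n_smooth : ∀ x ∈ Ω, ContDiffAt ℝ ∞ n x
  Γ_smooth : ∀ x ∈ Ω, ContDiffAt ℝ ∞ Γ x
  U_smooth : ∀ x ∈ Ω, ContDiffAt ℝ ∞ U x
  s_smooth : ∀ x ∈ Ω, ContDiffAt ℝ ∞ s x
  γ_symm : ∀ x ∈ Ω, ∀ v w, γ x v w = γ x w v
  γ_n : ∀ x ∈ Ω, ∀ w, γ x (n x) w = 0
  ell_n : ∀ x ∈ Ω, ell x (n x) = 1
  U_eq : ∀ x ∈ Ω, ∀ v w, U x v w = lieDerivTwo n γ x v w / 2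
  s_eq : ∀ x ∈ Ω, ∀ v, s x v = (fderiv ℝ ell x (n x) v - fderiv ℝ ell x v (n x)) / 2
  Γ_symm : ∀ x ∈ Ω, ∀ v w, Γ x v w = Γ x w v
  covDeriv_γ : ∀ x ∈ Ω, ∀ v u w,
    covDerivTwo Γ γ x v u w = -U x v u * ell x w - U x v w * ell x u
  covDeriv_ell : ∀ x ∈ Ω, ∀ v w,
    covDerivOne Γ ell x v w + covDerivOne Γ ell x w v = -2 * ell2 x * U x v w

namespace NullStructure

variable {Ω : Set E} (D : NullStructure Ω) {x : E}

/-- The two-form `F = ½ dℓ`. -/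
def F (x : E) : E →L[ℝ] E →L[ℝ] ℝ :=
  (1 / 2 : ℝ) • (fderiv ℝ D.ell x - (fderiv ℝ D.ell x).flip)

theorem F_apply (x v w : E) : D.F x v w = (fderiv ℝ D.ell x v w - fderiv ℝ D.ell x w v) / 2 := by
  simp [F]; ring

theorem eventually_mem (D : NullStructure Ω) (hx : x ∈ Ω) : ∀ᶠ y in nhds x, y ∈ Ω :=
  D.isOpen.mem_nhds hx

theorem fderiv_γ_symm (hx : x ∈ Ω) (z v w : E) :
    fderiv ℝ D.γ x z v w = fderiv ℝ D.γ x z w v := by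
  have d := (D.γ_smooth x hx).differentiableAt (by simp)
  have h := congrArg (fun l => l z) (Filter.EventuallyEq.fderiv_eq (𝕜 := ℝ)
    ((D.eventually_mem hx).mono fun y hy => D.γ_symm y hy v w))
  rw [fderiv_bilin_apply d (differentiableAt_const v) (differentiableAt_const w),
    fderiv_bilin_apply d (differentiableAt_const w) (differentiableAt_const v)] at h
  simpa using h

theorem U_symm (hx : x ∈ Ω) (v w : E) : D.U x v w = D.U x w v := by
  rw [D.U_eq x hx, D.U_eq x hx]
  simp only [lieDerivTwo]
  rw [D.fderiv_γ_symm hx _ v w, D.γ_symm x hx v, D.γ_symm x hx w]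
  ring

theorem fderiv_γ_n (hx : x ∈ Ω) (v w : E) :
    fderiv ℝ D.γ x v (D.n x) w + D.γ x (fderiv ℝ D.n x v) w = 0 := by
  have h := congrArg (fun l => l v) (Filter.EventuallyEq.fderiv_eq (𝕜 := ℝ)
    ((D.eventually_mem hx).mono fun y hy => D.γ_n y hy w))
  rw [fderiv_bilin_apply ((D.γ_smooth x hx).differentiableAt (by simp))
    ((D.n_smooth x hx).differentiableAt (by simp)) (differentiableAt_const w)] at h
  simpa using h

theorem U_n (hx : x ∈ Ω) (w : E) : D.U x (D.n x) w = 0 := by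
  rw [D.U_eq x hx, lieDerivTwo, D.fderiv_γ_n hx, D.γ_n x hx]
  simp

/-- The antisymmetric part of `∇ℓ` is `F` as the connection is torsion-free, and its symmetric part
is prescribed. -/
theorem covDeriv_ell_eq (hx : x ∈ Ω) (v w : E) :
    covDerivOne D.Γ D.ell x v w = D.F x v w - D.ell2 x * D.U x v w := by
  have h := D.covDeriv_ell x hx v w
  rw [F_apply]
  simp only [covDerivOne] at h ⊢
  rw [D.Γ_symm x hx w v] at h
  linarith

theorem s_eq_F (hx : x ∈ Ω) (v : E) : D.s x v = D.F x (D.n x) v := by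
  rw [D.s_eq x hx, F_apply]

theorem F_swap (x v w : E) : D.F x v w = -D.F x w v := by
  rw [F_apply, F_apply]; ring

theorem s_n (hx : x ∈ Ω) : D.s x (D.n x) = 0 := by
  rw [D.s_eq x hx]; simp

/-- Together with `ell_covDeriv_n` this determines the covariant derivative of `n`, since the
radical of `γ` is spanned by `n` and `ℓ(n) = 1`. -/
theorem γ_covDeriv_n (hx : x ∈ Ω) (v w : E) :
    D.γ x (covDerivVec D.Γ D.n x v) w = D.U x v w := by
  have h := D.covDeriv_γ x hx v (D.n x) w
  simp only [covDerivTwo] at h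
  rw [D.γ_n x hx, D.ell_n x hx, D.U_symm hx v (D.n x), D.U_n hx] at h
  have h2 := D.fderiv_γ_n hx v w
  simp only [covDerivVec, map_add, add_apply]
  linarith

theorem ell_covDeriv_n (hx : x ∈ Ω) (v : E) :
    D.ell x (covDerivVec D.Γ D.n x v) = D.s x v := by
  have h := congrArg (fun l => l v) (Filter.EventuallyEq.fderiv_eq (𝕜 := ℝ)
    ((D.eventually_mem hx).mono fun y hy => D.ell_n y hy))
  rw [fderiv_lin_apply ((D.ell_smooth x hx).differentiableAt (by simp))
    ((D.n_smooth x hx).differentiableAt (by simp))] at h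
  have h2 := D.covDeriv_ell_eq hx v (D.n x)
  rw [D.U_symm hx v (D.n x), D.U_n hx, D.F_swap, ← D.s_eq_F hx] at h2
  simp only [covDerivOne] at h2
  simp only [covDerivVec, map_add]
  simp at h
  linarith

theorem lieDerivTwo_U (hx : x ∈ Ω) (u w : E) :
    lieDerivTwo D.n D.U x u w = covDerivTwo D.Γ D.U x (D.n x) u w
      + D.U x (covDerivVec D.Γ D.n x u) w + D.U x u (covDerivVec D.Γ D.n x w) := by
  simp only [lieDerivTwo, covDerivTwo, covDerivVec, map_add, add_apply,
    D.Γ_symm x hx (D.n x)]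
  ring

theorem U_covDeriv_n_symm (hx : x ∈ Ω) (u w : E) :
    D.U x (covDerivVec D.Γ D.n x u) w = D.U x u (covDerivVec D.Γ D.n x w) := by
  rw [D.U_symm hx, ← D.γ_covDeriv_n hx, ← D.γ_covDeriv_n hx, D.γ_symm x hx]

theorem fderiv_U_symm (hx : x ∈ Ω) (z v w : E) :
    fderiv ℝ D.U x z v w = fderiv ℝ D.U x z w v := by
  have d := (D.U_smooth x hx).differentiableAt (by simp)
  have h := congrArg (fun l => l z) (Filter.EventuallyEq.fderiv_eq (𝕜 := ℝ)
    ((D.eventually_mem hx).mono fun y hy => D.U_symm hy v w))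
  rw [fderiv_bilin_apply d (differentiableAt_const v) (differentiableAt_const w),
    fderiv_bilin_apply d (differentiableAt_const w) (differentiableAt_const v)] at h
  simpa using h

theorem covDeriv_U_symm (hx : x ∈ Ω) (z v w : E) :
    covDerivTwo D.Γ D.U x z v w = covDerivTwo D.Γ D.U x z w v := by
  simp only [covDerivTwo]
  rw [D.fderiv_U_symm hx z v w, D.U_symm hx v, D.U_symm hx w]
  ring

theorem covDeriv_U_n (hx : x ∈ Ω) (v w : E) :
    covDerivTwo D.Γ D.U x v (D.n x) w = -D.U x (covDerivVec D.Γ D.n x v) w := by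
  have h := congrArg (fun l => l v) (Filter.EventuallyEq.fderiv_eq (𝕜 := ℝ)
    ((D.eventually_mem hx).mono fun y hy => D.U_n hy w))
  rw [fderiv_bilin_apply ((D.U_smooth x hx).differentiableAt (by simp))
    ((D.n_smooth x hx).differentiableAt (by simp)) (differentiableAt_const w)] at h
  simp only [covDerivTwo, covDerivVec, map_add, add_apply, D.U_n hx]
  simp at h
  linarith

/-- The Ricci identity for `γ`. -/
theorem metric_curvature_add (hx : x ∈ Ω) (v w u z : E) :
    D.γ x (curvature D.Γ x v w u) z + D.γ x u (curvature D.Γ x v w z)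
      = (covDerivTwo D.Γ D.U x v w u * D.ell x z + D.U x w u * covDerivOne D.Γ D.ell x v z
          + covDerivTwo D.Γ D.U x v w z * D.ell x u + D.U x w z * covDerivOne D.Γ D.ell x v u)
        - (covDerivTwo D.Γ D.U x w v u * D.ell x z + D.U x v u * covDerivOne D.Γ D.ell x w z
          + covDerivTwo D.Γ D.U x w v z * D.ell x u + D.U x v z * covDerivOne D.Γ D.ell x w u) :=
  bilin_curvature_add ((D.Γ_smooth x hx).differentiableAt (by simp)) (D.Γ_symm x hx)
    ((D.γ_smooth x hx).of_le (by norm_cast))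
    ((D.U_smooth x hx).differentiableAt (by simp))
    ((D.ell_smooth x hx).differentiableAt (by simp))
    ((D.eventually_mem hx).mono fun y hy => D.covDeriv_γ y hy) v w u z

/-- The symmetric part of `γ(R(n, ·) ·, w)`. Since `γ(R(n, v) u, w)` has a known part symmetric in
`u, w`, and, by the Bianchi identity and because `γ` annihilates `n`, a known part antisymmetric in
`u, v`, it is determined as the Christoffel symbols are by the derivatives of a metric. -/
theorem metric_curvature_n (hx : x ∈ Ω) (u v w : E) :
    D.γ x (curvature D.Γ x (D.n x) v u) w + D.γ x (curvature D.Γ x (D.n x) u v) w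
      = 2 * (lieDerivTwo D.n D.U x u v - D.U x u (covDerivVec D.Γ D.n x v)) * D.ell x w
        + 4 * D.s x w * D.U x u v - 2 * covDerivTwo D.Γ D.U x w u v
        + covDerivTwo D.Γ D.U x v w u + covDerivTwo D.Γ D.U x u w v
        - D.s x v * D.U x w u - D.s x u * D.U x w v := by
  have hΓ : DifferentiableAt ℝ D.Γ x := (D.Γ_smooth x hx).differentiableAt (by simp)
  have bi : ∀ w u v, D.γ x (curvature D.Γ x (D.n x) v u) w
      - D.γ x (curvature D.Γ x (D.n x) u v) w = D.γ x (curvature D.Γ x u v (D.n x)) w := by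
    intro w u v
    have h := congrArg (fun V => D.γ x V w) (curvature_bianchi hΓ
      ((D.eventually_mem hx).mono fun y hy => D.Γ_symm y hy) (D.n x) v u)
    simp only [map_add, add_apply] at h
    rw [curvature_swap v u, curvature_swap u (D.n x)] at h
    simp only [map_neg, neg_apply, map_zero, zero_apply] at h
    linarith
  have hn : ∀ v, covDerivOne D.Γ D.ell x v (D.n x) = -D.s x v := by
    intro v
    rw [D.covDeriv_ell_eq hx, D.U_symm hx v, D.U_n hx, D.F_swap, ← D.s_eq_F hx]; ring
  have nh : ∀ v, covDerivOne D.Γ D.ell x (D.n x) v = D.s x v := by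
    intro v
    rw [D.covDeriv_ell_eq hx, D.U_n hx, ← D.s_eq_F hx]; ring
  -- the Ricci identity for `γ` with `n` in the third slot, where `γ(n, ·) = 0`
  have A : ∀ w u v, D.γ x (curvature D.Γ x u v (D.n x)) w = covDerivTwo D.Γ D.U x u v w
      - covDerivTwo D.Γ D.U x v u w - D.s x u * D.U x v w + D.s x v * D.U x u w := by
    intro w u v
    have h := D.metric_curvature_add hx u v (D.n x) w
    rw [D.γ_n x hx, D.ell_n x hx, hn, hn, D.covDeriv_U_symm hx u v, D.covDeriv_U_symm hx v u,
      D.covDeriv_U_n hx, D.covDeriv_U_n hx, D.U_symm hx u (D.n x), D.U_symm hx v (D.n x),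
      D.U_n hx, D.U_n hx, D.U_covDeriv_n_symm hx u v, D.U_symm hx u] at h
    linarith
  -- the Ricci identity for `γ` with `n` as a direction of differentiation
  have S : ∀ w u v, D.γ x (curvature D.Γ x (D.n x) v u) w + D.γ x (curvature D.Γ x (D.n x) v w) u
      = (lieDerivTwo D.n D.U x v w - D.U x v (covDerivVec D.Γ D.n x w)) * D.ell x u
      + (lieDerivTwo D.n D.U x v u - D.U x v (covDerivVec D.Γ D.n x u)) * D.ell x w
      + D.U x v w * D.s x u + D.U x v u * D.s x w := by
    intro w u v
    have h := D.metric_curvature_add hx (D.n x) v u w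
    rw [D.γ_symm x hx u] at h
    rw [h, nh, nh, D.covDeriv_U_n hx, D.covDeriv_U_n hx, D.U_n hx, D.U_n hx,
      D.lieDerivTwo_U hx, D.lieDerivTwo_U hx]
    ring
  have sL : ∀ u v, lieDerivTwo D.n D.U x u v = lieDerivTwo D.n D.U x v u := by
    intro u v
    rw [D.lieDerivTwo_U hx, D.lieDerivTwo_U hx, D.covDeriv_U_symm hx, D.U_symm hx _ v,
      D.U_symm hx u]
    ring
  have sV : ∀ u v, D.U x u (covDerivVec D.Γ D.n x v) = D.U x v (covDerivVec D.Γ D.n x u) := by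
    intro u v
    rw [← D.U_covDeriv_n_symm hx, D.U_symm hx]
  -- the Koszul combination of the three permutations
  have s1 := S w u v
  have s2 := S u v w
  have s3 := S v w u
  have b1 := bi u w v
  have b2 := bi v u w
  rw [A] at b1 b2
  rw [sL w u, sV w u, D.U_symm hx w u] at s2
  rw [sL v w, sV v w] at s1
  rw [sL v u, sV v u] at s1
  simp only [D.covDeriv_U_symm hx _ v u, D.covDeriv_U_symm hx _ w u,
    D.U_symm hx v w, D.U_symm hx v u, D.U_symm hx w u] at *
  linarith

/-- The symmetric part of `ℓ(R(n, ·) ·)`, from the Ricci identity for `ℓ` with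
`∇ℓ = F - ℓ⁽²⁾ U`. After symmetrization the derivative of `F` along `n` drops out, and the other
derivative of `F` is that of `s = F(n, ·)`. -/
theorem ell_curvature_n (hx : x ∈ Ω) (u w : E) :
    D.ell x (curvature D.Γ x (D.n x) w u) + D.ell x (curvature D.Γ x (D.n x) u w)
      = covDerivOne D.Γ D.s x w u + covDerivOne D.Γ D.s x u w
        - D.F x (covDerivVec D.Γ D.n x w) u - D.F x (covDerivVec D.Γ D.n x u) w
        + 2 * fderiv ℝ D.ell2 x (D.n x) * D.U x u w
        + 2 * D.ell2 x * (lieDerivTwo D.n D.U x u w - D.U x u (covDerivVec D.Γ D.n x w)) := by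
  have hΓ : DifferentiableAt ℝ D.Γ x := (D.Γ_smooth x hx).differentiableAt (by simp)
  have dF : DifferentiableAt ℝ D.F x := by
    have h : DifferentiableAt ℝ (fderiv ℝ D.ell) x :=
      ((D.ell_smooth x hx).fderiv_right (m := ∞) (by simp)).differentiableAt (by simp)
    have h2 : DifferentiableAt ℝ (fun y => (fderiv ℝ D.ell y).flip) x :=
      (ContinuousLinearMap.flipₗᵢ ℝ E E ℝ).toContinuousLinearEquiv.differentiableAt.comp x h
    exact (h.sub h2).const_smul (1 / 2 : ℝ)
  have dU := (D.U_smooth x hx).differentiableAt (by simp)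
  have dn := (D.n_smooth x hx).differentiableAt (by simp)
  have de := (D.ell2_smooth x hx).differentiableAt (by simp)
  have ds := (D.s_smooth x hx).differentiableAt (by simp)
  have c (u : E) := differentiableAt_const (𝕜 := ℝ) (x := x) u
  set K : E → E →L[ℝ] E →L[ℝ] ℝ := fun y => D.F y - D.ell2 y • D.U y with hK
  have dK : DifferentiableAt ℝ K x := dF.sub (de.smul dU)
  have R := apply_curvature hΓ (D.Γ_symm x hx) (θ := D.ell) (K := K)
    ((D.ell_smooth x hx).of_le (by norm_cast)) dK
    ((D.eventually_mem hx).mono fun y hy v w => by simp [D.covDeriv_ell_eq hy, K])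
  have k1 : ∀ w u, covDerivTwo D.Γ K x w (D.n x) u
      = covDerivOne D.Γ D.s x w u - K x (covDerivVec D.Γ D.n x w) u := by
    intro w u
    have h := congrArg (fun l => l w) (Filter.EventuallyEq.fderiv_eq (𝕜 := ℝ)
      (f₁ := fun y => K y (D.n y) u) (f := fun y => D.s y u)
      ((D.eventually_mem hx).mono fun y hy => by simp [K, D.U_n hy, ← D.s_eq_F hy]))
    rw [fderiv_bilin_apply dK dn (c u), fderiv_lin_apply ds (c u)] at h
    have h2 : ∀ v, K x (D.n x) v = D.s x v := by intro v; simp [K, D.U_n hx, ← D.s_eq_F hx]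
    simp only [covDerivTwo, covDerivOne, covDerivVec, map_add, add_apply, h2]
    simp at h
    linarith
  have k2 : covDerivTwo D.Γ K x (D.n x) w u + covDerivTwo D.Γ K x (D.n x) u w
      = -2 * (fderiv ℝ D.ell2 x (D.n x) * D.U x u w
        + D.ell2 x * covDerivTwo D.Γ D.U x (D.n x) u w) := by
    have h := congrArg (fun l => l (D.n x)) (Filter.EventuallyEq.fderiv_eq (𝕜 := ℝ) (x := x)
      (f₁ := fun y => K y w u + K y u w) (f := fun y => -2 * (D.ell2 y * D.U y u w))
      ((D.eventually_mem hx).mono fun y hy => by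
        simp only [K, sub_apply, smul_apply, smul_eq_mul]
        rw [D.F_swap y w u, D.U_symm hy w u]; ring))
    have d1 (u w : E) : DifferentiableAt ℝ (fun y => K y u w) x :=
      (dK.clm_apply (c u)).clm_apply (c w)
    have d2 : DifferentiableAt ℝ (fun y => D.U y u w) x := (dU.clm_apply (c u)).clm_apply (c w)
    rw [fderiv_fun_add (d1 w u) (d1 u w), fderiv_const_mul (de.fun_mul d2),
      fderiv_fun_mul de d2] at h
    simp only [add_apply, smul_apply] at h
    rw [fderiv_bilin_apply dK (c w) (c u), fderiv_bilin_apply dK (c u) (c w),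
      fderiv_bilin_apply dU (c u) (c w)] at h
    simp at h
    have sK : ∀ u w, K x w u + K x u w = -2 * (D.ell2 x * D.U x u w) := by
      intro u w
      simp only [K, sub_apply, smul_apply, smul_eq_mul]
      rw [D.F_swap x w u, D.U_symm hx w u]; ring
    have e1 := sK (D.Γ x (D.n x) w) u
    have e2 := sK w (D.Γ x (D.n x) u)
    rw [D.U_symm hx _ u] at e1
    rw [D.U_symm hx w] at e2
    simp only [covDerivTwo]
    linarith
  rw [R, R, k1, k1, D.lieDerivTwo_U hx, D.U_covDeriv_n_symm hx]
  simp only [K, sub_apply, smul_apply, smul_eq_mul]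
  rw [D.U_covDeriv_n_symm hx, D.U_covDeriv_n_symm hx, ← D.U_covDeriv_n_symm hx w u,
    D.U_symm hx _ u]
  simp only [K] at k2
  linarith

end NullStructure

end Null

/-! ### Transverse submanifolds of null data -/

section Slices

variable {E F : Type*} [NormedAddCommGroup E] [NormedSpace ℝ E] [NormedAddCommGroup F]
  [NormedSpace ℝ F]

/-- A parametrized transverse submanifold `f : O → Ω` of null metric hypersurface data, with its
induced metric `h`, the Levi-Civita connection `Γh` of `h`, the vector field `lam` that
corresponds to the pull-back of `ℓ` through `h`, and the pull-backs of `ℓ`, `U`, `s`. -/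
structure NullStructure.Slice {Ω : Set E} (D : NullStructure Ω) (O : Set F) where
  /-- the parametrization -/
  f : F → E
  /-- the induced metric -/
  h : F → F →L[ℝ] F →L[ℝ] ℝ
  /-- the Levi-Civita connection of the induced metric -/
  Γh : F → F →L[ℝ] F →L[ℝ] F
  /-- the pull-back of `ℓ` -/
  ell : F → F →L[ℝ] ℝ
  /-- the pull-back of `U` -/
  U : F → F →L[ℝ] F →L[ℝ] ℝ
  /-- the pull-back of `s` -/
  s : F → F →L[ℝ] ℝ
  /-- the pull-back of `ℓ` with its index raised -/
  lam : F → F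
  isOpen : IsOpen O
  mapsTo : ∀ z ∈ O, f z ∈ Ω
  f_smooth : ∀ z ∈ O, ContDiffAt ℝ ∞ f z
  h_smooth : ∀ z ∈ O, ContDiffAt ℝ ∞ h z
  Γh_diff : ∀ z ∈ O, DifferentiableAt ℝ Γh z
  ell_diff : ∀ z ∈ O, DifferentiableAt ℝ ell z
  U_diff : ∀ z ∈ O, DifferentiableAt ℝ U z
  s_diff : ∀ z ∈ O, DifferentiableAt ℝ s z
  lam_diff : ∀ z ∈ O, DifferentiableAt ℝ lam z
  h_eq : ∀ z ∈ O, ∀ v w, h z v w = D.γ (f z) (fderiv ℝ f z v) (fderiv ℝ f z w)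
  ell_eq : ∀ z ∈ O, ∀ v, ell z v = D.ell (f z) (fderiv ℝ f z v)
  U_eq : ∀ z ∈ O, ∀ v w, U z v w = D.U (f z) (fderiv ℝ f z v) (fderiv ℝ f z w)
  s_eq : ∀ z ∈ O, ∀ v, s z v = D.s (f z) (fderiv ℝ f z v)
  Γh_symm : ∀ z ∈ O, ∀ v w, Γh z v w = Γh z w v
  covDeriv_h : ∀ z ∈ O, ∀ v u w, covDerivTwo Γh h z v u w = 0
  h_lam : ∀ z ∈ O, ∀ v, h z (lam z) v = ell z v
  /-- transversality: the `γ`-orthogonal complement of the tangent space is spanned by `n` -/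
  transverse : ∀ z ∈ O, ∀ V, (∀ v, D.γ (f z) V (fderiv ℝ f z v) = 0) →
    V = D.ell (f z) V • D.n (f z)

namespace NullStructure.Slice

variable {Ω : Set E} {D : NullStructure Ω} {O : Set F} (S : D.Slice O) {z : F}

theorem eventually_mem (S : D.Slice O) (hz : z ∈ O) : ∀ᶠ y in nhds z, y ∈ O :=
  S.isOpen.mem_nhds hz

/-- The second fundamental form of a transverse submanifold. -/
def second (z v w : F) : E := secondForm D.Γ S.Γh S.f z v w

/-- The difference `ℓ⁽²⁾ - ℓ⁽²⁾_∥`. -/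
def delta (z : F) : ℝ := D.ell2 (S.f z) - S.ell z (S.lam z)

/-- The `n`-component of the second fundamental form,
`Q_AB = ∇ʰ_(A ℓ_B) + (ℓ⁽²⁾ - ℓ⁽²⁾_∥) U_AB`; see `second_eq`. -/
def Q (z v w : F) : ℝ :=
  (covDerivOne S.Γh S.ell z v w + covDerivOne S.Γh S.ell z w v) / 2 + S.delta z * S.U z v w

theorem f_contDiffAt_two (hz : z ∈ O) : ContDiffAt ℝ 2 S.f z :=
  (S.f_smooth z hz).of_le (by norm_cast)

theorem f_contDiffAt_three (hz : z ∈ O) : ContDiffAt ℝ 3 S.f z :=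
  (S.f_smooth z hz).of_le (by norm_cast)

theorem U_symm (hz : z ∈ O) (v w : F) : S.U z v w = S.U z w v := by
  rw [S.U_eq z hz, S.U_eq z hz, D.U_symm (S.mapsTo z hz)]

theorem h_symm (hz : z ∈ O) (v w : F) : S.h z v w = S.h z w v := by
  rw [S.h_eq z hz, S.h_eq z hz, D.γ_symm _ (S.mapsTo z hz)]

theorem second_symm (hz : z ∈ O) (v w : F) : S.second z v w = S.second z w v :=
  secondForm_symm (S.f_contDiffAt_two hz) (D.Γ_symm _ (S.mapsTo z hz)) (S.Γh_symm z hz) v w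

/-- The components of the second fundamental form along the submanifold, found from the covariant
derivatives of `γ` and of the induced metric by the Koszul argument. -/
theorem γ_second (hz : z ∈ O) (v w u : F) :
    D.γ (S.f z) (S.second z v w) (fderiv ℝ S.f z u) = S.U z v w * S.ell z u := by
  have hx := S.mapsTo z hz
  have p := fun v u w => covDerivTwo_pullback (Γ := D.Γ) (Γh := S.Γh) (S.f_contDiffAt_two hz)
    ((D.γ_smooth _ hx).differentiableAt (by simp)) ((S.h_smooth z hz).differentiableAt (by simp))
    ((S.eventually_mem hz).mono fun y hy => S.h_eq y hy) v u w
  simp only [S.covDeriv_h z hz, D.covDeriv_γ _ hx, ← S.U_eq z hz, ← S.ell_eq z hz] at p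
  change ∀ v u w, 0 = _ + D.γ (S.f z) (S.second z v u) _ + D.γ (S.f z) _ (S.second z v w) at p
  -- the Koszul combination
  have p1 := p v w u
  have p2 := p w u v
  have p3 := p u v w
  rw [D.γ_symm _ hx (fderiv ℝ S.f z w)] at p1
  rw [D.γ_symm _ hx (fderiv ℝ S.f z u)] at p2
  rw [D.γ_symm _ hx (fderiv ℝ S.f z v)] at p3
  rw [S.second_symm hz w v, S.U_symm hz w v] at p2
  rw [S.second_symm hz u v, S.second_symm hz u w, S.U_symm hz u v, S.U_symm hz u w] at p3
  linarith

theorem covDeriv_ell (hz : z ∈ O) (v w : F) :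
    covDerivOne S.Γh S.ell z v w
      = D.F (S.f z) (fderiv ℝ S.f z v) (fderiv ℝ S.f z w) - D.ell2 (S.f z) * S.U z v w
        + D.ell (S.f z) (S.second z v w) := by
  have hx := S.mapsTo z hz
  rw [covDerivOne_pullback (Γ := D.Γ) (S.f_contDiffAt_two hz)
    ((D.ell_smooth _ hx).differentiableAt (by simp)) (S.ell_diff z hz)
    ((S.eventually_mem hz).mono fun y hy => S.ell_eq y hy), D.covDeriv_ell_eq hx, S.U_eq z hz]
  rfl

theorem ell_second (hz : z ∈ O) (v w : F) :
    D.ell (S.f z) (S.second z v w) = S.U z v w * S.ell z (S.lam z) + S.Q z v w := by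
  have h1 := S.covDeriv_ell hz v w
  have h2 := S.covDeriv_ell hz w v
  rw [S.second_symm hz w v, S.U_symm hz w v, D.F_swap] at h2
  simp only [Q, delta]
  linarith

theorem F_map (hz : z ∈ O) (v w : F) :
    D.F (S.f z) (fderiv ℝ S.f z v) (fderiv ℝ S.f z w)
      = (covDerivOne S.Γh S.ell z v w - covDerivOne S.Γh S.ell z w v) / 2 := by
  have h1 := S.covDeriv_ell hz v w
  have h2 := S.covDeriv_ell hz w v
  rw [S.second_symm hz w v, S.U_symm hz w v, D.F_swap] at h2
  linarith

/-- The expansion of a vector in the directions tangent to the submanifold and along `n`. -/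
theorem expand (hz : z ∈ O) (V : E) (T : F)
    (hT : ∀ v, D.γ (S.f z) V (fderiv ℝ S.f z v) = S.h z T v) :
    V = fderiv ℝ S.f z T + (D.ell (S.f z) V - S.ell z T) • D.n (S.f z) := by
  have h := S.transverse z hz (V - fderiv ℝ S.f z T) fun v => by
    simp [hT, S.h_eq z hz]
  rw [map_sub, ← S.ell_eq z hz] at h
  rw [← h]; abel

/-- The second fundamental form is `U ⊗ ℓ♯ + Q ⊗ n`. -/
theorem second_eq (hz : z ∈ O) (v w : F) :
    S.second z v w = S.U z v w • fderiv ℝ S.f z (S.lam z) + S.Q z v w • D.n (S.f z) := by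
  have h := S.expand hz (S.second z v w) (S.U z v w • S.lam z) fun u => by
    simp [S.γ_second hz, S.h_lam z hz]
  rw [S.ell_second hz] at h
  rw [h]
  simp

/-- The covariant derivative of `n` along the submanifold; `N` is `U(v, ·)` with its index raised
by the induced metric. -/
theorem covDeriv_n_eq (hz : z ∈ O) (v N : F) (hN : ∀ u, S.h z N u = S.U z v u) :
    covDerivVec D.Γ D.n (S.f z) (fderiv ℝ S.f z v)
      = fderiv ℝ S.f z N + (S.s z v - S.U z (S.lam z) v) • D.n (S.f z) := by
  have hx := S.mapsTo z hz
  have h := S.expand hz (covDerivVec D.Γ D.n (S.f z) (fderiv ℝ S.f z v)) N fun u => by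
    rw [D.γ_covDeriv_n hx, hN, S.U_eq z hz]
  rw [D.ell_covDeriv_n hx, ← S.s_eq z hz, ← S.h_lam z hz, S.h_symm hz, hN, S.U_symm hz] at h
  exact h

theorem covDeriv_s (hz : z ∈ O) (v w : F) :
    covDerivOne D.Γ D.s (S.f z) (fderiv ℝ S.f z v) (fderiv ℝ S.f z w)
      = covDerivOne S.Γh S.s z v w - S.U z v w * S.s z (S.lam z) := by
  have hx := S.mapsTo z hz
  rw [covDerivOne_pullback (Γ := D.Γ) (S.f_contDiffAt_two hz)
    ((D.s_smooth _ hx).differentiableAt (by simp)) (S.s_diff z hz)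
    ((S.eventually_mem hz).mono fun y hy => S.s_eq y hy)]
  change _ = _ + D.s (S.f z) (S.second z v w) - _
  rw [S.second_eq hz]
  simp [D.s_n hx, S.s_eq z hz]

theorem U_second (hz : z ∈ O) (v w u : F) :
    D.U (S.f z) (S.second z v w) (fderiv ℝ S.f z u) = S.U z v w * S.U z (S.lam z) u := by
  rw [S.second_eq hz]
  simp [D.U_n (S.mapsTo z hz), S.U_eq z hz]

theorem covDeriv_U (hz : z ∈ O) (v w u : F) :
    covDerivTwo D.Γ D.U (S.f z) (fderiv ℝ S.f z v) (fderiv ℝ S.f z w) (fderiv ℝ S.f z u)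
      = covDerivTwo S.Γh S.U z v w u - S.U z v w * S.U z (S.lam z) u
        - S.U z v u * S.U z (S.lam z) w := by
  have hx := S.mapsTo z hz
  rw [covDerivTwo_pullback (Γ := D.Γ) (S.f_contDiffAt_two hz)
    ((D.U_smooth _ hx).differentiableAt (by simp)) (S.U_diff z hz)
    ((S.eventually_mem hz).mono fun y hy => S.U_eq y hy)]
  change _ = _ + D.U (S.f z) (S.second z v w) _ + D.U (S.f z) _ (S.second z v u) - _ - _
  rw [D.U_symm hx _ (S.second z v u), S.U_second hz, S.U_second hz]
  ring

theorem F_covDeriv_n (hz : z ∈ O) (v w N : F) (hN : ∀ u, S.h z N u = S.U z v u) :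
    D.F (S.f z) (covDerivVec D.Γ D.n (S.f z) (fderiv ℝ S.f z v)) (fderiv ℝ S.f z w)
      = (covDerivOne S.Γh S.ell z N w - covDerivOne S.Γh S.ell z w N) / 2
        + (S.s z v - S.U z (S.lam z) v) * S.s z w := by
  have hx := S.mapsTo z hz
  rw [S.covDeriv_n_eq hz v N hN, ← S.F_map hz, S.s_eq z hz w, D.s_eq_F hx]
  simp

theorem U_covDeriv_n (hz : z ∈ O) (v w N : F) (hN : ∀ u, S.h z N u = S.U z v u) :
    D.U (S.f z) (fderiv ℝ S.f z w) (covDerivVec D.Γ D.n (S.f z) (fderiv ℝ S.f z v))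
      = S.U z w N := by
  have hx := S.mapsTo z hz
  rw [S.covDeriv_n_eq hz v N hN, S.U_eq z hz w, D.U_symm hx, D.U_symm hx _ (fderiv ℝ S.f z N)]
  simp [D.U_n hx]

/-- The part of the Ricci tensor that involves the transverse direction `n`, symmetrized. The
covector `V ↦ ℓ(V) - γ(V, ℓ♯)` annihilates the tangent vectors of the submanifold and takes the
value `1` on `n`. -/
theorem transverse_curvature (hz : z ∈ O) (u w Nu Nw : F) (hu : ∀ v, S.h z Nu v = S.U z u v)
    (hw : ∀ v, S.h z Nw v = S.U z w v) :
    let R := curvature D.Γ (S.f z) (D.n (S.f z))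
    let df := fderiv ℝ S.f z
    let q := fun V => D.ell (S.f z) V - D.γ (S.f z) V (df (S.lam z))
    q (R (df w) (df u)) + q (R (df u) (df w)) =
      covDerivOne S.Γh S.s z w u + covDerivOne S.Γh S.s z u w - 6 * S.s z (S.lam z) * S.U z u w
      - ((covDerivOne S.Γh S.ell z Nw u - covDerivOne S.Γh S.ell z u Nw) / 2
        + (S.s z w - S.U z (S.lam z) w) * S.s z u)
      - ((covDerivOne S.Γh S.ell z Nu w - covDerivOne S.Γh S.ell z w Nu) / 2
        + (S.s z u - S.U z (S.lam z) u) * S.s z w)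
      + 2 * fderiv ℝ D.ell2 (S.f z) (D.n (S.f z)) * S.U z u w
      + 2 * S.delta z * (lieDerivTwo D.n D.U (S.f z) (df u) (df w) - S.U z u Nw)
      + 2 * covDerivTwo S.Γh S.U z (S.lam z) u w
      - covDerivTwo S.Γh S.U z w (S.lam z) u - covDerivTwo S.Γh S.U z u (S.lam z) w
      + S.s z w * S.U z (S.lam z) u + S.s z u * S.U z (S.lam z) w
      - 2 * S.U z (S.lam z) u * S.U z (S.lam z) w
      + 2 * S.U z (S.lam z) (S.lam z) * S.U z u w := by
  intro R df q
  have hx := S.mapsTo z hz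
  have h1 := D.ell_curvature_n hx (df u) (df w)
  have h2 := D.metric_curvature_n hx (df u) (df w) (df (S.lam z))
  rw [S.covDeriv_s hz, S.covDeriv_s hz, S.F_covDeriv_n hz w u Nw hw, S.F_covDeriv_n hz u w Nu hu,
    ← S.U_eq z hz, S.U_covDeriv_n hz w u Nw hw, S.U_symm hz w u] at h1
  rw [S.covDeriv_U hz, S.covDeriv_U hz, S.covDeriv_U hz, S.U_covDeriv_n hz w u Nw hw,
    ← S.U_eq z hz, ← S.U_eq z hz, ← S.U_eq z hz, ← S.ell_eq z hz, ← S.s_eq z hz, ← S.s_eq z hz,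
    ← S.s_eq z hz, S.U_symm hz w u, S.U_symm hz w (S.lam z), S.U_symm hz u (S.lam z)] at h2
  simp only [q, R, delta]
  linarith

/-- Since `h` is parallel, `∇ lam` is `∇ ℓ` with its second index raised. -/
theorem h_covDeriv_lam (hz : z ∈ O) (v w : F) :
    S.h z (covDerivVec S.Γh S.lam z v) w = covDerivOne S.Γh S.ell z v w := by
  have c (u : F) := differentiableAt_const (𝕜 := ℝ) (x := z) u
  have h1 := congrArg (fun l => l v) (Filter.EventuallyEq.fderiv_eq (𝕜 := ℝ)
      ((S.eventually_mem hz).mono fun y hy => S.h_lam y hy w))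
  rw [fderiv_bilin_apply ((S.h_smooth z hz).differentiableAt (by simp)) (S.lam_diff z hz) (c w),
    fderiv_lin_apply (S.ell_diff z hz) (c w)] at h1
  have h2 := S.covDeriv_h z hz v (S.lam z) w
  simp only [covDerivTwo] at h2
  simp only [covDerivVec, covDerivOne, map_add, add_apply, ← S.h_lam z hz (S.Γh z v w)]
  simp at h1
  linarith

theorem h_curvature_antisymm (hz : z ∈ O) (v w u t : F) :
    S.h z (curvature S.Γh z v w u) t + S.h z u (curvature S.Γh z v w t) = 0 := by
  -- a metric connection is the case `U = 0` of the Ricci identity for `γ`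
  have h := bilin_curvature_add (S.Γh_diff z hz) (S.Γh_symm z hz) (γ := S.h)
    (U := fun _ => 0) (ℓ := fun _ => 0) ((S.h_smooth z hz).of_le (by norm_cast))
    (differentiableAt_const _) (differentiableAt_const _)
    ((S.eventually_mem hz).mono fun y hy => by simp [S.covDeriv_h y hy]) v w u t
  rw [h]
  simp [covDerivOne]

/-- The Gauss equation of a transverse submanifold. -/
theorem γ_curvature (hz : z ∈ O) (v w u t : F) :
    let B := fun v w u t => covDerivTwo S.Γh S.U z v w u * S.ell z t
      + S.U z w u * covDerivOne S.Γh S.ell z v t + S.U z w u * S.U z v (S.lam z) * S.ell z t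
      + S.U z v t * S.Q z w u
    D.γ (S.f z) (curvature D.Γ (S.f z) (fderiv ℝ S.f z v) (fderiv ℝ S.f z w) (fderiv ℝ S.f z u))
        (fderiv ℝ S.f z t)
      = S.h z (curvature S.Γh z v w u) t + B v w u t - B w v u t := by
  intro B
  have hx := S.mapsTo z hz
  have df : DifferentiableAt ℝ S.f z := (S.f_smooth z hz).differentiableAt (by simp)
  have ddf : DifferentiableAt ℝ (fderiv ℝ S.f) z :=
    ((S.f_contDiffAt_two hz).fderiv_right (m := 1) (by norm_num)).differentiableAt (by simp)
  have dΓ : DifferentiableAt ℝ D.Γ (S.f z) := (D.Γ_smooth _ hx).differentiableAt (by simp)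
  have dγ : DifferentiableAt ℝ D.γ (S.f z) := (D.γ_smooth _ hx).differentiableAt (by simp)
  have c (u : F) := differentiableAt_const (𝕜 := ℝ) (x := z) u
  have key : ∀ v w, D.γ (S.f z) (covDerivSecondForm D.Γ S.Γh S.f z v w u) (fderiv ℝ S.f z t)
      = B v w u t := by
    intro v w
    have dW : DifferentiableAt ℝ (fun y => S.second y w u) z :=
      differentiableAt_secondForm (S.f_contDiffAt_three hz) dΓ (S.Γh_diff z hz) w u
    have hc : HasFDerivAt (fun y => D.γ (S.f y)) ((fderiv ℝ D.γ (S.f z)).comp (fderiv ℝ S.f z)) z :=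
      dγ.hasFDerivAt.comp z df.hasFDerivAt
    have d1 : DifferentiableAt ℝ (fun y => S.U y w u) z :=
      ((S.U_diff z hz).clm_apply (c w)).clm_apply (c u)
    have d2 : DifferentiableAt ℝ (fun y => S.ell y t) z := (S.ell_diff z hz).clm_apply (c t)
    have h1 := congrArg (fun l => l v) (Filter.EventuallyEq.fderiv_eq (𝕜 := ℝ)
      ((S.eventually_mem hz).mono fun y hy => S.γ_second hy w u t))
    rw [fderiv_bilin_apply hc.differentiableAt dW (ddf.clm_apply (c t)), hc.fderiv,
      fderiv_lin_apply ddf (c t), fderiv_fun_mul d1 d2] at h1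
    simp only [add_apply, smul_apply] at h1
    rw [fderiv_bilin_apply (S.U_diff z hz) (c w) (c u), fderiv_lin_apply (S.ell_diff z hz) (c t)]
      at h1
    simp at h1
    have h2 := D.covDeriv_γ _ hx (fderiv ℝ S.f z v) (S.second z w u) (fderiv ℝ S.f z t)
    rw [D.U_symm hx _ (S.second z w u), S.U_second hz, ← S.U_eq z hz, ← S.ell_eq z hz,
      S.ell_second hz] at h2
    have h3 : D.γ (S.f z) (S.second z w u) (fderiv ℝ (fderiv ℝ S.f) z v t
        + D.Γ (S.f z) (fderiv ℝ S.f z v) (fderiv ℝ S.f z t))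
        = S.U z w u * (S.U z v t * S.ell z (S.lam z) + S.ell z (S.Γh z v t)) := by
      have e : fderiv ℝ (fderiv ℝ S.f) z v t + D.Γ (S.f z) (fderiv ℝ S.f z v) (fderiv ℝ S.f z t)
          = S.second z v t + fderiv ℝ S.f z (S.Γh z v t) := by
        simp [second, secondForm]
      rw [e, map_add, S.γ_second hz, S.second_eq hz v t, map_add, map_smul, map_smul,
        S.γ_second hz, D.γ_symm _ hx _ (D.n (S.f z)), D.γ_n _ hx]
      simp
      ring
    simp only [covDerivTwo] at h2
    simp only [map_add] at h3
    have h4 := S.γ_second hz (S.Γh z v w) u t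
    have h5 := S.γ_second hz w (S.Γh z v u) t
    simp only [B, covDerivSecondForm, covDerivOne, covDerivTwo, map_add, map_sub, add_apply,
      sub_apply]
    rw [S.U_symm hz v (S.lam z)]
    change D.γ (S.f z) (fderiv ℝ (fun y => S.second y w u) z v) _
      + D.γ (S.f z) (D.Γ (S.f z) (fderiv ℝ S.f z v) (S.second z w u)) _
      - D.γ (S.f z) (S.second z (S.Γh z v w) u) _ - D.γ (S.f z) (S.second z w (S.Γh z v u)) _ = _
    linarith
  rw [curvature_map (S.f_contDiffAt_three hz) dΓ (S.Γh_diff z hz) (S.Γh_symm z hz)]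
  simp only [map_add, map_sub, add_apply, sub_apply]
  rw [key, key, ← S.h_eq z hz]

end NullStructure.Slice

end Slices

/-! ### Components of tensor fields -/

section Components

variable {k : ℕ}

/-- The coordinate basis of `ℝᵏ`. -/
abbrev coordBasis (a : Fin k) : Coord k := EuclideanSpace.single a 1

theorem sum_smul_coordBasis (v : Coord k) : ∑ a, v a • coordBasis a = v := by
  ext i
  simp [Finset.sum_apply, Pi.single_apply]

/-- Linearity of a real function on a vector space, unbundled. -/
structure IsLin {V : Type*} [AddCommGroup V] [Module ℝ V] (C : V → ℝ) : Prop where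
  add : ∀ u v, C (u + v) = C u + C v
  smul : ∀ (c : ℝ) u, C (c • u) = c * C u

theorem IsLin.map_sum {V ι : Type*} [AddCommGroup V] [Module ℝ V] {C : V → ℝ} (h : IsLin C)
    (t : Finset ι) (c : ι → ℝ) (u : ι → V) : C (∑ i ∈ t, c i • u i) = ∑ i ∈ t, c i * C (u i) := by
  classical
  induction t using Finset.induction_on with
  | empty => simpa using h.smul 0 0
  | insert i t hi ih => rw [Finset.sum_insert hi, Finset.sum_insert hi, h.add, h.smul, ih]

theorem IsLin.eq_sum {C : Coord k → ℝ} (h : IsLin C) (v : Coord k) :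
    C v = ∑ a, v a * C (coordBasis a) := by
  conv_lhs => rw [← sum_smul_coordBasis v, h.map_sum]

/-- Bilinearity of a real function of two vectors, unbundled. -/
structure IsBilin {V W : Type*} [AddCommGroup V] [Module ℝ V] [AddCommGroup W] [Module ℝ W]
    (C : V → W → ℝ) : Prop where
  left : ∀ w, IsLin fun u => C u w
  right : ∀ u, IsLin (C u)

theorem IsBilin.eq_sum {l : ℕ} {C : Coord k → Coord l → ℝ} (h : IsBilin C) (u : Coord k)
    (w : Coord l) :
    C u w = ∑ a, ∑ b, u a * w b * C (coordBasis a) (coordBasis b) := by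
  rw [(h.left w).eq_sum]
  refine Finset.sum_congr rfl fun a _ => ?_
  rw [(h.right _).eq_sum, Finset.mul_sum]
  exact Finset.sum_congr rfl fun b _ => by ring

theorem IsBilin.ext {l : ℕ} {C C' : Coord k → Coord l → ℝ} (h : IsBilin C) (h' : IsBilin C')
    (e : ∀ a b, C (coordBasis a) (coordBasis b) = C' (coordBasis a) (coordBasis b)) (u : Coord k)
    (w : Coord l) : C u w = C' u w := by
  rw [h.eq_sum, h'.eq_sum]
  simp only [e]

theorem isLin_clm {V : Type*} [NormedAddCommGroup V] [NormedSpace ℝ V] (θ : V →L[ℝ] ℝ) :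
    IsLin fun v => θ v := ⟨by simp, by simp⟩

theorem isBilin_clm {V W : Type*} [NormedAddCommGroup V] [NormedSpace ℝ V] [NormedAddCommGroup W]
    [NormedSpace ℝ W] (T : V →L[ℝ] W →L[ℝ] ℝ) : IsBilin fun v w => T v w :=
  ⟨fun _ => ⟨by simp, by simp⟩, fun _ => ⟨by simp, by simp⟩⟩

/-- The vector field with the given components. -/
def vecField (V : Fin k → Coord k → ℝ) (x : Coord k) : Coord k := ∑ a, V a x • coordBasis a

/-- The covector field with the given components. -/
def covecField (θ : Fin k → Coord k → ℝ) (x : Coord k) : Coord k →L[ℝ] ℝ :=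
  ∑ a, θ a x • (EuclideanSpace.proj a : Coord k →L[ℝ] ℝ)

/-- The `2`-covariant tensor field with the given components. -/
def bilinField (T : Fin k → Fin k → Coord k → ℝ) (x : Coord k) : Coord k →L[ℝ] Coord k →L[ℝ] ℝ :=
  ∑ a, (EuclideanSpace.proj a : Coord k →L[ℝ] ℝ).smulRight (covecField (T a) x)

/-- The bilinear map `Γ(v, w)` with the given connection coefficients. -/
def connField (Γ : Fin k → Fin k → Fin k → Coord k → ℝ) (x : Coord k) :
    Coord k →L[ℝ] Coord k →L[ℝ] Coord k :=
  ∑ a, (EuclideanSpace.proj a : Coord k →L[ℝ] ℝ).smulRight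
    (∑ b, (EuclideanSpace.proj b : Coord k →L[ℝ] ℝ).smulRight (vecField (fun c => Γ c a b) x))

variable {x : Coord k}

@[simp]
theorem vecField_apply (V : Fin k → Coord k → ℝ) (x : Coord k) (a : Fin k) :
    vecField V x a = V a x := by
  simp [vecField, Finset.sum_apply, Pi.single_apply]

@[simp]
theorem covecField_coordBasis (θ : Fin k → Coord k → ℝ) (x : Coord k) (a : Fin k) :
    covecField θ x (coordBasis a) = θ a x := by
  simp [covecField]

@[simp]
theorem bilinField_coordBasis (T : Fin k → Fin k → Coord k → ℝ) (x : Coord k) (a b : Fin k) :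
    bilinField T x (coordBasis a) (coordBasis b) = T a b x := by
  simp [bilinField]

@[simp]
theorem connField_coordBasis (Γ : Fin k → Fin k → Fin k → Coord k → ℝ) (x : Coord k)
    (a b : Fin k) :
    connField Γ x (coordBasis a) (coordBasis b) = vecField (fun c => Γ c a b) x := by
  simp [connField]

theorem covecField_vecField (θ V : Fin k → Coord k → ℝ) (x y : Coord k) :
    covecField θ x (vecField V y) = ∑ a, V a y * θ a x := by
  rw [(isLin_clm _).eq_sum]
  simp

theorem contDiffAt_vecField {n : WithTop ℕ∞} {V : Fin k → Coord k → ℝ}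
    (hV : ∀ a, ContDiffAt ℝ n (V a) x) :
    ContDiffAt ℝ n (vecField V) x :=
  ContDiffAt.sum fun a _ => (hV a).smul contDiffAt_const

theorem contDiffAt_covecField {n : WithTop ℕ∞} {θ : Fin k → Coord k → ℝ}
    (hθ : ∀ a, ContDiffAt ℝ n (θ a) x) : ContDiffAt ℝ n (covecField θ) x :=
  ContDiffAt.sum fun a _ => (hθ a).smul contDiffAt_const

theorem contDiffAt_bilinField {n : WithTop ℕ∞} {T : Fin k → Fin k → Coord k → ℝ}
    (hT : ∀ a b, ContDiffAt ℝ n (T a b) x) : ContDiffAt ℝ n (bilinField T) x :=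
  ContDiffAt.sum fun a _ => ContDiffAt.smulRight contDiffAt_const (contDiffAt_covecField (hT a))

theorem contDiffAt_connField {n : WithTop ℕ∞} {Γ : Fin k → Fin k → Fin k → Coord k → ℝ}
    (hΓ : ∀ c a b, ContDiffAt ℝ n (Γ c a b) x) : ContDiffAt ℝ n (connField Γ) x :=
  ContDiffAt.sum fun a _ => ContDiffAt.smulRight contDiffAt_const
    (ContDiffAt.sum fun b _ => ContDiffAt.smulRight contDiffAt_const
      (contDiffAt_vecField fun c => hΓ c a b))

theorem fderiv_vecField {V : Fin k → Coord k → ℝ} (hV : DifferentiableAt ℝ (vecField V) x)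
    (v : Coord k) (a : Fin k) : fderiv ℝ (vecField V) x v a = fderiv ℝ (V a) x v := by
  have h := ((EuclideanSpace.proj a : Coord k →L[ℝ] ℝ).hasFDerivAt.comp x hV.hasFDerivAt).fderiv
  have e : ((EuclideanSpace.proj a : Coord k →L[ℝ] ℝ) ∘ vecField V) = V a := by
    funext y; simp
  rw [e] at h
  rw [h]; simp

theorem fderiv_covecField {θ : Fin k → Coord k → ℝ} (hθ : DifferentiableAt ℝ (covecField θ) x)
    (v : Coord k) (a : Fin k) :
    fderiv ℝ (covecField θ) x v (coordBasis a) = fderiv ℝ (θ a) x v := by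
  have h := fderiv_lin_apply hθ (differentiableAt_const (coordBasis a)) v
  simp only [covecField_coordBasis] at h
  rw [h]; simp

theorem fderiv_bilinField {T : Fin k → Fin k → Coord k → ℝ}
    (hT : DifferentiableAt ℝ (bilinField T) x) (v : Coord k) (a b : Fin k) :
    fderiv ℝ (bilinField T) x v (coordBasis a) (coordBasis b) = fderiv ℝ (T a b) x v := by
  have h := fderiv_bilin_apply hT (differentiableAt_const (coordBasis a))
    (differentiableAt_const (coordBasis b)) v
  simp only [bilinField_coordBasis] at h
  rw [h]; simp

theorem fderiv_connField {Γ : Fin k → Fin k → Fin k → Coord k → ℝ}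
    (hΓ : DifferentiableAt ℝ (connField Γ) x) (v : Coord k) (a b c : Fin k) :
    fderiv ℝ (connField Γ) x v (coordBasis a) (coordBasis b) c = fderiv ℝ (Γ c a b) x v := by
  have d := (hΓ.clm_apply (differentiableAt_const (coordBasis a))).clm_apply
    (differentiableAt_const (coordBasis b))
  have h := fderiv_bilin_apply hΓ (differentiableAt_const (coordBasis a))
    (differentiableAt_const (coordBasis b)) v
  simp only [connField_coordBasis] at h d
  have h2 := congrArg (fun w : Coord k => w c) h
  simp only [fderiv_vecField d] at h2
  rw [h2]; simp

theorem covDer₁_eq {Γ : Fin k → Fin k → Fin k → Coord k → ℝ} {θ : Fin k → Coord k → ℝ}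
    (hθ : DifferentiableAt ℝ (covecField θ) x) (a b : Fin k) :
    covDer₁ Γ θ a b x
      = covDerivOne (connField Γ) (covecField θ) x (coordBasis a) (coordBasis b) := by
  rw [covDerivOne, fderiv_covecField hθ, connField_coordBasis, covecField_vecField]
  rfl

theorem bilinField_vecField_left (T : Fin k → Fin k → Coord k → ℝ) (V : Fin k → Coord k → ℝ)
    (x y : Coord k) (b : Fin k) :
    bilinField T x (vecField V y) (coordBasis b) = ∑ a, V a y * T a b x := by
  rw [((isBilin_clm (bilinField T x)).left (coordBasis b)).eq_sum]
  simp

theorem bilinField_vecField_right (T : Fin k → Fin k → Coord k → ℝ) (V : Fin k → Coord k → ℝ)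
    (x y : Coord k) (a : Fin k) :
    bilinField T x (coordBasis a) (vecField V y) = ∑ b, V b y * T a b x := by
  rw [((isBilin_clm (bilinField T x)).right (coordBasis a)).eq_sum]
  simp

theorem covDer₂_eq {Γ : Fin k → Fin k → Fin k → Coord k → ℝ} {T : Fin k → Fin k → Coord k → ℝ}
    (hT : DifferentiableAt ℝ (bilinField T) x) (a b c : Fin k) :
    covDer₂ Γ T a b c x = covDerivTwo (connField Γ) (bilinField T) x (coordBasis a) (coordBasis b)
      (coordBasis c) := by
  rw [covDerivTwo, fderiv_bilinField hT, connField_coordBasis, connField_coordBasis,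
    bilinField_vecField_left, bilinField_vecField_right]
  rfl

theorem lieDer₂_eq {V : Fin k → Coord k → ℝ} {T : Fin k → Fin k → Coord k → ℝ}
    (hV : DifferentiableAt ℝ (vecField V) x) (hT : DifferentiableAt ℝ (bilinField T) x)
    (a b : Fin k) :
    lieDer₂ V T a b x
      = lieDerivTwo (vecField V) (bilinField T) x (coordBasis a) (coordBasis b) := by
  rw [lieDerivTwo, fderiv_bilinField hT, (isLin_clm (fderiv ℝ (T a b) x)).eq_sum,
    ((isBilin_clm (bilinField T x)).left (coordBasis b)).eq_sum,
    ((isBilin_clm (bilinField T x)).right (coordBasis a)).eq_sum, ← Finset.sum_add_distrib,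
    ← Finset.sum_add_distrib]
  refine Finset.sum_congr rfl fun c _ => ?_
  simp only [fderiv_vecField hV, bilinField_coordBasis, vecField_apply, pd, coordBasis]
  ring

theorem riemann_eq {Γ : Fin k → Fin k → Fin k → Coord k → ℝ}
    (hΓ : DifferentiableAt ℝ (connField Γ) x) (a b c d : Fin k) :
    riemann Γ a b c d x
      = curvature (connField Γ) x (coordBasis c) (coordBasis d) (coordBasis b) a := by
  have e : ∀ c d b, connField Γ x (coordBasis c) (connField Γ x (coordBasis d) (coordBasis b)) a
      = ∑ f, Γ f d b x * Γ a c f x := by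
    intro c d b
    have hl : IsLin fun w => connField Γ x (coordBasis c) w a := ⟨by simp, by simp⟩
    rw [hl.eq_sum]
    simp
  simp only [curvature, PiLp.add_apply, PiLp.sub_apply, fderiv_connField hΓ, e]
  rw [riemann, Finset.sum_sub_distrib]
  simp only [pd, coordBasis]
  rw [← add_sub_assoc]
  congr 1
  · congr 1
    exact Finset.sum_congr rfl fun f _ => mul_comm _ _
  · exact Finset.sum_congr rfl fun f _ => mul_comm _ _

theorem ricci_eq {Γ : Fin k → Fin k → Fin k → Coord k → ℝ}
    (hΓ : DifferentiableAt ℝ (connField Γ) x) (b d : Fin k) :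
    ricci Γ b d x
      = ∑ a, curvature (connField Γ) x (coordBasis a) (coordBasis d) (coordBasis b) a :=
  Finset.sum_congr rfl fun a _ => riemann_eq hΓ a b a d

theorem divergence_eq {Γ : Fin k → Fin k → Fin k → Coord k → ℝ} {V : Fin k → Coord k → ℝ}
    (hV : DifferentiableAt ℝ (vecField V) x) :
    divergence Γ V x = ∑ c, covDerivVec (connField Γ) (vecField V) x (coordBasis c) c := by
  refine Finset.sum_congr rfl fun c _ => ?_
  have hl : IsLin fun w => connField Γ x (coordBasis c) w c := ⟨by simp, by simp⟩
  rw [covDerivVec, PiLp.add_apply, fderiv_vecField hV, hl.eq_sum]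
  simp only [pd, coordBasis]
  congr 1
  refine Finset.sum_congr rfl fun d _ => ?_
  rw [connField_coordBasis, vecField_apply, vecField_apply, mul_comm]

theorem pushCoord_eq {l : ℕ} {f : Coord l → Coord k} {y : Coord l} (hf : DifferentiableAt ℝ f y)
    (A : Fin l) (a : Fin k) : pushCoord f A a y = fderiv ℝ f y (coordBasis A) a := by
  have h := ((EuclideanSpace.proj a : Coord k →L[ℝ] ℝ).hasFDerivAt.comp y hf.hasFDerivAt).fderiv
  have e : ((EuclideanSpace.proj a : Coord k →L[ℝ] ℝ) ∘ f) = fun z => f z a := by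
    funext y; simp
  rw [e] at h
  rw [pushCoord, pd, h]; simp

/-- The components of the pull-back of a covector that is given by a linear function `C`. The field
`θ` needs to have the components of `C` only at the point `f y`. -/
theorem pull₁_eq {l : ℕ} {f : Coord l → Coord k} {y : Coord l} (hf : DifferentiableAt ℝ f y)
    {θ : Fin k → Coord k → ℝ} {C : Coord k → ℝ} (hC : IsLin C)
    (e : ∀ a, θ a (f y) = C (coordBasis a)) (A : Fin l) :
    pull₁ f θ A y = C (fderiv ℝ f y (coordBasis A)) := by
  rw [hC.eq_sum]
  exact Finset.sum_congr rfl fun a _ => by rw [pushCoord_eq hf, e]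

theorem pull₂_eq {l : ℕ} {f : Coord l → Coord k} {y : Coord l} (hf : DifferentiableAt ℝ f y)
    {T : Fin k → Fin k → Coord k → ℝ} {C : Coord k → Coord k → ℝ} (hC : IsBilin C)
    (e : ∀ a b, T a b (f y) = C (coordBasis a) (coordBasis b)) (A B : Fin l) :
    pull₂ f T A B y = C (fderiv ℝ f y (coordBasis A)) (fderiv ℝ f y (coordBasis B)) := by
  rw [hC.eq_sum]
  exact Finset.sum_congr rfl fun a _ => Finset.sum_congr rfl fun b _ => by
    rw [pushCoord_eq hf, pushCoord_eq hf, e]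

theorem contDiffAt_pd {f : Coord k → ℝ} (hf : ContDiffAt ℝ ∞ f x) (a : Fin k) :
    ContDiffAt ℝ ∞ (pd a f) x :=
  (hf.fderiv_right (m := ∞) (by simp)).clm_apply contDiffAt_const

/-- The entries of the inverse of a smooth invertible matrix are smooth. -/
theorem contDiffAt_inv_entry {V ι : Type*} [NormedAddCommGroup V] [NormedSpace ℝ V] [Fintype ι]
    [DecidableEq ι] {M : V → Matrix ι ι ℝ} {x : V}
    (hM : ∀ i j, ContDiffAt ℝ ∞ (fun y => M y i j) x) (h0 : (M x).det ≠ 0) (i j : ι) :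
    ContDiffAt ℝ ∞ (fun y => (M y)⁻¹ i j) x := by
  have cdet : ∀ F : V → Matrix ι ι ℝ, (∀ i j, ContDiffAt ℝ ∞ (fun y => F y i j) x) →
      ContDiffAt ℝ ∞ (fun y => (F y).det) x := by
    intro F hF
    simp only [Matrix.det_apply']
    exact ContDiffAt.sum fun σ _ => contDiffAt_const.mul (contDiffAt_prod fun i _ => hF (σ i) i)
  simp only [Matrix.inv_def, Matrix.smul_apply, smul_eq_mul, Ring.inverse_eq_inv',
    Matrix.adjugate_apply]
  refine ContDiffAt.mul ((cdet M hM).inv h0) (cdet _ fun a b => ?_)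
  by_cases hab : a = j
  · subst hab; simpa using contDiffAt_const
  · simpa [Matrix.updateRow_apply, hab] using hM a b

end Components

/-! ### Traces and the Ricci tensor -/

section Traces

variable {k m : ℕ}

/-- Raising the index of a covector with a contravariant metric `H`. -/
def raiseIndex (H : Fin m → Fin m → ℝ) (β : Coord m → ℝ) : Coord m :=
  ∑ C, (∑ E, H C E * β (coordBasis E)) • coordBasis C

theorem raiseIndex_apply (H : Fin m → Fin m → ℝ) (β : Coord m → ℝ) (C : Fin m) :
    raiseIndex H β C = ∑ E, H C E * β (coordBasis E) := by
  simp [raiseIndex, Finset.sum_apply, Pi.single_apply]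

/-- The trace of a bilinear form with respect to a contravariant metric `H`. -/
def metricTrace (H : Fin m → Fin m → ℝ) (T : Coord m → Coord m → ℝ) : ℝ :=
  ∑ C, ∑ E, H C E * T (coordBasis C) (coordBasis E)

theorem metricTrace_mul (H : Fin m → Fin m → ℝ) {α β : Coord m → ℝ} (hα : IsLin α) :
    metricTrace H (fun v w => α v * β w) = α (raiseIndex H β) := by
  rw [raiseIndex, hα.map_sum]
  refine Finset.sum_congr rfl fun C _ => ?_
  rw [Finset.sum_mul]
  exact Finset.sum_congr rfl fun E _ => by ring

theorem metricTrace_mul' {H : Fin m → Fin m → ℝ} (hs : ∀ C E, H C E = H E C) {α β : Coord m → ℝ}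
    (hβ : IsLin β) : metricTrace H (fun v w => α v * β w) = β (raiseIndex H α) := by
  rw [← metricTrace_mul H hβ, metricTrace, metricTrace, Finset.sum_comm]
  exact Finset.sum_congr rfl fun C _ => Finset.sum_congr rfl fun E _ => by rw [hs]; ring

theorem metricTrace_add (H : Fin m → Fin m → ℝ) (T T' : Coord m → Coord m → ℝ) :
    metricTrace H (fun v w => T v w + T' v w) = metricTrace H T + metricTrace H T' := by
  simp only [metricTrace, mul_add, Finset.sum_add_distrib]

theorem metricTrace_sub (H : Fin m → Fin m → ℝ) (T T' : Coord m → Coord m → ℝ) :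
    metricTrace H (fun v w => T v w - T' v w) = metricTrace H T - metricTrace H T' := by
  simp only [metricTrace, mul_sub, Finset.sum_sub_distrib]

theorem metricTrace_const_mul (H : Fin m → Fin m → ℝ) (c : ℝ) (T : Coord m → Coord m → ℝ) :
    metricTrace H (fun v w => c * T v w) = c * metricTrace H T := by
  simp only [metricTrace, Finset.mul_sum]
  exact Finset.sum_congr rfl fun C _ => Finset.sum_congr rfl fun E _ => by ring

/-- The Ricci tensor `Ric(u, w) = tr (v ↦ R(v, w) u)`. -/
def ricciTensor (Γ : Coord k → Coord k →L[ℝ] Coord k →L[ℝ] Coord k) (x u w : Coord k) : ℝ :=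
  ∑ a, curvature Γ x (coordBasis a) w u a

/-- The linear map `v ↦ R(v, w) u`. -/
def curvatureMap (Γ : Coord k → Coord k →L[ℝ] Coord k →L[ℝ] Coord k) (x w u : Coord k) :
    Coord k →ₗ[ℝ] Coord k where
  toFun v := curvature Γ x v w u
  map_add' v v' := by simp only [curvature, map_add, add_apply]; abel
  map_smul' c v := by
    simp only [curvature, map_smul, smul_apply, RingHom.id_apply, smul_add, smul_sub]

theorem isLin_covDerivOne_left (Γ : Coord k → Coord k →L[ℝ] Coord k →L[ℝ] Coord k)
    (θ : Coord k → Coord k →L[ℝ] ℝ) (x w : Coord k) : IsLin fun v => covDerivOne Γ θ x v w :=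
  ⟨fun _ _ => by simp [covDerivOne]; ring, fun _ _ => by simp [covDerivOne]; ring⟩

theorem isLin_covDerivOne_right (Γ : Coord k → Coord k →L[ℝ] Coord k →L[ℝ] Coord k)
    (θ : Coord k → Coord k →L[ℝ] ℝ) (x v : Coord k) : IsLin fun w => covDerivOne Γ θ x v w :=
  ⟨fun _ _ => by simp [covDerivOne]; ring, fun _ _ => by simp [covDerivOne]; ring⟩

theorem isLin_covDerivTwo_one (Γ : Coord k → Coord k →L[ℝ] Coord k →L[ℝ] Coord k)
    (T : Coord k → Coord k →L[ℝ] Coord k →L[ℝ] ℝ) (x u w : Coord k) :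
    IsLin fun v => covDerivTwo Γ T x v u w :=
  ⟨fun _ _ => by simp [covDerivTwo]; ring, fun _ _ => by simp [covDerivTwo]; ring⟩

theorem isLin_covDerivTwo_two (Γ : Coord k → Coord k →L[ℝ] Coord k →L[ℝ] Coord k)
    (T : Coord k → Coord k →L[ℝ] Coord k →L[ℝ] ℝ) (x v w : Coord k) :
    IsLin fun u => covDerivTwo Γ T x v u w :=
  ⟨fun _ _ => by simp [covDerivTwo]; ring, fun _ _ => by simp [covDerivTwo]; ring⟩

theorem isLin_covDerivTwo_three (Γ : Coord k → Coord k →L[ℝ] Coord k →L[ℝ] Coord k)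
    (T : Coord k → Coord k →L[ℝ] Coord k →L[ℝ] ℝ) (x v u : Coord k) :
    IsLin fun w => covDerivTwo Γ T x v u w :=
  ⟨fun _ _ => by simp [covDerivTwo]; ring, fun _ _ => by simp [covDerivTwo]; ring⟩

namespace NullStructure.Slice

variable {Ω : Set (Coord k)} {D : NullStructure Ω} {O : Set (Coord m)} (S : D.Slice O)
  {z : Coord m}

/-- `H` is the contravariant metric of the induced metric at the point `z`. -/
structure IsInverse (z : Coord m) (H : Fin m → Fin m → ℝ) : Prop where
  symm : ∀ C E, H C E = H E C
  mul : ∀ C G, ∑ E, H C E * S.h z (coordBasis E) (coordBasis G) = if C = G then 1 else 0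

variable {S} {H : Fin m → Fin m → ℝ}

theorem IsInverse.sum_h (hH : S.IsInverse z H) (hz : z ∈ O) (V : Coord m) (C : Fin m) :
    ∑ E, H C E * S.h z V (coordBasis E) = V C := by
  have h : ∀ E, S.h z V (coordBasis E)
      = ∑ G, V G * S.h z (coordBasis E) (coordBasis G) := by
    intro E
    rw [((isBilin_clm (S.h z)).left (coordBasis E)).eq_sum]
    exact Finset.sum_congr rfl fun G _ => by rw [S.h_symm hz]
  simp only [h, Finset.mul_sum]
  rw [Finset.sum_comm]
  have h2 : ∀ G, ∑ E, H C E * (V G * S.h z (coordBasis E) (coordBasis G))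
      = V G * if C = G then 1 else 0 := by
    intro G
    rw [← hH.mul C G, Finset.mul_sum]
    exact Finset.sum_congr rfl fun E _ => by ring
  simp [h2]

theorem IsInverse.h_raiseIndex (hH : S.IsInverse z H) {β : Coord m → ℝ} (hβ : IsLin β)
    (v : Coord m) : S.h z (raiseIndex H β) v = β v := by
  refine (?_ : ∀ v, S.h z (raiseIndex H β) v = β v) v
  have hl := isLin_clm (S.h z (raiseIndex H β))
  intro v
  rw [hl.eq_sum, hβ.eq_sum]
  refine Finset.sum_congr rfl fun G _ => ?_
  congr 1
  rw [raiseIndex, ((isBilin_clm (S.h z)).left (coordBasis G)).map_sum]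
  simp only [Finset.sum_mul]
  rw [Finset.sum_comm]
  have h2 : ∀ E, ∑ C, H C E * β (coordBasis E) * S.h z (coordBasis C) (coordBasis G)
      = β (coordBasis E) * if E = G then 1 else 0 := by
    intro E
    rw [← hH.mul E G, Finset.mul_sum]
    exact Finset.sum_congr rfl fun C _ => by rw [hH.symm]; ring
  simp [h2]

theorem IsInverse.eq_raiseIndex (hH : S.IsInverse z H) (hz : z ∈ O) {β : Coord m → ℝ} {V : Coord m}
    (hV : ∀ v, S.h z V v = β v) : raiseIndex H β = V := by
  ext C
  rw [raiseIndex_apply, ← hH.sum_h hz]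
  simp [hV]

theorem IsInverse.raiseIndex_ell (hH : S.IsInverse z H) (hz : z ∈ O) :
    raiseIndex H (fun v => S.ell z v) = S.lam z :=
  hH.eq_raiseIndex hz (S.h_lam z hz)

/-- The trace of a bilinear form `h(A ·, ·)` is the trace of `A`. -/
theorem IsInverse.metricTrace_h (hH : S.IsInverse z H) (hz : z ∈ O) (A : Coord m → Coord m) :
    metricTrace H (fun v w => S.h z (A v) w) = ∑ C, A (coordBasis C) C :=
  Finset.sum_congr rfl fun C _ => hH.sum_h hz (A (coordBasis C)) C

/-- The expansion of a vector in the frame that consists of a basis of the tangent space of the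
submanifold and `n`. -/
theorem IsInverse.expand_apply (hH : S.IsInverse z H) (hz : z ∈ O) (V : Coord k) :
    V = ∑ C, (∑ E, H C E * D.γ (S.f z) V (fderiv ℝ S.f z (coordBasis E)))
          • fderiv ℝ S.f z (coordBasis C)
      + (D.ell (S.f z) V - D.γ (S.f z) V (fderiv ℝ S.f z (S.lam z))) • D.n (S.f z) := by
  have hβ : IsLin fun v => D.γ (S.f z) V (fderiv ℝ S.f z v) := ⟨by simp, by simp⟩
  have h := S.expand hz V (raiseIndex H fun v => D.γ (S.f z) V (fderiv ℝ S.f z v)) fun v =>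
    (hH.h_raiseIndex hβ v).symm
  rw [← S.h_lam z hz, S.h_symm hz, hH.h_raiseIndex hβ] at h
  conv_lhs => rw [h]
  simp [raiseIndex]

/-- The trace of an endomorphism computed in the frame that consists of a basis of the tangent space
of the submanifold and `n`. -/
theorem IsInverse.trace_eq (hH : S.IsInverse z H) (hz : z ∈ O) (M : Coord k →ₗ[ℝ] Coord k) :
    ∑ a, M (coordBasis a) a
      = metricTrace H (fun v w => D.γ (S.f z) (M (fderiv ℝ S.f z v)) (fderiv ℝ S.f z w))
        + (D.ell (S.f z) (M (D.n (S.f z)))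
          - D.γ (S.f z) (M (D.n (S.f z))) (fderiv ℝ S.f z (S.lam z))) := by
  have h : ∀ a, M (coordBasis a) a
      = ∑ C, ∑ E, H C E * (fderiv ℝ S.f z (coordBasis C) a
          * D.γ (S.f z) (M (coordBasis a)) (fderiv ℝ S.f z (coordBasis E)))
        + D.n (S.f z) a * (D.ell (S.f z) (M (coordBasis a))
          - D.γ (S.f z) (M (coordBasis a)) (fderiv ℝ S.f z (S.lam z))) := by
    intro a
    have e := congrArg (fun V : Coord k => V a) (hH.expand_apply hz (M (coordBasis a)))
    simp only [PiLp.add_apply, WithLp.ofLp_sum, Finset.sum_apply, PiLp.smul_apply,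
      smul_eq_mul, Finset.sum_mul] at e
    rw [e, mul_comm (D.n (S.f z) a)]
    congr 1
    exact Finset.sum_congr rfl fun C _ => Finset.sum_congr rfl fun E _ => by ring
  have hq : IsLin fun V => D.ell (S.f z) (M V)
      - D.γ (S.f z) (M V) (fderiv ℝ S.f z (S.lam z)) :=
    ⟨fun _ _ => by simp; ring, fun _ _ => by simp; ring⟩
  have hg : ∀ w, IsLin fun V => D.γ (S.f z) (M V) w := fun w => ⟨by simp, by simp⟩
  rw [hq.eq_sum, Finset.sum_congr rfl fun a _ => h a, Finset.sum_add_distrib]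
  congr 1
  rw [Finset.sum_comm, metricTrace]
  refine Finset.sum_congr rfl fun C _ => ?_
  rw [Finset.sum_comm]
  refine Finset.sum_congr rfl fun E _ => ?_
  rw [(hg _).eq_sum, Finset.mul_sum]

/-- The tangential part of the trace that gives the Ricci tensor, from the Gauss equation. -/
theorem IsInverse.metricTrace_gauss (hH : S.IsInverse z H) (hz : z ∈ O) (u w : Coord m) :
    let Nu := raiseIndex H fun v => S.U z u v
    let Nw := raiseIndex H fun v => S.U z w v
    metricTrace H (fun v t => D.γ (S.f z) (curvature D.Γ (S.f z) (fderiv ℝ S.f z v)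
        (fderiv ℝ S.f z w) (fderiv ℝ S.f z u)) (fderiv ℝ S.f z t))
      = ricciTensor S.Γh z u w
        + (covDerivTwo S.Γh S.U z (S.lam z) w u
          + S.U z w u * metricTrace H (fun v t => covDerivOne S.Γh S.ell z v t)
          + S.U z w u * S.U z (S.lam z) (S.lam z)
          + S.Q z w u * metricTrace H (fun v t => S.U z v t))
        - (covDerivTwo S.Γh S.U z w (S.lam z) u + covDerivOne S.Γh S.ell z w Nu
          + S.U z w (S.lam z) * S.U z (S.lam z) u + S.Q z Nw u) := by
  intro Nu Nw
  have hell := isLin_clm (S.ell z)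
  have hQ : IsLin fun v => S.Q z v u := by
    constructor
    · intro v v'
      simp only [Q, map_add, add_apply, (isLin_covDerivOne_left _ _ _ _).add,
        (isLin_covDerivOne_right _ _ _ _).add]
      ring
    · intro c v
      simp only [Q, map_smul, smul_apply, (isLin_covDerivOne_left _ _ _ _).smul,
        (isLin_covDerivOne_right _ _ _ _).smul, smul_eq_mul]
      ring
  have hU : ∀ w, IsLin fun v => S.U z v w := fun w => (isBilin_clm (S.U z)).left w
  have t1 := metricTrace_mul H (β := fun t => S.ell z t)
    (isLin_covDerivTwo_one S.Γh S.U z w u)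
  have t3 : metricTrace H (fun v t => S.U z v (S.lam z) * S.ell z t)
      = S.U z (S.lam z) (S.lam z) := by
    rw [metricTrace_mul H (hU _), hH.raiseIndex_ell hz]
  have t5 := metricTrace_mul H (β := fun t => S.ell z t)
    (isLin_covDerivTwo_two S.Γh S.U z w u)
  have t6 := metricTrace_mul' hH.symm (α := fun v => S.U z v u)
    (isLin_covDerivOne_right S.Γh S.ell z w)
  have t7 := metricTrace_mul H (β := fun t => S.ell z t) (hU u)
  have t8 := metricTrace_mul H (β := fun t => S.U z w t) hQ
  have eN : raiseIndex H (fun v => S.U z v u) = Nu := by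
    congr 1; funext v; rw [S.U_symm hz]
  rw [hH.raiseIndex_ell hz] at t1 t5 t7
  rw [eN] at t6
  have e : (fun v t => D.γ (S.f z) (curvature D.Γ (S.f z) (fderiv ℝ S.f z v)
        (fderiv ℝ S.f z w) (fderiv ℝ S.f z u)) (fderiv ℝ S.f z t))
      = fun v t => S.h z (curvature S.Γh z v w u) t
        + (covDerivTwo S.Γh S.U z v w u * S.ell z t
          + S.U z w u * covDerivOne S.Γh S.ell z v t
          + S.U z w u * (S.U z v (S.lam z) * S.ell z t)
          + S.Q z w u * S.U z v t)
        - (covDerivTwo S.Γh S.U z w v u * S.ell z t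
          + S.U z v u * covDerivOne S.Γh S.ell z w t
          + S.U z w (S.lam z) * (S.U z v u * S.ell z t)
          + S.Q z v u * S.U z w t) := by
    funext v t
    rw [S.γ_curvature hz]
    ring
  rw [e]
  simp only [metricTrace_sub, metricTrace_add, metricTrace_const_mul, t1, t3, t5, t6, t7, t8,
    hH.metricTrace_h hz (fun v => curvature S.Γh z v w u)]
  rfl

/-- The Ricci tensor of the induced metric is symmetric: by the Bianchi identity its antisymmetric
part is the trace of `R(w, u)`, which is `h`-antisymmetric. -/
theorem IsInverse.ricciTensor_symm (hH : S.IsInverse z H) (hz : z ∈ O) (u w : Coord m) :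
    ricciTensor S.Γh z u w = ricciTensor S.Γh z w u := by
  have bi : ∀ C, curvature S.Γh z (coordBasis C) w u C - curvature S.Γh z (coordBasis C) u w C
      = -curvature S.Γh z w u (coordBasis C) C := by
    intro C
    have h := congrArg (fun V : Coord m => V C) (curvature_bianchi (S.Γh_diff z hz)
      ((S.eventually_mem hz).mono fun y hy => S.Γh_symm y hy) (coordBasis C) w u)
    rw [curvature_swap u (coordBasis C)] at h
    simp only [PiLp.add_apply, PiLp.neg_apply, PiLp.zero_apply] at h
    linarith
  have tr := hH.metricTrace_h hz (fun v => curvature S.Γh z w u v)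
  have anti : metricTrace H (fun v t => S.h z (curvature S.Γh z w u v) t)
      = -metricTrace H (fun v t => S.h z (curvature S.Γh z w u v) t) := by
    conv_lhs => rw [metricTrace, Finset.sum_comm]
    rw [metricTrace, ← Finset.sum_neg_distrib]
    refine Finset.sum_congr rfl fun C _ => ?_
    rw [← Finset.sum_neg_distrib]
    refine Finset.sum_congr rfl fun E _ => ?_
    have h := S.h_curvature_antisymm hz w u (coordBasis C) (coordBasis E)
    rw [S.h_symm hz (coordBasis C)] at h
    rw [hH.symm E C]
    linear_combination H C E * h
  have h0 : ∑ C, curvature S.Γh z w u (coordBasis C) C = 0 := by rw [← tr]; linarith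
  have h1 : ricciTensor S.Γh z u w - ricciTensor S.Γh z w u = 0 := by
    rw [ricciTensor, ricciTensor, ← Finset.sum_sub_distrib, Finset.sum_congr rfl fun C _ => bi C,
      Finset.sum_neg_distrib, h0, neg_zero]
  linarith

/-- The symmetrized pull-back of the Ricci tensor of the metric hypersurface connection, the sum of
`metricTrace_gauss` and `transverse_curvature`. -/
theorem IsInverse.ricciTensor_pullback (hH : S.IsInverse z H) (hz : z ∈ O) (u w : Coord m) :
    let Nu := raiseIndex H fun v => S.U z u v
    let Nw := raiseIndex H fun v => S.U z w v
    let df := fderiv ℝ S.f z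
    ricciTensor D.Γ (S.f z) (df u) (df w) + ricciTensor D.Γ (S.f z) (df w) (df u)
      = 2 * ricciTensor S.Γh z u w + 4 * covDerivTwo S.Γh S.U z (S.lam z) u w
        + 2 * S.U z u w * metricTrace H (fun v t => covDerivOne S.Γh S.ell z v t)
        + 4 * S.U z u w * S.U z (S.lam z) (S.lam z)
        + 2 * S.Q z u w * metricTrace H (fun v t => S.U z v t)
        - 2 * covDerivTwo S.Γh S.U z w (S.lam z) u - 2 * covDerivTwo S.Γh S.U z u (S.lam z) w
        - covDerivOne S.Γh S.ell z w Nu - covDerivOne S.Γh S.ell z u Nw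
        - 4 * S.U z (S.lam z) w * S.U z (S.lam z) u - S.Q z Nw u - S.Q z Nu w
        + covDerivOne S.Γh S.s z w u + covDerivOne S.Γh S.s z u w
        - 6 * S.s z (S.lam z) * S.U z u w
        - (covDerivOne S.Γh S.ell z Nw u - covDerivOne S.Γh S.ell z u Nw) / 2
        - (covDerivOne S.Γh S.ell z Nu w - covDerivOne S.Γh S.ell z w Nu) / 2
        - 2 * S.s z u * S.s z w
        + 2 * S.U z (S.lam z) w * S.s z u + 2 * S.U z (S.lam z) u * S.s z w
        + 2 * fderiv ℝ D.ell2 (S.f z) (D.n (S.f z)) * S.U z u w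
        + 2 * S.delta z * (lieDerivTwo D.n D.U (S.f z) (df u) (df w) - S.U z u Nw) := by
  intro Nu Nw df
  have hN : ∀ u v, S.h z (raiseIndex H fun v => S.U z u v) v = S.U z u v := fun u v =>
    hH.h_raiseIndex (isLin_clm (S.U z u)) v
  have T := S.transverse_curvature hz u w Nu Nw (hN u) (hN w)
  have G1 := hH.metricTrace_gauss hz u w
  have G2 := hH.metricTrace_gauss hz w u
  have R1 := hH.trace_eq hz (curvatureMap D.Γ (S.f z) (df w) (df u))
  have R2 := hH.trace_eq hz (curvatureMap D.Γ (S.f z) (df u) (df w))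
  change ricciTensor D.Γ (S.f z) (df u) (df w) = _ + _ at R1
  change ricciTensor D.Γ (S.f z) (df w) (df u) = _ + _ at R2
  have sQ : S.Q z w u = S.Q z u w := by
    simp only [Q]; rw [S.U_symm hz w u]; ring
  have sD : covDerivTwo S.Γh S.U z (S.lam z) w u = covDerivTwo S.Γh S.U z (S.lam z) u w := by
    have h1 := S.covDeriv_U hz (S.lam z) w u
    have h2 := S.covDeriv_U hz (S.lam z) u w
    rw [D.covDeriv_U_symm (S.mapsTo z hz)] at h1
    linarith
  simp only [S.U_symm hz w u, S.U_symm hz w (S.lam z), S.U_symm hz u (S.lam z), sQ, sD,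
    hH.ricciTensor_symm hz w u] at G1 G2 T
  simp only [curvatureMap, LinearMap.coe_mk, AddHom.coe_mk] at R1 R2
  rw [R1, R2]
  simp only [df]
  linarith

/-- The pull-back of the covariant derivative of a covector field. -/
theorem covDerivOne_map (hz : z ∈ O) {θ : Coord k → Coord k →L[ℝ] ℝ}
    (hθ : DifferentiableAt ℝ θ (S.f z)) {θS : Coord m → Coord m →L[ℝ] ℝ}
    (hθS : DifferentiableAt ℝ θS z)
    (e : ∀ y ∈ O, ∀ v, θS y v = θ (S.f y) (fderiv ℝ S.f y v)) (v w : Coord m) :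
    covDerivOne D.Γ θ (S.f z) (fderiv ℝ S.f z v) (fderiv ℝ S.f z w)
      = covDerivOne S.Γh θS z v w - S.U z v w * θS z (S.lam z)
        - S.Q z v w * θ (S.f z) (D.n (S.f z)) := by
  rw [covDerivOne_pullback (Γ := D.Γ) (S.f_contDiffAt_two hz) hθ hθS
    ((S.eventually_mem hz).mono fun y hy => e y hy)]
  change _ = _ + θ (S.f z) (S.second z v w) - _ - _
  rw [S.second_eq hz]
  simp [e z hz]
  ring

/-- Contraction with the contravariant tensor `P`, expressed by the induced metric and `n`:
`P = h⁻¹ - n ⊗ ℓ♯ - ℓ♯ ⊗ n - (ℓ⁽²⁾ - ℓ⁽²⁾_∥) n ⊗ n`. -/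
theorem IsInverse.sum_P (hH : S.IsInverse z H) (hz : z ∈ O) {P : Fin k → Fin k → ℝ}
    (Ps : ∀ a b, P a b = P b a)
    (Pell : ∀ a, ∑ b, P a b * D.ell (S.f z) (coordBasis b)
      + D.ell2 (S.f z) * D.n (S.f z) a = 0)
    (Pγ : ∀ a c, ∑ b, P a b * D.γ (S.f z) (coordBasis b) (coordBasis c)
      + D.n (S.f z) a * D.ell (S.f z) (coordBasis c) = if a = c then 1 else 0)
    (T : Coord k →L[ℝ] Coord k →L[ℝ] ℝ) :
    ∑ a, ∑ c, P a c * T (coordBasis a) (coordBasis c)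
      = metricTrace H (fun v w => T (fderiv ℝ S.f z v) (fderiv ℝ S.f z w))
        - T (D.n (S.f z)) (fderiv ℝ S.f z (S.lam z)) - T (fderiv ℝ S.f z (S.lam z)) (D.n (S.f z))
        - S.delta z * T (D.n (S.f z)) (D.n (S.f z)) := by
  set x := S.f z with hx'
  have hx := S.mapsTo z hz
  set df := fderiv ℝ S.f z
  -- For a product `α ⊗ β` the contraction is `α` applied to the vector `W = P(·, β)`, which is
  -- expanded along the submanifold and `n`.
  have rank_one : ∀ α β : Coord k →L[ℝ] ℝ,
      ∑ a, ∑ c, P a c * (α (coordBasis a) * β (coordBasis c))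
        = metricTrace H (fun v w => α (df v) * β (df w)) - α (D.n x) * β (df (S.lam z))
          - α (df (S.lam z)) * β (D.n x) - S.delta z * (α (D.n x) * β (D.n x)) := by
    intro α β
    set W : Coord k := ∑ a, (∑ c, P a c * β (coordBasis c)) • coordBasis a with hW
    have gW : ∀ d, D.γ x W (coordBasis d) = β (coordBasis d)
        - β (D.n x) * D.ell x (coordBasis d) := by
      intro d
      rw [hW, ((isBilin_clm (D.γ x)).left (coordBasis d)).map_sum]
      simp only [Finset.sum_mul]
      rw [Finset.sum_comm]
      have : ∀ c, ∑ a, P a c * β (coordBasis c) * D.γ x (coordBasis a) (coordBasis d)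
          = β (coordBasis c) * ((if c = d then 1 else 0) - D.n x c * D.ell x (coordBasis d)) := by
        intro c
        rw [← Pγ c d, add_sub_cancel_right, Finset.mul_sum]
        exact Finset.sum_congr rfl fun a _ => by rw [Ps]; ring
      simp only [this, mul_sub, Finset.sum_sub_distrib]
      rw [(isLin_clm β).eq_sum (D.n x), Finset.sum_mul]
      simp only [mul_ite, mul_one, mul_zero, Finset.sum_ite_eq', Finset.mem_univ, if_true]
      congr 1
      exact Finset.sum_congr rfl fun a _ => by ring
    have gW' : ∀ V, D.γ x W V = β V - β (D.n x) * D.ell x V := by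
      have hl : IsLin fun V => β V - β (D.n x) * D.ell x V :=
        ⟨fun _ _ => by simp; ring, fun _ _ => by simp; ring⟩
      intro V
      rw [(isLin_clm (D.γ x W)).eq_sum, hl.eq_sum]
      simp only [gW]
    have lW : D.ell x W = -D.ell2 x * β (D.n x) := by
      rw [hW, (isLin_clm (D.ell x)).map_sum]
      simp only [Finset.sum_mul]
      rw [Finset.sum_comm, (isLin_clm β).eq_sum (D.n x), Finset.mul_sum]
      refine Finset.sum_congr rfl fun c _ => ?_
      have h := Pell c
      rw [← eq_neg_iff_add_eq_zero] at h
      have : ∑ a, P a c * β (coordBasis c) * D.ell x (coordBasis a)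
          = β (coordBasis c) * ∑ a, P c a * D.ell x (coordBasis a) := by
        rw [Finset.mul_sum]
        exact Finset.sum_congr rfl fun a _ => by rw [Ps]; ring
      rw [this, h]; ring
    have hβ : IsLin fun v => β (df v) := ⟨by simp, by simp⟩
    have hα : IsLin fun v => α (df v) := ⟨by simp, by simp⟩
    have ex := S.expand hz W (raiseIndex H (fun v => β (df v)) - β (D.n x) • S.lam z) fun v => by
      rw [gW', map_sub, map_smul]
      simp only [sub_apply, smul_apply, smul_eq_mul]
      rw [hH.h_raiseIndex hβ, S.h_lam z hz, S.ell_eq z hz]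
    have e1 : ∑ a, ∑ c, P a c * (α (coordBasis a) * β (coordBasis c)) = α W := by
      rw [hW, (isLin_clm α).map_sum]
      refine Finset.sum_congr rfl fun a _ => ?_
      rw [Finset.sum_mul]
      exact Finset.sum_congr rfl fun c _ => by ring
    have e2 : S.ell z (raiseIndex H fun v => β (df v)) = β (df (S.lam z)) := by
      rw [← S.h_lam z hz, S.h_symm hz, hH.h_raiseIndex hβ]
    rw [e1, ex, metricTrace_mul H hα, ← hx', lW]
    simp only [map_add, map_sub, map_smul, smul_eq_mul, e2, delta]
    simp only [← hx']
    ring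
  have hT : ∀ u w, T u w = ∑ b, u b * T (coordBasis b) w := fun u w =>
    ((isBilin_clm T).left w).eq_sum u
  have key := fun b => rank_one (EuclideanSpace.proj b : Coord k →L[ℝ] ℝ) (T (coordBasis b))
  have s := Finset.sum_congr (rfl : (Finset.univ : Finset (Fin k)) = _) fun b _ => key b
  simp only [Finset.sum_sub_distrib, PiLp.proj_apply, ← Finset.mul_sum] at s
  rw [← hT, ← hT, ← hT] at s
  have l : ∑ b, ∑ a, ∑ c, P a c * ((coordBasis a : Coord k) b * T (coordBasis b) (coordBasis c))
      = ∑ a, ∑ c, P a c * T (coordBasis a) (coordBasis c) := by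
    rw [Finset.sum_comm]
    refine Finset.sum_congr rfl fun a _ => ?_
    rw [Finset.sum_comm]
    refine Finset.sum_congr rfl fun c _ => ?_
    rw [← Finset.mul_sum, ← hT]
  have r : ∑ b, metricTrace H (fun v w => df v b * T (coordBasis b) (df w))
      = metricTrace H (fun v w => T (df v) (df w)) := by
    simp only [metricTrace]
    rw [Finset.sum_comm]
    refine Finset.sum_congr rfl fun a _ => ?_
    rw [Finset.sum_comm]
    refine Finset.sum_congr rfl fun c _ => ?_
    rw [← Finset.mul_sum, ← hT]
  rw [l, r] at s
  exact s

end NullStructure.Slice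

end Traces

/-! ### Null data in coordinates -/

section CoordinateData

variable {k m : ℕ}

theorem contDiffAt_lieDer₂ {V : Fin k → Coord k → ℝ} {T : Fin k → Fin k → Coord k → ℝ}
    {x : Coord k} (hV : ∀ a, ContDiffAt ℝ ∞ (V a) x) (hT : ∀ a b, ContDiffAt ℝ ∞ (T a b) x)
    (a b : Fin k) : ContDiffAt ℝ ∞ (lieDer₂ V T a b) x :=
  ContDiffAt.sum fun c _ => (((hV c).mul (contDiffAt_pd (hT a b) c)).add
    ((hT c b).mul (contDiffAt_pd (hV c) a))).add ((hT a c).mul (contDiffAt_pd (hV c) b))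

theorem contDiffAt_christoffelFirst {g : Fin k → Fin k → Coord k → ℝ} {x : Coord k}
    (hg : ∀ a b, ContDiffAt ℝ ∞ (g a b) x) (a b d : Fin k) :
    ContDiffAt ℝ ∞ (christoffelFirst g a b d) x :=
  (((contDiffAt_pd (hg b d) a).add (contDiffAt_pd (hg a d) b)).sub
    (contDiffAt_pd (hg a b) d)).div_const 2

theorem isBilin_lieDerivTwo (V : Coord k → Coord k) (T : Coord k → Coord k →L[ℝ] Coord k →L[ℝ] ℝ)
    (x : Coord k) : IsBilin (lieDerivTwo V T x) :=
  ⟨fun _ => ⟨fun _ _ => by simp [lieDerivTwo]; ring, fun _ _ => by simp [lieDerivTwo]; ring⟩,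
    fun _ => ⟨fun _ _ => by simp [lieDerivTwo]; ring, fun _ _ => by simp [lieDerivTwo]; ring⟩⟩

theorem covDerivTwo_ext {Γ : Coord k → Coord k →L[ℝ] Coord k →L[ℝ] Coord k}
    {T : Coord k → Coord k →L[ℝ] Coord k →L[ℝ] ℝ} {x : Coord k}
    {C : Coord k → Coord k → Coord k → ℝ} (h1 : ∀ u w, IsLin fun v => C v u w)
    (h2 : ∀ v, IsBilin (C v))
    (e : ∀ a b c, covDerivTwo Γ T x (coordBasis a) (coordBasis b) (coordBasis c)
      = C (coordBasis a) (coordBasis b) (coordBasis c)) (v u w : Coord k) :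
    covDerivTwo Γ T x v u w = C v u w := by
  rw [(isLin_covDerivTwo_one Γ T x u w).eq_sum, (h1 u w).eq_sum]
  refine Finset.sum_congr rfl fun a _ => ?_
  rw [IsBilin.ext ⟨fun w => isLin_covDerivTwo_two Γ T x (coordBasis a) w,
    fun u => isLin_covDerivTwo_three Γ T x (coordBasis a) u⟩ (h2 (coordBasis a)) (e a)]

theorem isBilin_covDerivOne (Γ : Coord k → Coord k →L[ℝ] Coord k →L[ℝ] Coord k)
    (θ : Coord k → Coord k →L[ℝ] ℝ) (x : Coord k) : IsBilin (covDerivOne Γ θ x) :=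
  ⟨isLin_covDerivOne_left Γ θ x, isLin_covDerivOne_right Γ θ x⟩

namespace CoordData

/-- The components are those of smooth null hypersurface data on the open set `Ω`; the relations
between `γ, ℓ, ℓ⁽²⁾` and `P, n, n⁽²⁾` are part of `IsRegularAt`. -/
structure IsSmoothNullOn (L : CoordData k) (Ω : Set (Coord k)) : Prop where
  isOpen : IsOpen Ω
  regular : ∀ x ∈ Ω, L.IsRegularAt x
  n2_eq : ∀ x ∈ Ω, L.n2 x = 0
  γ_smooth : ∀ x ∈ Ω, ∀ a b, ContDiffAt ℝ ∞ (L.γ a b) x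
  ell_smooth : ∀ x ∈ Ω, ∀ a, ContDiffAt ℝ ∞ (L.ell a) x
  ell2_smooth : ∀ x ∈ Ω, ContDiffAt ℝ ∞ L.ell2 x
  Y_smooth : ∀ x ∈ Ω, ∀ a b, ContDiffAt ℝ ∞ (L.Y a b) x
  Y_symm : ∀ x ∈ Ω, ∀ a b, L.Y a b x = L.Y b a x

namespace IsSmoothNullOn

variable {L : CoordData k} {Ω : Set (Coord k)} (hL : L.IsSmoothNullOn Ω) {x : Coord k}

include hL

theorem pd_n2 (hx : x ∈ Ω) (a : Fin k) : pd a L.n2 x = 0 := by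
  have h : L.n2 =ᶠ[nhds x] fun _ => 0 :=
    (show ∀ᶠ y in nhds x, y ∈ Ω from hL.isOpen.mem_nhds hx).mono hL.n2_eq
  rw [pd, h.fderiv_eq]
  simp

/-- `P` and `n` are smooth, being entries of the inverse of the matrix of the form `𝒜`. -/
theorem smooth_P_n (hx : x ∈ Ω) :
    (∀ a b, ContDiffAt ℝ ∞ (L.P a b) x) ∧ ∀ a, ContDiffAt ℝ ∞ (L.n a) x := by
  let M : Coord k → Matrix (Fin k ⊕ Unit) (Fin k ⊕ Unit) ℝ := fun y =>
    Matrix.fromBlocks (Matrix.of fun a b => L.γ a b y) (Matrix.of fun a _ => L.ell a y)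
      (Matrix.of fun _ b => L.ell b y) (Matrix.of fun _ _ => L.ell2 y)
  let W : Coord k → Matrix (Fin k ⊕ Unit) (Fin k ⊕ Unit) ℝ := fun y =>
    Matrix.fromBlocks (Matrix.of fun a b => L.P a b y) (Matrix.of fun a _ => L.n a y)
      (Matrix.of fun _ b => L.n b y) (Matrix.of fun _ _ => L.n2 y)
  have hMW : ∀ y ∈ Ω, W y * M y = 1 := by
    intro y hy
    have h := hL.regular y hy
    ext i j
    rcases i with a | _ <;> rcases j with c | _
    · simpa [M, W, Matrix.fromBlocks_multiply, Matrix.mul_apply, Matrix.one_apply] using h.prod4 a c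
    · simpa [M, W, Matrix.fromBlocks_multiply, Matrix.mul_apply, Matrix.one_apply, mul_comm]
        using h.prod3 a
    · have := h.prod1.self_of_nhds c
      simp only [h.γ_symm.self_of_nhds c] at this
      simpa [M, W, Matrix.fromBlocks_multiply, Matrix.mul_apply, Matrix.one_apply, mul_comm]
        using this
    · simpa [M, W, Matrix.fromBlocks_multiply, Matrix.mul_apply, Matrix.one_apply, mul_comm]
        using h.prod2
  have dM : ∀ i j, ContDiffAt ℝ ∞ (fun y => M y i j) x := by
    rintro (a | _) (b | _)
    · exact hL.γ_smooth x hx a b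
    · exact hL.ell_smooth x hx a
    · exact hL.ell_smooth x hx b
    · exact hL.ell2_smooth x hx
  have h0 : (M x).det ≠ 0 := by
    intro h0
    have := congrArg Matrix.det (hMW x hx)
    rw [Matrix.det_mul, h0] at this
    simp at this
  have eqW : ∀ i j, ContDiffAt ℝ ∞ (fun y => W y i j) x := by
    intro i j
    refine (contDiffAt_inv_entry dM h0 i j).congr_of_eventuallyEq ?_
    filter_upwards [hL.isOpen.mem_nhds hx] with y hy
    rw [Matrix.inv_eq_left_inv (hMW y hy)]
  exact ⟨fun a b => eqW (Sum.inl a) (Sum.inl b), fun a => eqW (Sum.inl a) (Sum.inr ())⟩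

theorem P_smooth (hx : x ∈ Ω) (a b : Fin k) : ContDiffAt ℝ ∞ (L.P a b) x := (hL.smooth_P_n hx).1 a b

theorem n_smooth (hx : x ∈ Ω) (a : Fin k) : ContDiffAt ℝ ∞ (L.n a) x := (hL.smooth_P_n hx).2 a

theorem U_smooth (hx : x ∈ Ω) (a b : Fin k) : ContDiffAt ℝ ∞ (L.U a b) x := by
  have h2 : ContDiffAt ℝ ∞ L.n2 x := contDiffAt_const.congr_of_eventuallyEq
    ((show ∀ᶠ y in nhds x, y ∈ Ω from hL.isOpen.mem_nhds hx).mono hL.n2_eq)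
  exact ((contDiffAt_lieDer₂ (hL.n_smooth hx) (hL.γ_smooth x hx) a b).div_const 2).add
    ((((hL.ell_smooth x hx a).mul (contDiffAt_pd h2 b)).add
      ((hL.ell_smooth x hx b).mul (contDiffAt_pd h2 a))).div_const 2)

theorem F_smooth (hx : x ∈ Ω) (a b : Fin k) : ContDiffAt ℝ ∞ (L.F a b) x :=
  ((contDiffAt_pd (hL.ell_smooth x hx b) a).sub
    (contDiffAt_pd (hL.ell_smooth x hx a) b)).div_const 2

theorem s_smooth (hx : x ∈ Ω) (b : Fin k) : ContDiffAt ℝ ∞ (L.s b) x :=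
  ContDiffAt.sum fun a _ => (hL.n_smooth hx a).mul (hL.F_smooth hx a b)

theorem r_smooth (hx : x ∈ Ω) (b : Fin k) : ContDiffAt ℝ ∞ (L.r b) x :=
  ContDiffAt.sum fun a _ => (hL.n_smooth hx a).mul (hL.Y_smooth x hx a b)

theorem mhConnection_smooth (hx : x ∈ Ω) (c a b : Fin k) :
    ContDiffAt ℝ ∞ (L.mhConnection c a b) x :=
  (ContDiffAt.sum fun d _ => (hL.P_smooth hx c d).mul
    (contDiffAt_christoffelFirst (hL.γ_smooth x hx) a b d)).add
    ((hL.n_smooth hx c).mul (((contDiffAt_pd (hL.ell_smooth x hx b) a).add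
      (contDiffAt_pd (hL.ell_smooth x hx a) b)).div_const 2))

theorem isMHConnectionAt (hx : x ∈ Ω) : L.IsMHConnectionAt L.mhConnection x :=
  ((hL.regular x hx).isMHConnectionAt_iff _).2 fun _ _ _ => rfl

omit hL in
theorem differentiableAt_of_smooth {V W : Type*} [NormedAddCommGroup V] [NormedSpace ℝ V]
    [NormedAddCommGroup W] [NormedSpace ℝ W] {g : V → W} {y : V} (h : ContDiffAt ℝ ∞ g y) :
    DifferentiableAt ℝ g y := h.differentiableAt (by simp)

/-- Null hypersurface data in coordinates, with the tensor fields assembled from their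
components. -/
def nullStructure : NullStructure Ω where
  γ := bilinField L.γ
  ell := covecField L.ell
  ell2 := L.ell2
  n := vecField L.n
  Γ := connField L.mhConnection
  U := bilinField L.U
  s := covecField L.s
  isOpen := hL.isOpen
  γ_smooth x hx := contDiffAt_bilinField (hL.γ_smooth x hx)
  ell_smooth x hx := contDiffAt_covecField (hL.ell_smooth x hx)
  ell2_smooth := hL.ell2_smooth
  n_smooth x hx := contDiffAt_vecField (hL.n_smooth hx)
  Γ_smooth x hx := contDiffAt_connField (hL.mhConnection_smooth hx)
  U_smooth x hx := contDiffAt_bilinField (hL.U_smooth hx)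
  s_smooth x hx := contDiffAt_covecField (hL.s_smooth hx)
  γ_symm x hx v w := by
    refine IsBilin.ext (isBilin_clm (bilinField L.γ x))
      (C' := fun v w => bilinField L.γ x w v)
      ⟨(isBilin_clm (bilinField L.γ x)).right, (isBilin_clm (bilinField L.γ x)).left⟩ ?_ v w
    intro a b
    simp only [bilinField_coordBasis]
    exact (hL.regular x hx).γ_symm.self_of_nhds a b
  γ_n x hx w := by
    rw [((isLin_clm (bilinField L.γ x (vecField L.n x)))).eq_sum]
    refine Finset.sum_eq_zero fun b _ => ?_
    rw [bilinField_vecField_left]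
    have h := (hL.regular x hx).prod1.self_of_nhds b
    rw [hL.n2_eq x hx, zero_mul, add_zero] at h
    rw [← mul_zero (w b), ← h]
    congr 1
    exact Finset.sum_congr rfl fun a _ => by
      rw [(hL.regular x hx).γ_symm.self_of_nhds a b, mul_comm]
  ell_n x hx := by
    have h := (hL.regular x hx).prod2
    rw [hL.n2_eq x hx, zero_mul, add_zero] at h
    rw [covecField_vecField, ← h]
    exact Finset.sum_congr rfl fun a _ => mul_comm _ _
  U_eq x hx v w := by
    have hb := isBilin_lieDerivTwo (vecField L.n) (bilinField L.γ) x
    refine IsBilin.ext (isBilin_clm (bilinField L.U x))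
      (C' := fun v w => lieDerivTwo (vecField L.n) (bilinField L.γ) x v w / 2)
      ⟨fun w => ⟨fun u v => by rw [(hb.left w).add]; ring,
        fun c u => by rw [(hb.left w).smul]; ring⟩,
        fun u => ⟨fun v w => by rw [(hb.right u).add]; ring,
        fun c v => by rw [(hb.right u).smul]; ring⟩⟩ ?_ v w
    intro a b
    rw [bilinField_coordBasis, ← lieDer₂_eq
      (differentiableAt_of_smooth (contDiffAt_vecField (hL.n_smooth hx)))
      (differentiableAt_of_smooth (contDiffAt_bilinField (hL.γ_smooth x hx))), CoordData.U,
      hL.pd_n2 hx, hL.pd_n2 hx]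
    ring
  s_eq x hx v := by
    have hd := differentiableAt_of_smooth (contDiffAt_covecField (hL.ell_smooth x hx))
    have hl : IsLin fun v => (fderiv ℝ (covecField L.ell) x (vecField L.n x) v
        - fderiv ℝ (covecField L.ell) x v (vecField L.n x)) / 2 :=
      ⟨fun _ _ => by simp; ring, fun _ _ => by simp; ring⟩
    rw [(isLin_clm (covecField L.s x)).eq_sum, hl.eq_sum]
    refine Finset.sum_congr rfl fun b _ => ?_
    congr 1
    have hl2 : IsLin fun V => (fderiv ℝ (covecField L.ell) x V (coordBasis b)
        - fderiv ℝ (covecField L.ell) x (coordBasis b) V) / 2 :=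
      ⟨fun _ _ => by simp; ring, fun _ _ => by simp; ring⟩
    rw [hl2.eq_sum, covecField_coordBasis]
    refine Finset.sum_congr rfl fun a _ => ?_
    rw [fderiv_covecField hd, fderiv_covecField hd, vecField_apply]
    rfl
  Γ_symm x hx v w := by
    ext c
    refine IsBilin.ext (C := fun v w => connField L.mhConnection x v w c)
      (C' := fun v w => connField L.mhConnection x w v c)
      ⟨fun _ => ⟨by simp, by simp⟩, fun _ => ⟨by simp, by simp⟩⟩
      ⟨fun _ => ⟨by simp, by simp⟩, fun _ => ⟨by simp, by simp⟩⟩ (fun a b => ?_) v w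
    simp only [connField_coordBasis, vecField_apply]
    exact (hL.isMHConnectionAt hx).1 c a b
  covDeriv_γ x hx v u w := by
    refine covDerivTwo_ext (C := fun v u w => -bilinField L.U x v u * covecField L.ell x w
      - bilinField L.U x v w * covecField L.ell x u) (fun u w => ?_)
      (fun v => ⟨fun w => ?_, fun u => ?_⟩) (fun a b c => ?_) v u w
    · exact ⟨fun _ _ => by simp; ring, fun _ _ => by simp; ring⟩
    · exact ⟨fun _ _ => by simp; ring, fun _ _ => by simp; ring⟩
    · exact ⟨fun _ _ => by simp; ring, fun _ _ => by simp; ring⟩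
    · rw [← covDer₂_eq (differentiableAt_of_smooth (contDiffAt_bilinField (hL.γ_smooth x hx)))]
      simp only [bilinField_coordBasis, covecField_coordBasis]
      exact (hL.isMHConnectionAt hx).2.1 a b c
  covDeriv_ell x hx v w := by
    have hb := isBilin_covDerivOne (connField L.mhConnection) (covecField L.ell) x
    refine IsBilin.ext
      (C := fun v w => covDerivOne (connField L.mhConnection) (covecField L.ell) x v w
        + covDerivOne (connField L.mhConnection) (covecField L.ell) x w v)
      (C' := fun v w => -2 * L.ell2 x * bilinField L.U x v w)
      ⟨fun w => ⟨fun u v => by rw [(hb.left w).add, (hb.right w).add]; ring,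
        fun c u => by rw [(hb.left w).smul, (hb.right w).smul]; ring⟩,
        fun u => ⟨fun v w => by rw [(hb.left u).add, (hb.right u).add]; ring,
        fun c v => by rw [(hb.left u).smul, (hb.right u).smul]; ring⟩⟩
      ⟨fun _ => ⟨fun _ _ => by simp; ring, fun _ _ => by simp; ring⟩,
        fun _ => ⟨fun _ _ => by simp; ring, fun _ _ => by simp; ring⟩⟩ (fun a b => ?_) v w
    have hd := differentiableAt_of_smooth (contDiffAt_covecField (hL.ell_smooth x hx))
    rw [← covDer₁_eq hd, ← covDer₁_eq hd, bilinField_coordBasis]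
    exact (hL.isMHConnectionAt hx).2.2 a b

/-- A vector in the radical of `γ` is a multiple of `n`, because `P γ + n ⊗ ℓ` is the identity. -/
theorem eq_smul_n (hx : x ∈ Ω) (V : Coord k) (hV : ∀ w, bilinField L.γ x V w = 0) :
    V = covecField L.ell x V • vecField L.n x := by
  ext a
  have h : ∀ c, V c * (if a = c then (1 : ℝ) else 0)
      = ∑ b, L.P a b x * (V c * L.γ b c x) + L.n a x * (V c * L.ell c x) := by
    intro c
    rw [← (hL.regular x hx).prod4 a c, mul_add, Finset.mul_sum]
    congr 1
    · exact Finset.sum_congr rfl fun b _ => by ring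
    · ring
  have h2 := Finset.sum_congr (rfl : (Finset.univ : Finset (Fin k)) = _) fun c _ => h c
  rw [Finset.sum_add_distrib, Finset.sum_comm] at h2
  simp only [← Finset.mul_sum] at h2
  have h3 : ∀ b, ∑ c, V c * L.γ b c x = 0 := by
    intro b
    rw [← hV (coordBasis b), ((isBilin_clm (bilinField L.γ x)).left (coordBasis b)).eq_sum]
    exact Finset.sum_congr rfl fun c _ => by
      rw [bilinField_coordBasis, (hL.regular x hx).γ_symm.self_of_nhds c b]
  have h4 : ∑ c, V c * L.ell c x = covecField L.ell x V := by
    rw [(isLin_clm (covecField L.ell x)).eq_sum]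
    simp
  simp only [h3, h4] at h2
  simp at h2
  simp [h2, mul_comm]

end IsSmoothNullOn

/-- A parametrized submanifold `f : O → Ω` which is transverse to `n`: no multiple of `n`, zero
included, is the image of a non-zero vector, so that `f` is an immersion. -/
structure IsTransverseMap (L : CoordData k) (Ω : Set (Coord k)) (f : Coord m → Coord k)
    (O : Set (Coord m)) : Prop where
  isOpen : IsOpen O
  mapsTo : ∀ z ∈ O, f z ∈ Ω
  smooth : ∀ z ∈ O, ContDiffAt ℝ ∞ f z
  transverse : ∀ z ∈ O, ∀ (v : Coord m) (c : ℝ),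
    fderiv ℝ f z v = c • vecField L.n (f z) → v = 0

section Pullback

variable {f : Coord m → Coord k} {z : Coord m}

theorem covecField_pull₁ (hf : DifferentiableAt ℝ f z) (θ : Fin k → Coord k → ℝ) (v : Coord m) :
    covecField (pull₁ f θ) z v = covecField θ (f z) (fderiv ℝ f z v) := by
  have hl : IsLin fun v => covecField θ (f z) (fderiv ℝ f z v) := ⟨by simp, by simp⟩
  rw [(isLin_clm (covecField (pull₁ f θ) z)).eq_sum, hl.eq_sum]
  refine Finset.sum_congr rfl fun A _ => ?_
  rw [covecField_coordBasis, pull₁_eq hf (isLin_clm (covecField θ (f z))) fun a => by simp]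

theorem bilinField_pull₂ (hf : DifferentiableAt ℝ f z) (T : Fin k → Fin k → Coord k → ℝ)
    (v w : Coord m) :
    bilinField (pull₂ f T) z v w = bilinField T (f z) (fderiv ℝ f z v) (fderiv ℝ f z w) := by
  refine IsBilin.ext (isBilin_clm (bilinField (pull₂ f T) z))
    (C' := fun v w => bilinField T (f z) (fderiv ℝ f z v) (fderiv ℝ f z w))
    ⟨fun _ => ⟨by simp, by simp⟩, fun _ => ⟨by simp, by simp⟩⟩ (fun A B => ?_) v w
  rw [bilinField_coordBasis, pull₂_eq hf (isBilin_clm (bilinField T (f z))) fun a b => by simp]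

theorem contDiffAt_pushCoord (hf : ContDiffAt ℝ ∞ f z) (A : Fin m) (a : Fin k) :
    ContDiffAt ℝ ∞ (pushCoord f A a) z :=
  contDiffAt_pd ((EuclideanSpace.proj a : Coord k →L[ℝ] ℝ).contDiff.contDiffAt.comp z hf) A

theorem contDiffAt_pull₁ (hf : ContDiffAt ℝ ∞ f z) {θ : Fin k → Coord k → ℝ}
    (hθ : ∀ a, ContDiffAt ℝ ∞ (θ a) (f z)) (A : Fin m) : ContDiffAt ℝ ∞ (pull₁ f θ A) z :=
  ContDiffAt.sum fun a _ => (contDiffAt_pushCoord hf A a).mul ((hθ a).comp z hf)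

theorem contDiffAt_pull₂ (hf : ContDiffAt ℝ ∞ f z) {T : Fin k → Fin k → Coord k → ℝ}
    (hT : ∀ a b, ContDiffAt ℝ ∞ (T a b) (f z)) (A B : Fin m) :
    ContDiffAt ℝ ∞ (pull₂ f T A B) z :=
  ContDiffAt.sum fun a _ => ContDiffAt.sum fun b _ =>
    ((contDiffAt_pushCoord hf A a).mul (contDiffAt_pushCoord hf B b)).mul ((hT a b).comp z hf)

end Pullback

namespace IsTransverseMap

variable {L : CoordData (m + 1)} {Ω : Set (Coord (m + 1))} {f : Coord m → Coord (m + 1)}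
  {O : Set (Coord m)} (hf : L.IsTransverseMap Ω f O) (hL : L.IsSmoothNullOn Ω) {z : Coord m}

include hf

theorem differentiableAt (hz : z ∈ O) : DifferentiableAt ℝ f z :=
  (hf.smooth z hz).differentiableAt (by simp)

/-- The tangent space of the submanifold and `n` span the whole space, by a count of dimensions. -/
theorem exists_decomposition (hL : L.IsSmoothNullOn Ω) (hz : z ∈ O) (V : Coord (m + 1)) :
    ∃ (v : Coord m) (c : ℝ), V = fderiv ℝ f z v + c • vecField L.n (f z) := by
  let Φ : (Coord m × ℝ) →ₗ[ℝ] Coord (m + 1) :=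
    (fderiv ℝ f z : Coord m →ₗ[ℝ] Coord (m + 1)).coprod
      (LinearMap.toSpanSingleton ℝ _ (vecField L.n (f z)))
  have hΦ : ∀ v c, Φ (v, c) = fderiv ℝ f z v + c • vecField L.n (f z) := fun v c => by simp [Φ]
  have inj : Function.Injective Φ := by
    rw [← LinearMap.ker_eq_bot, LinearMap.ker_eq_bot']
    rintro ⟨v, c⟩ h
    rw [hΦ] at h
    have hv : v = 0 := hf.transverse z hz v (-c) <| by
      rw [neg_smul]
      exact eq_neg_of_add_eq_zero_left h
    subst hv
    have h1 := congrArg (hL.nullStructure.ell (f z)) h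
    rw [map_add, map_zero, map_zero, zero_add, map_smul] at h1
    have h2 : hL.nullStructure.ell (f z) (vecField L.n (f z)) = 1 :=
      hL.nullStructure.ell_n _ (hf.mapsTo z hz)
    rw [h2] at h1
    simp at h1
    simp [h1]
  have surj := (LinearMap.injective_iff_surjective_of_finrank_eq_finrank (f := Φ) (by simp)).1 inj
  obtain ⟨⟨v, c⟩, h⟩ := surj V
  exact ⟨v, c, by rw [← h, hΦ]⟩

/-- A vector that is `γ`-orthogonal to a transverse submanifold is a multiple of `n`. -/
theorem eq_smul_n (hL : L.IsSmoothNullOn Ω) (hz : z ∈ O) (V : Coord (m + 1))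
    (hV : ∀ v, bilinField L.γ (f z) V (fderiv ℝ f z v) = 0) :
    V = covecField L.ell (f z) V • vecField L.n (f z) := by
  have hx := hf.mapsTo z hz
  refine hL.eq_smul_n hx V fun w => ?_
  obtain ⟨v, c, rfl⟩ := hf.exists_decomposition hL hz w
  have h : bilinField L.γ (f z) V (vecField L.n (f z)) = 0 := by
    have h1 := hL.nullStructure.γ_symm _ hx V (vecField L.n (f z))
    exact h1.trans (hL.nullStructure.γ_n _ hx V)
  rw [map_add, hV, map_smul, h]
  simp

/-- The induced metric is non-degenerate: the image of a vector in its radical is `γ`-orthogonal to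
the submanifold, hence a multiple of `n`. -/
theorem det_ne_zero (hL : L.IsSmoothNullOn Ω) (hz : z ∈ O) :
    (Matrix.of fun A B => pull₂ f L.γ A B z).det ≠ 0 := by
  intro h0
  obtain ⟨v, hv0, hv⟩ := Matrix.exists_mulVec_eq_zero_iff.2 h0
  apply hv0
  set w : Coord m := WithLp.toLp 2 v
  have hw : ∀ A, ∑ B, w B * pull₂ f L.γ A B z = 0 := by
    intro A
    refine Eq.trans (Finset.sum_congr rfl fun B _ => ?_) (congrFun hv A)
    exact mul_comm _ _
  have h1 : ∀ u, bilinField (pull₂ f L.γ) z u w = 0 := by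
    intro u
    rw [(isBilin_clm (bilinField (pull₂ f L.γ) z)).eq_sum]
    refine Finset.sum_eq_zero fun A _ => ?_
    rw [← mul_zero (u A), ← hw A, Finset.mul_sum]
    exact Finset.sum_congr rfl fun B _ => by simp; ring
  have h2 := hf.eq_smul_n hL hz (fderiv ℝ f z w) fun u => by
    have h3 := h1 u
    rw [bilinField_pull₂ (hf.differentiableAt hz)] at h3
    exact (hL.nullStructure.γ_symm _ (hf.mapsTo z hz) _ _).trans h3
  have h3 := hf.transverse z hz w _ h2
  funext B
  have := congrArg (fun V : Coord m => V B) h3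
  simpa [w] using this

theorem pull_γ_symm (hL : L.IsSmoothNullOn Ω) (hz : z ∈ O) (A B : Fin m) :
    pull₂ f L.γ A B z = pull₂ f L.γ B A z := by
  rw [← bilinField_coordBasis (pull₂ f L.γ), ← bilinField_coordBasis (pull₂ f L.γ),
    bilinField_pull₂ (hf.differentiableAt hz), bilinField_pull₂ (hf.differentiableAt hz)]
  exact hL.nullStructure.γ_symm _ (hf.mapsTo z hz) _ _

theorem inverseMetric_symm (hL : L.IsSmoothNullOn Ω) (hz : z ∈ O) (A B : Fin m) :
    inverseMetric (pull₂ f L.γ) A B z = inverseMetric (pull₂ f L.γ) B A z := by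
  have h : (Matrix.of fun A B => pull₂ f L.γ A B z).transpose
      = Matrix.of fun A B => pull₂ f L.γ A B z := by
    ext A B
    exact hf.pull_γ_symm hL hz B A
  have h2 := Matrix.transpose_nonsing_inv (Matrix.of fun A B => pull₂ f L.γ A B z)
  rw [h] at h2
  exact congrFun (congrFun h2 B) A

theorem inverseMetric_mul (hL : L.IsSmoothNullOn Ω) (hz : z ∈ O) (C G : Fin m) :
    ∑ E, inverseMetric (pull₂ f L.γ) C E z * pull₂ f L.γ E G z = if C = G then 1 else 0 := by
  have h := Matrix.nonsing_inv_mul (Matrix.of fun A B => pull₂ f L.γ A B z)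
    (isUnit_iff_ne_zero.2 (hf.det_ne_zero hL hz))
  have h2 := congrFun (congrFun h C) G
  rw [Matrix.mul_apply, Matrix.one_apply] at h2
  exact h2

theorem contDiffAt_pull_γ (hL : L.IsSmoothNullOn Ω) (hz : z ∈ O) (A B : Fin m) :
    ContDiffAt ℝ ∞ (pull₂ f L.γ A B) z :=
  contDiffAt_pull₂ (hf.smooth z hz) (hL.γ_smooth _ (hf.mapsTo z hz)) A B

theorem contDiffAt_inverseMetric (hL : L.IsSmoothNullOn Ω) (hz : z ∈ O) (A B : Fin m) :
    ContDiffAt ℝ ∞ (inverseMetric (pull₂ f L.γ) A B) z :=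
  contDiffAt_inv_entry (M := fun y => Matrix.of fun A B => pull₂ f L.γ A B y)
    (fun A B => hf.contDiffAt_pull_γ hL hz A B) (hf.det_ne_zero hL hz) A B

theorem contDiffAt_leviCivita (hL : L.IsSmoothNullOn Ω) (hz : z ∈ O) (C A B : Fin m) :
    ContDiffAt ℝ ∞ (leviCivita (pull₂ f L.γ) C A B) z :=
  ContDiffAt.sum fun E _ => (hf.contDiffAt_inverseMetric hL hz C E).mul
    (contDiffAt_christoffelFirst (hf.contDiffAt_pull_γ hL hz) A B E)

theorem pd_pull_γ_symm (hL : L.IsSmoothNullOn Ω) (hz : z ∈ O) (C A B : Fin m) :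
    pd C (pull₂ f L.γ A B) z = pd C (pull₂ f L.γ B A) z := by
  have h : pull₂ f L.γ A B =ᶠ[nhds z] pull₂ f L.γ B A :=
    (show ∀ᶠ y in nhds z, y ∈ O from hf.isOpen.mem_nhds hz).mono fun y hy =>
      hf.pull_γ_symm hL hy A B
  rw [pd, pd, h.fderiv_eq]

theorem leviCivita_symm (hL : L.IsSmoothNullOn Ω) (hz : z ∈ O) (C A B : Fin m) :
    leviCivita (pull₂ f L.γ) C A B z = leviCivita (pull₂ f L.γ) C B A z := by
  refine Finset.sum_congr rfl fun E _ => ?_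
  congr 1
  simp only [christoffelFirst]
  rw [hf.pd_pull_γ_symm hL hz E A B]
  ring

theorem sum_leviCivita (hL : L.IsSmoothNullOn Ω) (hz : z ∈ O) (A B G : Fin m) :
    ∑ C, leviCivita (pull₂ f L.γ) C A B z * pull₂ f L.γ C G z
      = christoffelFirst (pull₂ f L.γ) A B G z := by
  simp only [leviCivita, Finset.sum_mul]
  rw [Finset.sum_comm]
  have h : ∀ E, ∑ C, inverseMetric (pull₂ f L.γ) C E z * christoffelFirst (pull₂ f L.γ) A B E z
      * pull₂ f L.γ C G z = (if E = G then 1 else 0) * christoffelFirst (pull₂ f L.γ) A B E z := by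
    intro E
    rw [← hf.inverseMetric_mul hL hz E G, Finset.sum_mul]
    exact Finset.sum_congr rfl fun C _ => by rw [hf.inverseMetric_symm hL hz C E]; ring
  simp [h]

theorem covDer₂_leviCivita (hL : L.IsSmoothNullOn Ω) (hz : z ∈ O) (A B C : Fin m) :
    covDer₂ (leviCivita (pull₂ f L.γ)) (pull₂ f L.γ) A B C z = 0 := by
  rw [covDer₂, hf.sum_leviCivita hL hz]
  have h : ∑ E, leviCivita (pull₂ f L.γ) E A C z * pull₂ f L.γ B E z
      = christoffelFirst (pull₂ f L.γ) A C B z := by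
    rw [← hf.sum_leviCivita hL hz]
    exact Finset.sum_congr rfl fun E _ => by rw [hf.pull_γ_symm hL hz B E]
  rw [h]
  simp only [christoffelFirst]
  rw [hf.pd_pull_γ_symm hL hz A C B, hf.pd_pull_γ_symm hL hz C A B, hf.pd_pull_γ_symm hL hz B A C]
  rw [hf.pd_pull_γ_symm hL hz C B A]
  ring

/-- The pull-back of `ℓ` with its index raised by the induced metric. -/
def ellUp (L : CoordData (m + 1)) (f : Coord m → Coord (m + 1)) (C : Fin m) (z : Coord m) : ℝ :=
  ∑ E, inverseMetric (pull₂ f L.γ) C E z * pull₁ f L.ell E z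

/-- The transverse submanifold, with the tensor fields assembled from their components. -/
def slice : hL.nullStructure.Slice O where
  f := f
  h := bilinField (pull₂ f L.γ)
  Γh := connField (leviCivita (pull₂ f L.γ))
  ell := covecField (pull₁ f L.ell)
  U := bilinField (pull₂ f L.U)
  s := covecField (pull₁ f L.s)
  lam := vecField (ellUp L f)
  isOpen := hf.isOpen
  mapsTo := hf.mapsTo
  f_smooth := hf.smooth
  h_smooth z hz := contDiffAt_bilinField (hf.contDiffAt_pull_γ hL hz)
  Γh_diff z hz := IsSmoothNullOn.differentiableAt_of_smooth
    (contDiffAt_connField (hf.contDiffAt_leviCivita hL hz))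
  ell_diff z hz := IsSmoothNullOn.differentiableAt_of_smooth
    (contDiffAt_covecField (contDiffAt_pull₁ (hf.smooth z hz) (hL.ell_smooth _ (hf.mapsTo z hz))))
  U_diff z hz := IsSmoothNullOn.differentiableAt_of_smooth
    (contDiffAt_bilinField (contDiffAt_pull₂ (hf.smooth z hz) (hL.U_smooth (hf.mapsTo z hz))))
  s_diff z hz := IsSmoothNullOn.differentiableAt_of_smooth
    (contDiffAt_covecField (contDiffAt_pull₁ (hf.smooth z hz) (hL.s_smooth (hf.mapsTo z hz))))
  lam_diff z hz := IsSmoothNullOn.differentiableAt_of_smooth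
    (contDiffAt_vecField fun C => ContDiffAt.sum fun E _ =>
      (hf.contDiffAt_inverseMetric hL hz C E).mul
        (contDiffAt_pull₁ (hf.smooth z hz) (hL.ell_smooth _ (hf.mapsTo z hz)) E))
  h_eq z hz v w := bilinField_pull₂ (hf.differentiableAt hz) L.γ v w
  ell_eq z hz v := covecField_pull₁ (hf.differentiableAt hz) L.ell v
  U_eq z hz v w := bilinField_pull₂ (hf.differentiableAt hz) L.U v w
  s_eq z hz v := covecField_pull₁ (hf.differentiableAt hz) L.s v
  Γh_symm z hz v w := by
    ext c
    refine IsBilin.ext (C := fun v w => connField (leviCivita (pull₂ f L.γ)) z v w c)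
      (C' := fun v w => connField (leviCivita (pull₂ f L.γ)) z w v c)
      ⟨fun _ => ⟨by simp, by simp⟩, fun _ => ⟨by simp, by simp⟩⟩
      ⟨fun _ => ⟨by simp, by simp⟩, fun _ => ⟨by simp, by simp⟩⟩ (fun a b => ?_) v w
    simp only [connField_coordBasis, vecField_apply]
    exact hf.leviCivita_symm hL hz c a b
  covDeriv_h z hz v u w := by
    refine covDerivTwo_ext (C := fun _ _ _ => 0) (fun _ _ => ⟨by simp, by simp⟩)
      (fun _ => ⟨fun _ => ⟨by simp, by simp⟩, fun _ => ⟨by simp, by simp⟩⟩) (fun a b c => ?_) v u w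
    rw [← covDer₂_eq (IsSmoothNullOn.differentiableAt_of_smooth
      (contDiffAt_bilinField (hf.contDiffAt_pull_γ hL hz)))]
    exact hf.covDer₂_leviCivita hL hz a b c
  h_lam z hz v := by
    have hl := isLin_clm (bilinField (pull₂ f L.γ) z (vecField (ellUp L f) z))
    rw [hl.eq_sum, (isLin_clm (covecField (pull₁ f L.ell) z)).eq_sum]
    refine Finset.sum_congr rfl fun G _ => ?_
    congr 1
    rw [bilinField_vecField_left, covecField_coordBasis]
    simp only [ellUp, Finset.sum_mul]
    rw [Finset.sum_comm]
    have h : ∀ E, ∑ C, inverseMetric (pull₂ f L.γ) C E z * pull₁ f L.ell E z * pull₂ f L.γ C G z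
        = (if E = G then 1 else 0) * pull₁ f L.ell E z := by
      intro E
      rw [← hf.inverseMetric_mul hL hz E G, Finset.sum_mul]
      exact Finset.sum_congr rfl fun C _ => by rw [hf.inverseMetric_symm hL hz C E]; ring
    simp [h]
  transverse z hz V hV := hf.eq_smul_n hL hz V hV

theorem slice_isInverse (hz : z ∈ O) : (hf.slice hL).IsInverse z
    fun C E => inverseMetric (pull₂ f L.γ) C E z where
  symm := hf.inverseMetric_symm hL hz
  mul C G := by
    refine Eq.trans (Finset.sum_congr rfl fun E _ => ?_) (hf.inverseMetric_mul hL hz C G)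
    exact congrArg (_ * ·) (bilinField_coordBasis (pull₂ f L.γ) z E G)

end IsTransverseMap

end CoordData

end CoordinateData

/-! ### Linearity of the terms of the constraint tensor -/

section Bilinearity

variable {V : Type*} [AddCommGroup V] [Module ℝ V] {C C' : V → V → ℝ}

theorem IsLin.add_lin {α β : V → ℝ} (h : IsLin α) (h' : IsLin β) : IsLin fun v => α v + β v :=
  ⟨fun u v => by rw [h.add, h'.add]; ring, fun c u => by rw [h.smul, h'.smul]; ring⟩

theorem IsLin.const_mul {α : V → ℝ} (h : IsLin α) (c : ℝ) : IsLin fun v => c * α v :=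
  ⟨fun u v => by rw [h.add]; ring, fun d u => by rw [h.smul]; ring⟩

theorem IsLin.sub_lin {α β : V → ℝ} (h : IsLin α) (h' : IsLin β) : IsLin fun v => α v - β v :=
  ⟨fun u v => by rw [h.add, h'.add]; ring, fun c u => by rw [h.smul, h'.smul]; ring⟩

theorem IsLin.finset_sum {ι : Type*} (t : Finset ι) {α : ι → V → ℝ} (h : ∀ i, IsLin (α i)) :
    IsLin fun v => ∑ i ∈ t, α i v :=
  ⟨fun u v => by simp only [(h _).add, Finset.sum_add_distrib],
    fun c u => by simp only [(h _).smul, Finset.mul_sum]⟩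

theorem IsBilin.add (h : IsBilin C) (h' : IsBilin C') : IsBilin fun u w => C u w + C' u w :=
  ⟨fun w => (h.left w).add_lin (h'.left w), fun u => (h.right u).add_lin (h'.right u)⟩

theorem IsBilin.sub (h : IsBilin C) (h' : IsBilin C') : IsBilin fun u w => C u w - C' u w :=
  ⟨fun w => (h.left w).sub_lin (h'.left w), fun u => (h.right u).sub_lin (h'.right u)⟩

theorem IsBilin.const_mul (h : IsBilin C) (c : ℝ) : IsBilin fun u w => c * C u w :=
  ⟨fun w => (h.left w).const_mul c, fun u => (h.right u).const_mul c⟩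

theorem IsBilin.swap (h : IsBilin C) : IsBilin fun u w => C w u := ⟨h.right, h.left⟩

theorem isBilin_mul {α β : V → ℝ} (h : IsLin α) (h' : IsLin β) : IsBilin fun u w => α u * β w :=
  ⟨fun w => ⟨fun u v => by rw [h.add]; ring, fun c u => by rw [h.smul]; ring⟩,
    fun u => h'.const_mul (α u)⟩

theorem IsBilin.finset_sum {ι : Type*} (t : Finset ι) {T : ι → V → V → ℝ}
    (h : ∀ i, IsBilin (T i)) : IsBilin fun u w => ∑ i ∈ t, T i u w :=
  ⟨fun w => IsLin.finset_sum t fun i => (h i).left w,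
    fun u => IsLin.finset_sum t fun i => (h i).right u⟩

theorem isBilin_ricciTensor {k : ℕ} (Γ : Coord k → Coord k →L[ℝ] Coord k →L[ℝ] Coord k)
    (x : Coord k) : IsBilin (ricciTensor Γ x) := by
  refine IsBilin.finset_sum _ fun a => ⟨fun w => ⟨fun u v => ?_, fun c u => ?_⟩,
    fun u => ⟨fun w v => ?_, fun c w => ?_⟩⟩
  all_goals
    simp only [curvature, map_add, map_smul, add_apply, smul_apply, PiLp.add_apply, PiLp.sub_apply,
      PiLp.smul_apply, smul_eq_mul]
    ring

end Bilinearity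

/-! ### The pull-back of the constraint tensor -/

section Assembly

variable {k m : ℕ}

theorem covDer₁_add_const_mul {Γ : Fin k → Fin k → Fin k → Coord k → ℝ}
    {θ η : Fin k → Coord k → ℝ} {x : Coord k} (hθ : ∀ a, DifferentiableAt ℝ (θ a) x)
    (hη : ∀ a, DifferentiableAt ℝ (η a) x) (t : ℝ) (a b : Fin k) :
    covDer₁ Γ (fun c y => θ c y + t * η c y) a b x = covDer₁ Γ θ a b x + t * covDer₁ Γ η a b x := by
  have h : pd a (fun y => θ b y + t * η b y) x = pd a (θ b) x + t * pd a (η b) x := by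
    rw [pd, fderiv_fun_add (hθ b) ((hη b).const_mul t), fderiv_const_mul (hη b)]
    simp [pd]
  simp only [covDer₁, h, mul_add, Finset.sum_add_distrib, Finset.mul_sum, mul_sub]
  have : ∀ c, Γ c a b x * (t * η c x) = t * (Γ c a b x * η c x) := fun c => by ring
  simp only [this]
  ring

namespace CoordData

variable {L : CoordData k} {Ω : Set (Coord k)} (hL : L.IsSmoothNullOn Ω) {x : Coord k}

theorem covecField_r (x v : Coord k) :
    covecField L.r x v = bilinField L.Y x (vecField L.n x) v := by
  rw [(isLin_clm (covecField L.r x)).eq_sum, (isBilin_clm (bilinField L.Y x)).eq_sum,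
    Finset.sum_comm]
  refine Finset.sum_congr rfl fun b _ => ?_
  rw [covecField_coordBasis, CoordData.r, Finset.mul_sum]
  exact Finset.sum_congr rfl fun a _ => by simp; ring

theorem κ_eq (x : Coord k) : L.κ x = -covecField L.r x (vecField L.n x) := by
  rw [covecField_r, (isBilin_clm (bilinField L.Y x)).eq_sum]
  simp [CoordData.κ]

theorem trP_eq (T : Fin k → Fin k → Coord k → ℝ) (x : Coord k) :
    L.trP T x = ∑ a, ∑ b, L.P a b x * bilinField T x (coordBasis a) (coordBasis b) := by
  simp [trP]

theorem nDeriv_eq (g : Coord k → ℝ) (x : Coord k) :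
    L.nDeriv g x = fderiv ℝ g x (vecField L.n x) := by
  rw [(isLin_clm (fderiv ℝ g x)).eq_sum]
  simp [nDeriv, pd]

/-- The constraint tensor as a bilinear form, in the case `n⁽²⁾ = 0`. The contraction with `P` is
kept in components. -/
def constraintForm (hL : L.IsSmoothNullOn Ω) (x u w : Coord k) : ℝ :=
  (1 / 2) * (ricciTensor (connField L.mhConnection) x u w
      + ricciTensor (connField L.mhConnection) x w u)
    - 2 * lieDerivTwo (vecField L.n) (bilinField L.Y) x u w
    - (2 * L.κ x + L.trP L.U x) * bilinField L.Y x u w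
    + (1 / 2) * (covDerivOne (connField L.mhConnection) (covecField L.s) x u w
      + covDerivOne (connField L.mhConnection) (covecField L.s) x w u)
    + (covDerivOne (connField L.mhConnection) (covecField L.r) x u w
      + covDerivOne (connField L.mhConnection) (covecField L.r) x w u)
    - 2 * (covecField L.r x u * covecField L.r x w)
    + 2 * (covecField L.r x u * covecField L.s x w + covecField L.s x u * covecField L.r x w)
    - covecField L.s x u * covecField L.s x w
    - L.trP L.Y x * bilinField L.U x u w
    + ∑ a, ∑ c, L.P a c x * (bilinField L.U x (coordBasis a) u
          * (2 * bilinField L.Y x w (coordBasis c) + hL.nullStructure.F x w (coordBasis c))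
        + (2 * bilinField L.Y x u (coordBasis c) + hL.nullStructure.F x u (coordBasis c))
          * bilinField L.U x (coordBasis a) w)

theorem isBilin_constraintForm (x : Coord k) : IsBilin (constraintForm hL x) := by
  have hr := isBilin_ricciTensor (connField L.mhConnection) x
  have hY := isBilin_clm (bilinField L.Y x)
  have hU := isBilin_clm (bilinField L.U x)
  have hs := isBilin_covDerivOne (connField L.mhConnection) (covecField L.s) x
  have hrr := isBilin_covDerivOne (connField L.mhConnection) (covecField L.r) x
  have ls := isLin_clm (covecField L.s x)
  have lr := isLin_clm (covecField L.r x)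
  have hF := isBilin_clm (hL.nullStructure.F x)
  refine (((((((((((hr.add hr.swap).const_mul _).sub
    ((isBilin_lieDerivTwo (vecField L.n) (bilinField L.Y) x).const_mul 2)).sub
    (hY.const_mul _)).add ((hs.add hs.swap).const_mul _)).add (hrr.add hrr.swap)).sub
    ((isBilin_mul lr lr).const_mul 2)).add
    (((isBilin_mul lr ls).add (isBilin_mul ls lr)).const_mul 2)).sub (isBilin_mul ls ls)).sub
    (hU.const_mul _)).add (IsBilin.finset_sum _ fun a => IsBilin.finset_sum _ fun c =>
      IsBilin.const_mul (IsBilin.add ?_ ?_) _))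
  · exact isBilin_mul (hU.right _) (((hY.left _).const_mul 2).add_lin (hF.left _))
  · exact isBilin_mul (((hY.left _).const_mul 2).add_lin (hF.left _)) (hU.right _)

theorem F_coordBasis (hx : x ∈ Ω) (a b : Fin k) :
    hL.nullStructure.F x (coordBasis a) (coordBasis b) = L.F a b x := by
  have hd := IsSmoothNullOn.differentiableAt_of_smooth
    (contDiffAt_covecField (hL.ell_smooth x hx))
  rw [NullStructure.F_apply]
  change (fderiv ℝ (covecField L.ell) x _ _ - fderiv ℝ (covecField L.ell) x _ _) / 2 = _
  rw [fderiv_covecField hd, fderiv_covecField hd]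
  rfl

theorem constraint_eq (hx : x ∈ Ω) (a b : Fin k) :
    L.constraint a b x = constraintForm hL x (coordBasis a) (coordBasis b) := by
  have dΓ := IsSmoothNullOn.differentiableAt_of_smooth
    (contDiffAt_connField (hL.mhConnection_smooth hx))
  have dn := IsSmoothNullOn.differentiableAt_of_smooth (contDiffAt_vecField (hL.n_smooth hx))
  have dY := IsSmoothNullOn.differentiableAt_of_smooth (contDiffAt_bilinField (hL.Y_smooth x hx))
  have ds := fun a => IsSmoothNullOn.differentiableAt_of_smooth (hL.s_smooth hx a)
  have dr := fun a => IsSmoothNullOn.differentiableAt_of_smooth (hL.r_smooth hx a)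
  have ds' := IsSmoothNullOn.differentiableAt_of_smooth (contDiffAt_covecField (hL.s_smooth hx))
  have dr' := IsSmoothNullOn.differentiableAt_of_smooth (contDiffAt_covecField (hL.r_smooth hx))
  have hP : ∑ i, ∑ c, L.P i c x * (L.U i a x * (2 * L.Y b c x + L.F b c x)
        + L.U i b x * (2 * L.Y a c x + L.F a c x))
      = ∑ i, ∑ c, L.P i c x * (L.U i a x * (2 * L.Y b c x + L.F b c x)
        + (2 * L.Y a c x + L.F a c x) * L.U i b x) :=
    Finset.sum_congr rfl fun _ _ => Finset.sum_congr rfl fun _ _ => by ring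
  rw [constraint, hL.n2_eq x hx, hP, covDer₁_add_const_mul ds dr, covDer₁_add_const_mul ds dr,
    covDer₁_eq ds', covDer₁_eq ds', covDer₁_eq dr', covDer₁_eq dr', ricci_eq dΓ, ricci_eq dΓ,
    lieDer₂_eq dn dY, constraintForm]
  simp only [bilinField_coordBasis, covecField_coordBasis, F_coordBasis hL hx, ricciTensor]
  ring

namespace IsTransverseMap

variable {L : CoordData (m + 1)} {Ω : Set (Coord (m + 1))} {f : Coord m → Coord (m + 1)}
  {O : Set (Coord m)} {y : Coord m}

/-- The pull-back of the constraint tensor, for the components of null data in coordinates and a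
transverse parametrized submanifold. -/
theorem constraint_pullback (hf : L.IsTransverseMap Ω f O) (hL : L.IsSmoothNullOn Ω)
    (hy : y ∈ O) (A B : Fin m) :
    let h := pull₂ f L.γ
    let hinv := fun C E => inverseMetric h C E y
    let Γh := leviCivita h
    let ℓ := pull₁ f L.ell
    let ℓup := fun C z => ∑ E, inverseMetric h C E z * ℓ E z
    let s := pull₁ f L.s
    let r := pull₁ f L.r
    let U := pull₂ f L.U
    let Y := pull₂ f L.Y
    let LieU := pull₂ f (lieDer₂ L.n L.U)
    let LieY := pull₂ f (lieDer₂ L.n L.Y)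
    let κ := L.κ (f y)
    let trU := ∑ C, ∑ E, hinv C E * U C E y
    let trY := ∑ C, ∑ E, hinv C E * Y C E y
    let δ := L.ell2 (f y) - ∑ C, ℓup C y * ℓ C y
    let Dℓ := fun C E => covDer₁ Γh ℓ C E y
    let DU := fun C E G => covDer₂ Γh U C E G y
    let Dsr := fun C E => covDer₁ Γh (fun G z => s G z + r G z) C E y
    pull₂ f L.constraint A B y =
      ricci Γh A B y + (Dsr A B + Dsr B A) - 2 * (r A y - s A y) * (r B y - s B y)
      + δ * LieU A B y - 2 * LieY A B y
      - (2 * κ + trU) * (Y A B y - (Dℓ A B + Dℓ B A) / 2)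
      + (L.nDeriv L.ell2 (f y) + 2 * ∑ C, ∑ E, ℓup C y * ℓup E y * U C E y
          - 4 * ∑ C, ℓup C y * s C y + (trU + κ) * δ - trY + divergence Γh ℓup y) * U A B y
      + 2 * ∑ C, ℓup C y * (DU C A B - (DU A B C + DU B A C) / 2
          - ((2 * (r A y - s A y) + ∑ E, ℓup E y * U E A y) * U B C y
            + (2 * (r B y - s B y) + ∑ E, ℓup E y * U E B y) * U A C y) / 2)
      + 2 * ∑ C, ∑ E, hinv C E * (((2 * Y E A y - Dℓ E A - δ * U E A y) * U B C y
            + (2 * Y E B y - Dℓ E B - δ * U E B y) * U A C y) / 2) := by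
  intro h hinv Γh ℓ ℓup s r U Y LieU LieY κ trU trY δ Dℓ DU Dsr
  have hx := hf.mapsTo y hy
  have hfd := hf.differentiableAt hy
  let D := hL.nullStructure
  let S : D.Slice O := hf.slice hL
  have hH : S.IsInverse y hinv := hf.slice_isInverse hL hy
  set u : Coord m := coordBasis A with hu
  set w : Coord m := coordBasis B with hw
  set df := fderiv ℝ f y with hdf
  set lam : Coord m := S.lam y with hlam
  set Nu := raiseIndex hinv fun v => S.U y u v with hNu
  set Nw := raiseIndex hinv fun v => S.U y w v with hNw
  set rS := covecField (pull₁ f L.r) with hrS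
  set YS := bilinField (pull₂ f L.Y) with hYS
  have smr := fun a => hL.r_smooth hx a
  -- the tensor fields on tangent vectors of the submanifold are given by their pull-backs
  have erS : ∀ z ∈ O, ∀ v, rS z v = covecField L.r (f z) (fderiv ℝ f z v) := fun z hz v =>
    covecField_pull₁ (hf.differentiableAt hz) L.r v
  have esS : ∀ v, covecField L.s (f y) (df v) = S.s y v := fun v => (S.s_eq y hy v).symm
  have eYS : ∀ v t, bilinField L.Y (f y) (df v) (df t) = YS y v t := fun v t =>
    (bilinField_pull₂ hfd L.Y v t).symm
  have eUS : ∀ v t, bilinField L.U (f y) (df v) (df t) = S.U y v t := fun v t =>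
    (S.U_eq y hy v t).symm
  have YSs : ∀ v t, YS y v t = YS y t v := by
    intro v t
    refine IsBilin.ext (isBilin_clm (YS y)) (isBilin_clm (YS y)).swap (fun C E => ?_) v t
    simp only [hYS, bilinField_coordBasis]
    rw [pull₂, pull₂, Finset.sum_comm]
    exact Finset.sum_congr rfl fun a _ => Finset.sum_congr rfl fun b _ => by
      rw [hL.Y_symm _ hx]; ring
  have er : ∀ v, bilinField L.Y (f y) (vecField L.n (f y)) (df v) = rS y v := fun v => by
    rw [erS y hy, covecField_r]
  have Ysymm : ∀ V W, bilinField L.Y (f y) V W = bilinField L.Y (f y) W V := by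
    intro V W
    have hb := isBilin_clm (bilinField L.Y (f y))
    refine IsBilin.ext hb hb.swap (fun a b => ?_) V W
    simp only [bilinField_coordBasis]
    exact hL.Y_symm _ hx a b
  have eκ : κ = -covecField L.r (f y) (vecField L.n (f y)) := κ_eq (f y)
  have hN : ∀ u v, S.h y (raiseIndex hinv fun v => S.U y u v) v = S.U y u v := fun u v =>
    hH.h_raiseIndex (isLin_clm (S.U y u)) v
  -- `∇r` and `∇s` differ from `∇ʰ` of the pull-backs by the second fundamental form
  have drS : DifferentiableAt ℝ rS y := IsSmoothNullOn.differentiableAt_of_smooth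
    (contDiffAt_covecField (contDiffAt_pull₁ (hf.smooth y hy) smr))
  have cr := fun v t => S.covDerivOne_map hy (θ := covecField L.r)
    (IsSmoothNullOn.differentiableAt_of_smooth (contDiffAt_covecField smr)) drS erS v t
  have cs := fun v t => S.covDeriv_s hy v t
  -- `P` contracts like the inverse of `h` up to terms with an argument `n`, most of which vanish
  -- for the tensors that occur since `U(n, ·) = 0`
  have sP := fun T => hH.sum_P hy (P := fun a b => L.P a b (f y))
    (hL.regular _ hx).P_symm
    (fun a => by
      have := (hL.regular _ hx).prod3 a
      refine Eq.trans ?_ this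
      exact congrArg₂ (· + ·) (Finset.sum_congr rfl fun b _ => congrArg (_ * ·)
        (covecField_coordBasis L.ell (f y) b)) (congrArg (_ * ·) (vecField_apply L.n (f y) a)))
    (fun a c => by
      have := (hL.regular _ hx).prod4 a c
      refine Eq.trans ?_ this
      exact congrArg₂ (· + ·) (Finset.sum_congr rfl fun b _ => congrArg (_ * ·)
        (bilinField_coordBasis L.γ (f y) b c)) (congrArg₂ (· * ·) (vecField_apply L.n (f y) a)
          (covecField_coordBasis L.ell (f y) c))) T
  have Un : ∀ V, bilinField L.U (f y) (vecField L.n (f y)) V = 0 := fun V => D.U_n hx V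
  have Usymm : ∀ V W, bilinField L.U (f y) V W = bilinField L.U (f y) W V := fun V W =>
    D.U_symm hx V W
  have etrU : trU = metricTrace hinv (fun v t => S.U y v t) := by
    refine Finset.sum_congr rfl fun C _ => Finset.sum_congr rfl fun E _ => ?_
    exact congrArg (_ * ·) (bilinField_coordBasis (pull₂ f L.U) y C E).symm
  have etrY : trY = metricTrace hinv (fun v t => YS y v t) := by
    refine Finset.sum_congr rfl fun C _ => Finset.sum_congr rfl fun E _ => ?_
    exact congrArg (_ * ·) (bilinField_coordBasis (pull₂ f L.Y) y C E).symm
  have eδ : δ = S.delta y := by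
    refine congrArg (L.ell2 (f y) - ·) ?_
    exact (covecField_vecField (pull₁ f L.ell) (ellUp L f) y y).symm
  have trPU : L.trP L.U (f y) = trU := by
    rw [trP_eq, etrU]
    refine (sP (bilinField L.U (f y))).trans ?_
    change metricTrace hinv (fun v t => bilinField L.U (f y) (df v) (df t))
      - bilinField L.U (f y) (vecField L.n (f y)) _ - bilinField L.U (f y) _ (vecField L.n (f y))
      - _ * bilinField L.U (f y) (vecField L.n (f y)) _ = _
    rw [Usymm _ (vecField L.n (f y)), Un, Un]
    simp only [eUS]
    ring
  have trPY : L.trP L.Y (f y) = trY - 2 * rS y lam + δ * κ := by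
    rw [trP_eq, etrY, eδ, eκ]
    refine (sP (bilinField L.Y (f y))).trans ?_
    change metricTrace hinv (fun v t => bilinField L.Y (f y) (df v) (df t))
      - bilinField L.Y (f y) (vecField L.n (f y)) (df lam)
      - bilinField L.Y (f y) (df lam) (vecField L.n (f y))
      - _ * bilinField L.Y (f y) (vecField L.n (f y)) (vecField L.n (f y)) = _
    rw [Ysymm _ (vecField L.n (f y)), er, covecField_r]
    simp only [eYS]
    ring
  have Fn : ∀ v, D.F (f y) (df v) (vecField L.n (f y)) = -S.s y v := by
    intro v
    rw [D.F_swap, S.s_eq y hy]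
    exact congrArg Neg.neg (D.s_eq_F hx (df v)).symm
  have contr : ∀ a b : Coord m, ∑ i, ∑ c, L.P i c (f y)
        * (bilinField L.U (f y) (coordBasis i) (df a)
          * (2 * bilinField L.Y (f y) (df b) (coordBasis c) + D.F (f y) (df b) (coordBasis c)))
      = 2 * YS y b (raiseIndex hinv fun v => S.U y a v)
        + D.F (f y) (df b) (df (raiseIndex hinv fun v => S.U y a v))
        - S.U y lam a * (2 * rS y b - S.s y b) := by
    intro a b
    refine (sP (((bilinField L.U (f y)).flip (df a)).smulRight
      ((2 : ℝ) • bilinField L.Y (f y) (df b) + D.F (f y) (df b)))).trans ?_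
    change metricTrace hinv (fun v t => bilinField L.U (f y) (df v) (df a)
        * (2 * bilinField L.Y (f y) (df b) (df t) + D.F (f y) (df b) (df t)))
      - bilinField L.U (f y) (vecField L.n (f y)) (df a) * _
      - bilinField L.U (f y) (df lam) (df a) * (2 * bilinField L.Y (f y) (df b) (vecField L.n (f y))
        + D.F (f y) (df b) (vecField L.n (f y)))
      - _ * (bilinField L.U (f y) (vecField L.n (f y)) (df a) * _) = _
    have hl : IsLin fun t => 2 * bilinField L.Y (f y) (df b) (df t) + D.F (f y) (df b) (df t) :=
      ⟨fun _ _ => by simp; ring, fun _ _ => by simp; ring⟩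
    rw [metricTrace_mul' hH.symm hl, Un, Fn, Ysymm _ (vecField L.n (f y)), er, eUS]
    have e1 : raiseIndex hinv (fun v => bilinField L.U (f y) (df v) (df a))
        = raiseIndex hinv fun v => S.U y a v := by
      congr 1; funext v; rw [eUS, S.U_symm hy]
    rw [e1, eYS]
    ring
  have PB : ∑ i, ∑ c, L.P i c (f y) * (bilinField L.U (f y) (coordBasis i) (df u)
          * (2 * bilinField L.Y (f y) (df w) (coordBasis c) + D.F (f y) (df w) (coordBasis c))
        + (2 * bilinField L.Y (f y) (df u) (coordBasis c) + D.F (f y) (df u) (coordBasis c))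
          * bilinField L.U (f y) (coordBasis i) (df w))
      = 2 * YS y w Nu + D.F (f y) (df w) (df Nu) - S.U y lam u * (2 * rS y w - S.s y w)
        + (2 * YS y u Nw + D.F (f y) (df u) (df Nw) - S.U y lam w * (2 * rS y u - S.s y u)) := by
    rw [← contr u w, ← contr w u, ← Finset.sum_add_distrib]
    refine Finset.sum_congr rfl fun i _ => ?_
    rw [← Finset.sum_add_distrib]
    exact Finset.sum_congr rfl fun c _ => by ring
  have Fm : ∀ a b, D.F (f y) (df a) (df b)
      = (covDerivOne S.Γh S.ell y a b - covDerivOne S.Γh S.ell y b a) / 2 := fun a b =>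
    S.F_map hy a b
  -- the constraint tensor on tangent vectors, first through its bilinear form
  have lhs : pull₂ f L.constraint A B y = constraintForm hL (f y) (df u) (df w) :=
    pull₂_eq hfd (isBilin_constraintForm hL (f y)) (constraint_eq hL hx) A B
  have ric := hH.ricciTensor_pullback hy u w
  have eLieU : LieU A B y = lieDerivTwo D.n D.U (f y) (df u) (df w) :=
    pull₂_eq hfd (isBilin_lieDerivTwo D.n D.U (f y)) (fun a b => lieDer₂_eq
      (IsSmoothNullOn.differentiableAt_of_smooth (contDiffAt_vecField (hL.n_smooth hx)))
      (IsSmoothNullOn.differentiableAt_of_smooth (contDiffAt_bilinField (hL.U_smooth hx))) a b) A B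
  have eLieY : LieY A B y = lieDerivTwo (vecField L.n) (bilinField L.Y) (f y) (df u) (df w) :=
    pull₂_eq hfd (isBilin_lieDerivTwo _ _ (f y)) (fun a b => lieDer₂_eq
      (IsSmoothNullOn.differentiableAt_of_smooth (contDiffAt_vecField (hL.n_smooth hx)))
      (IsSmoothNullOn.differentiableAt_of_smooth
        (contDiffAt_bilinField (hL.Y_smooth _ hx))) a b) A B
  -- the component expressions on the submanifold in terms of `∇ʰ`, traces and `ℓ♯`
  have dℓ : DifferentiableAt ℝ (covecField (pull₁ f L.ell)) y := S.ell_diff y hy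
  have dU : DifferentiableAt ℝ (bilinField (pull₂ f L.U)) y := S.U_diff y hy
  have eDℓ : ∀ C E, Dℓ C E = covDerivOne S.Γh S.ell y (coordBasis C) (coordBasis E) := fun C E =>
    covDer₁_eq dℓ C E
  have eDU : ∀ C E G, DU C E G
      = covDerivTwo S.Γh S.U y (coordBasis C) (coordBasis E) (coordBasis G) := fun C E G =>
    covDer₂_eq dU C E G
  have eDsr : ∀ C E, Dsr C E = covDerivOne S.Γh S.s y (coordBasis C) (coordBasis E)
      + covDerivOne S.Γh rS y (coordBasis C) (coordBasis E) := by
    intro C E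
    have h1 := covDer₁_add_const_mul (Γ := Γh) (x := y) (θ := s) (η := r)
      (fun a => IsSmoothNullOn.differentiableAt_of_smooth
        (contDiffAt_pull₁ (hf.smooth y hy) (hL.s_smooth hx) a))
      (fun a => IsSmoothNullOn.differentiableAt_of_smooth
        (contDiffAt_pull₁ (hf.smooth y hy) smr a)) 1 C E
    simp only [one_mul] at h1
    rw [covDer₁_eq drS] at h1
    have h2 : covDer₁ Γh s C E y = _ := covDer₁_eq (S.s_diff y hy) C E
    rw [h2] at h1
    exact h1
  have eRic : ricci Γh A B y = ricciTensor S.Γh y u w := ricci_eq (S.Γh_diff y hy) A B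
  have ediv : divergence Γh ℓup y = metricTrace hinv fun v t => covDerivOne S.Γh S.ell y v t := by
    have h1 : divergence Γh ℓup y = ∑ C, covDerivVec S.Γh S.lam y (coordBasis C) C :=
      divergence_eq (S.lam_diff y hy)
    rw [h1, ← hH.metricTrace_h hy (fun v => covDerivVec S.Γh S.lam y v)]
    congr 1
    funext v t
    exact S.h_covDeriv_lam hy v t
  have eU : ∀ C E, U C E y = S.U y (coordBasis C) (coordBasis E) := fun C E =>
    (bilinField_coordBasis (pull₂ f L.U) y C E).symm
  have eY : ∀ C E, Y C E y = YS y (coordBasis C) (coordBasis E) := fun C E =>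
    (bilinField_coordBasis (pull₂ f L.Y) y C E).symm
  have es : ∀ C, s C y = S.s y (coordBasis C) := fun C =>
    (covecField_coordBasis (pull₁ f L.s) y C).symm
  have er' : ∀ C, r C y = rS y (coordBasis C) := fun C =>
    (covecField_coordBasis (pull₁ f L.r) y C).symm
  have elam : ∀ C, ℓup C y = lam C := fun C => (vecField_apply (ellUp L f) y C).symm
  have lin : ∀ {α : Coord m → ℝ}, IsLin α → ∑ C, lam C * α (coordBasis C) = α lam := fun hα =>
    (hα.eq_sum lam).symm
  have eUll : ∑ C, ∑ E, ℓup C y * ℓup E y * U C E y = S.U y lam lam := by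
    rw [(isBilin_clm (S.U y)).eq_sum]
    simp only [elam, eU]
  have esl : ∑ C, ℓup C y * s C y = S.s y lam := by
    rw [← lin (isLin_clm (S.s y))]
    simp only [elam, es]
  have eUl : ∀ G, ∑ E, ℓup E y * U E G y = S.U y lam (coordBasis G) := by
    intro G
    rw [← lin ((isBilin_clm (S.U y)).left (coordBasis G))]
    simp only [elam, eU]
  have sum1 : ∑ C, ℓup C y * (DU C A B - (DU A B C + DU B A C) / 2
        - ((2 * (r A y - s A y) + ∑ E, ℓup E y * U E A y) * U B C y
          + (2 * (r B y - s B y) + ∑ E, ℓup E y * U E B y) * U A C y) / 2)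
      = covDerivTwo S.Γh S.U y lam u w
        - (covDerivTwo S.Γh S.U y u w lam + covDerivTwo S.Γh S.U y w u lam) / 2
        - ((2 * (rS y u - S.s y u) + S.U y lam u) * S.U y w lam
          + (2 * (rS y w - S.s y w) + S.U y lam w) * S.U y u lam) / 2 := by
    have hl : IsLin fun v => covDerivTwo S.Γh S.U y v u w
        - 1 / 2 * (covDerivTwo S.Γh S.U y u w v + covDerivTwo S.Γh S.U y w u v)
        - 1 / 2 * ((2 * (rS y u - S.s y u) + S.U y lam u) * S.U y w v
          + (2 * (rS y w - S.s y w) + S.U y lam w) * S.U y u v) :=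
      ((isLin_covDerivTwo_one S.Γh S.U y u w).sub_lin
        (((isLin_covDerivTwo_three S.Γh S.U y u w).add_lin
          (isLin_covDerivTwo_three S.Γh S.U y w u)).const_mul _)).sub_lin
        ((((isLin_clm (S.U y w)).const_mul _).add_lin ((isLin_clm (S.U y u)).const_mul _)).const_mul
          _)
    have h1 := lin hl
    refine Eq.trans (Finset.sum_congr rfl fun C _ => ?_) (h1.trans ?_)
    · rw [elam, eUl, eUl, eDU, eDU, eDU, eU, eU, er', er', es, es]
      ring
    · ring
  have sum2 : ∑ C, ∑ E, hinv C E * (((2 * Y E A y - Dℓ E A - δ * U E A y) * U B C y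
          + (2 * Y E B y - Dℓ E B - δ * U E B y) * U A C y) / 2)
      = 1 / 2 * ((2 * YS y Nw u - covDerivOne S.Γh S.ell y Nw u - δ * S.U y Nw u)
        + (2 * YS y Nu w - covDerivOne S.Γh S.ell y Nu w - δ * S.U y Nu w)) := by
    have hl : ∀ a : Coord m,
        IsLin fun v => 2 * YS y v a - covDerivOne S.Γh S.ell y v a - δ * S.U y v a := fun a =>
      ((((isBilin_clm (YS y)).left a).const_mul 2).sub_lin
        (isLin_covDerivOne_left S.Γh S.ell y a)).sub_lin
        (((isBilin_clm (S.U y)).left a).const_mul δ)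
    rw [hNw, hNu, ← metricTrace_mul' hH.symm (hl u), ← metricTrace_mul' hH.symm (hl w),
      ← metricTrace_add, ← metricTrace_const_mul]
    refine Finset.sum_congr rfl fun C _ => Finset.sum_congr rfl fun E _ => ?_
    rw [eY, eY, eDℓ, eDℓ, eU, eU, eU, eU]
    ring
  have enl : L.nDeriv L.ell2 (f y) = fderiv ℝ D.ell2 (f y) (D.n (f y)) := nDeriv_eq _ _
  have sU3 : ∀ a b c, covDerivTwo S.Γh S.U y a b c = covDerivTwo S.Γh S.U y a c b := by
    intro a b c
    have h1 := S.covDeriv_U hy a b c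
    have h2 := S.covDeriv_U hy a c b
    rw [D.covDeriv_U_symm (S.mapsTo y hy)] at h1
    linarith
  have UN : S.U y Nw u = S.U y Nu w := by
    rw [S.U_symm hy Nw u, ← hN u Nw, S.h_symm hy, hN w, S.U_symm hy w]
  rw [lhs, constraintForm, PB, trPU, trPY, sum1, sum2, eUll, esl, ediv, enl, eRic, eDsr, eDsr,
    eLieU, eLieY, eDℓ, eDℓ, eU, eY, es, es, er', er', esS, esS, ← erS y hy, ← erS y hy, eUS, eYS]
  have eR : ∀ v t, ricciTensor D.Γ (S.f y) (fderiv ℝ S.f y v) (fderiv ℝ S.f y t)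
      = ricciTensor (connField L.mhConnection) (f y) (df v) (df t) := fun _ _ => rfl
  have es' : ∀ v t, covDerivOne (connField L.mhConnection) (covecField L.s) (f y) (df v) (df t)
      = covDerivOne S.Γh S.s y v t - S.U y v t * S.s y lam := fun v t => cs v t
  have er'' : ∀ v t, covDerivOne (connField L.mhConnection) (covecField L.r) (f y) (df v) (df t)
      = covDerivOne S.Γh rS y v t - S.U y v t * rS y lam
        + ((covDerivOne S.Γh S.ell y v t + covDerivOne S.Γh S.ell y t v) / 2 + δ * S.U y v t)
          * κ := fun v t => (cr v t).trans <| by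
    rw [eδ, eκ]
    change _ - ((covDerivOne S.Γh S.ell y v t + covDerivOne S.Γh S.ell y t v) / 2
      + S.delta y * S.U y v t) * covecField L.r (f y) (vecField L.n (f y)) = _
    ring
  have eL : lieDerivTwo D.n D.U (S.f y) (fderiv ℝ S.f y u) (fderiv ℝ S.f y w)
      = lieDerivTwo D.n D.U (f y) (df u) (df w) := rfl
  have eE : fderiv ℝ D.ell2 (S.f y) (D.n (S.f y)) = fderiv ℝ D.ell2 (f y) (D.n (f y)) := rfl
  have eκ' : L.κ (f y) = κ := rfl
  simp only [NullStructure.Slice.Q, ← hlam, ← hNu, ← hNw, eR, eL, eE, ← eδ, ← etrU] at ric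
  rw [es', es', er'', er'', eκ', Fm, Fm]
  simp only [← hu, ← hw]
  rw [YSs u Nw, YSs w Nu, UN, S.U_symm hy w u, S.U_symm hy w lam, S.U_symm hy u lam,
    ← sU3 u lam w, ← sU3 w lam u]
  rw [UN, S.U_symm hy u Nw, UN] at ric
  -- all terms are now tensors on the submanifold, and the only relation left is that for the Ricci
  -- tensor
  linear_combination (1 / 2) * ric

end IsTransverseMap

end CoordData

end Assembly

/-! ### Passage to charts -/

section Manifold

variable {m k : ℕ} {N : Type*} [TopologicalSpace N] [ChartedSpace (Coord k) N]
  [IsManifold (𝓡 k) ∞ N] {S : Type*} [TopologicalSpace S] [ChartedSpace (Coord m) S]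
  [IsManifold (𝓡 m) ∞ S] {φ : OpenPartialHomeomorph N (Coord k)}
  {χ : OpenPartialHomeomorph S (Coord m)}

/-- The differential of an immersion is injective: in suitable charts the map is a linear
injection. -/
theorem mfderiv_eq_zero_of_isImmersionAt {ψ : S → N} {p : S}
    (h : Manifold.IsImmersionAt (𝓡 m) (𝓡 k) ∞ ψ p) {X : TangentSpace (𝓡 m) p}
    (hX : mfderiv (𝓡 m) (𝓡 k) ψ p X = 0) : X = 0 := by
  have hd := chart_mdifferentiable h.domChart_mem_maximalAtlas
  have hc := chart_mdifferentiable h.codChart_mem_maximalAtlas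
  let e : Coord m →L[ℝ] Coord k :=
    (h.equiv : (Coord m × h.complement) →L[ℝ] Coord k).comp
      (ContinuousLinearMap.inl ℝ (Coord m) h.complement)
  have he : ∀ v, e v = 0 → v = 0 := fun v hv => by
    have h0 : h.equiv (v, 0) = 0 := hv
    exact congrArg Prod.fst (h.equiv.map_eq_zero_iff.1 h0)
  have hψ : MDifferentiableAt (𝓡 m) (𝓡 k) ψ p := h.contMDiffAt.mdifferentiableAt (by simp)
  have loc : (h.codChart ∘ ψ) =ᶠ[nhds p] (e ∘ h.domChart) := by
    filter_upwards [h.domChart.open_source.mem_nhds h.mem_domChart_source] with q hq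
    have hq' : h.domChart q ∈ (h.domChart.extend (𝓡 m)).target := by
      simpa using h.domChart.map_source hq
    have hw : h.codChart (ψ q) = h.equiv (h.domChart q, 0) := by
      simpa [h.domChart.left_inv hq] using h.writtenInCharts hq'
    exact hw
  have h1 := loc.mfderiv_eq (I := 𝓡 m) (I' := 𝓡 k)
  have hcp := hc.mdifferentiableAt h.mem_codChart_source
  have hdp := hd.mdifferentiableAt h.mem_domChart_source
  have hep : MDifferentiableAt (𝓡 m) (𝓡 k) e (h.domChart p) := e.mdifferentiableAt
  rw [mfderiv_comp p hcp hψ, mfderiv_comp p hep hdp] at h1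
  have h2 := congrArg (fun l => l X) h1
  have h3 : e (mfderiv (𝓡 m) (𝓡 m) h.domChart p X) = 0 := by
    rw [← e.mfderiv_eq (x := h.domChart p)]
    refine h2.symm.trans ?_
    change mfderiv (𝓡 k) (𝓡 k) h.codChart (ψ p) (mfderiv (𝓡 m) (𝓡 k) ψ p X) = 0
    rw [hX]
    exact map_zero _
  have h4 := congrArg (fun l => l X) (hd.symm_comp_deriv h.mem_domChart_source)
  refine h4.symm.trans ?_
  change mfderiv (𝓡 m) (𝓡 m) h.domChart.symm (h.domChart p)
    (mfderiv (𝓡 m) (𝓡 m) h.domChart p X) = 0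
  rw [he _ h3]
  exact map_zero _

/-- Hypersurface data that are null, read in a chart. -/
theorem HypersurfaceData.isSmoothNullOn_inChart (D : HypersurfaceData k N) (hD : D.IsNull)
    (hφ : φ ∈ IsManifold.maximalAtlas (𝓡 k) ∞ N) : (D.inChart φ).IsSmoothNullOn φ.target where
  isOpen := φ.open_target
  regular _ hx := D.inChart_isRegularAt hφ hx
  n2_eq x _ := hD (φ.symm x)
  γ_smooth _ hx a b := contDiffAt_comp₂ hφ hx D.γ_smooth a b
  ell_smooth _ hx a := contDiffAt_comp₁ hφ hx D.ell_smooth a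
  ell2_smooth x hx := by
    have hs := (contMDiffOn_symm_of_mem_maximalAtlas hφ).contMDiffAt (φ.open_target.mem_nhds hx)
    exact ((D.ell2_smooth.contMDiffAt (x := φ.symm x)).comp x hs).contDiffAt
  Y_smooth _ hx a b := contDiffAt_comp₂ hφ hx D.Y_smooth a b
  Y_symm x _ a b := D.Y_symm (φ.symm x) _ _

omit [IsManifold (𝓡 k) ∞ N] [IsManifold (𝓡 m) ∞ S] in
theorem contDiffAt_localExpr {ψ : S → N} (hψ : ContMDiff (𝓡 m) (𝓡 k) ∞ ψ)
    (hφ : φ ∈ IsManifold.maximalAtlas (𝓡 k) ∞ N) (hχ : χ ∈ IsManifold.maximalAtlas (𝓡 m) ∞ S)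
    {z : Coord m} (hz : z ∈ χ.target) (hzφ : ψ (χ.symm z) ∈ φ.source) :
    ContDiffAt ℝ ∞ (localExpr φ ψ χ) z := by
  have h1 := (contMDiffOn_symm_of_mem_maximalAtlas hχ).contMDiffAt (χ.open_target.mem_nhds hz)
  have h2 := (contMDiffOn_of_mem_maximalAtlas hφ).contMDiffAt (φ.open_source.mem_nhds hzφ)
  exact (h2.comp z ((hψ.contMDiffAt (x := χ.symm z)).comp z h1)).contDiffAt

theorem fderiv_localExpr {ψ : S → N} (hψ : ContMDiff (𝓡 m) (𝓡 k) ∞ ψ)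
    (hφ : φ ∈ IsManifold.maximalAtlas (𝓡 k) ∞ N) (hχ : χ ∈ IsManifold.maximalAtlas (𝓡 m) ∞ S)
    {z : Coord m} (hz : z ∈ χ.target) (hzφ : ψ (χ.symm z) ∈ φ.source) (v : Coord m) :
    fderiv ℝ (localExpr φ ψ χ) z v = mfderiv (𝓡 k) (𝓡 k) φ (ψ (χ.symm z))
      (mfderiv (𝓡 m) (𝓡 k) ψ (χ.symm z) (mfderiv (𝓡 m) (𝓡 m) χ.symm z v)) := by
  have h1 := (chart_mdifferentiable hχ).mdifferentiableAt_symm hz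
  have h2 := (chart_mdifferentiable hφ).mdifferentiableAt hzφ
  have h3 : MDifferentiableAt (𝓡 m) (𝓡 k) ψ (χ.symm z) :=
    hψ.contMDiffAt.mdifferentiableAt (by simp)
  rw [← mfderiv_eq_fderiv]
  have h4 := mfderiv_comp z h2 (h3.comp z h1)
  rw [mfderiv_comp z h3 h1] at h4
  exact congrArg (fun l => l v) h4

variable {M : Type*} [TopologicalSpace M] [ChartedSpace (Coord (m + 1)) M]
  [IsManifold (𝓡 (m + 1)) ∞ M] {θ : OpenPartialHomeomorph M (Coord (m + 1))}

/-- A transverse submanifold, read in charts. -/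
theorem IsTransverseSubmanifold.isTransverseMap_localExpr {D : HypersurfaceData (m + 1) M}
    {ψ : S → M} (hψ : IsTransverseSubmanifold D.toMetricHypersurfaceData ψ)
    (hθ : θ ∈ IsManifold.maximalAtlas (𝓡 (m + 1)) ∞ M)
    (hχ : χ ∈ IsManifold.maximalAtlas (𝓡 m) ∞ S) :
    (D.inChart θ).IsTransverseMap θ.target (localExpr θ ψ χ)
      (χ.target ∩ χ.symm ⁻¹' (ψ ⁻¹' θ.source)) where
  isOpen := χ.symm.isOpen_inter_preimage (θ.open_source.preimage hψ.1.contMDiff.continuous)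
  mapsTo _ hz := θ.map_source hz.2
  smooth _ hz := contDiffAt_localExpr hψ.1.contMDiff hθ hχ hz.1 hz.2
  transverse z hz v c hv := by
    have hs : ψ (χ.symm z) ∈ θ.source := hz.2
    have hdθ := chart_mdifferentiable hθ
    have hdχ := chart_mdifferentiable hχ
    set X := mfderiv (𝓡 m) (𝓡 m) χ.symm z v with hX
    rw [fderiv_localExpr hψ.1.contMDiff hθ hχ hz.1 hs v] at hv
    have e : vecField (D.inChart θ).n (localExpr θ ψ χ z)
        = mfderiv (𝓡 (m + 1)) (𝓡 (m + 1)) θ (ψ (χ.symm z)) (D.n (ψ (χ.symm z))) := by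
      ext a
      rw [vecField_apply]
      change coordCovector θ a (θ.symm (θ (ψ (χ.symm z)))) (D.n (θ.symm (θ (ψ (χ.symm z))))) = _
      rw [θ.left_inv hs]
      rfl
    have inj : ∀ V : TangentSpace (𝓡 (m + 1)) (ψ (χ.symm z)),
        mfderiv (𝓡 (m + 1)) (𝓡 (m + 1)) θ.symm (θ (ψ (χ.symm z)))
          (mfderiv (𝓡 (m + 1)) (𝓡 (m + 1)) θ (ψ (χ.symm z)) V) = V := fun V =>
      congrArg (fun l => l V) (hdθ.symm_comp_deriv hs)
    have hV : mfderiv (𝓡 m) (𝓡 (m + 1)) ψ (χ.symm z) X = c • D.n (ψ (χ.symm z)) := by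
      rw [e] at hv
      rw [← inj (mfderiv (𝓡 m) (𝓡 (m + 1)) ψ (χ.symm z) X), hv]
      refine Eq.trans (map_smul _ _ _) ?_
      exact congrArg (c • ·) (inj _)
    have hX0 : X = 0 := by
      -- for `c = 0` the immersion property is used, otherwise the transversality to `n`
      rcases eq_or_ne c 0 with rfl | hc
      · exact mfderiv_eq_zero_of_isImmersionAt (hψ.1.isImmersion.isImmersionAt _)
          (hV.trans (zero_smul _ _))
      · refine (hψ.2 (χ.symm z) (c⁻¹ • X) ?_).elim
        refine (map_smul _ _ _).trans ?_
        rw [hV]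
        exact inv_smul_smul₀ hc _
    have h4 := congrArg (fun l => l v) (hdχ.comp_symm_deriv hz.1)
    refine h4.symm.trans ?_
    change mfderiv (𝓡 m) (𝓡 m) χ (χ.symm z) X = 0
    rw [hX0]
    exact map_zero _

end Manifold

end

theorem theorem5p3 {m : ℕ}
    {N : Type*} [TopologicalSpace N] [ChartedSpace (Coord (m + 1)) N]
    [IsManifold (𝓡 (m + 1)) ∞ N]
    {S : Type*} [TopologicalSpace S] [ChartedSpace (Coord m) S] [IsManifold (𝓡 m) ∞ S]
    (D : HypersurfaceData (m + 1) N) (hD : D.IsNull)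
    (ψ : S → N) (hψ : IsTransverseSubmanifold D.toMetricHypersurfaceData ψ)
    (φ : OpenPartialHomeomorph N (Coord (m + 1)))
    (hφ : φ ∈ IsManifold.maximalAtlas (𝓡 (m + 1)) ∞ N)
    (χ : OpenPartialHomeomorph S (Coord m)) (hχ : χ ∈ IsManifold.maximalAtlas (𝓡 m) ∞ S)
    (y : Coord m) (hy : y ∈ χ.target) (hyφ : ψ (χ.symm y) ∈ φ.source) (A B : Fin m) :
    let L := D.inChart φ
    let f := localExpr φ ψ χ
    -- the induced metric, its inverse and its Levi-Civita connection
    let h := pull₂ f L.γ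
    let hinv := fun C E => inverseMetric h C E y
    let Γh := leviCivita h
    -- pull-backs to the submanifold
    let ℓ := pull₁ f L.ell
    let ℓup := fun C z => ∑ E, inverseMetric h C E z * ℓ E z
    let s := pull₁ f L.s
    let r := pull₁ f L.r
    let U := pull₂ f L.U
    let Y := pull₂ f L.Y
    let LieU := pull₂ f (lieDer₂ L.n L.U)
    let LieY := pull₂ f (lieDer₂ L.n L.Y)
    -- scalars at the point
    let κ := L.κ (f y)
    let trU := ∑ C, ∑ E, hinv C E * U C E y
    let trY := ∑ C, ∑ E, hinv C E * Y C E y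
    let δ := L.ell2 (f y) - ∑ C, ℓup C y * ℓ C y
    -- covariant derivatives on the submanifold
    let Dℓ := fun C E => covDer₁ Γh ℓ C E y
    let DU := fun C E G => covDer₂ Γh U C E G y
    let Dsr := fun C E => covDer₁ Γh (fun G z => s G z + r G z) C E y
    pull₂ f L.constraint A B y =
      ricci Γh A B y + (Dsr A B + Dsr B A) - 2 * (r A y - s A y) * (r B y - s B y)
      + δ * LieU A B y - 2 * LieY A B y
      - (2 * κ + trU) * (Y A B y - (Dℓ A B + Dℓ B A) / 2)
      + (L.nDeriv L.ell2 (f y) + 2 * ∑ C, ∑ E, ℓup C y * ℓup E y * U C E y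
          - 4 * ∑ C, ℓup C y * s C y + (trU + κ) * δ - trY + divergence Γh ℓup y) * U A B y
      + 2 * ∑ C, ℓup C y * (DU C A B - (DU A B C + DU B A C) / 2
          - ((2 * (r A y - s A y) + ∑ E, ℓup E y * U E A y) * U B C y
            + (2 * (r B y - s B y) + ∑ E, ℓup E y * U E B y) * U A C y) / 2)
      + 2 * ∑ C, ∑ E, hinv C E * (((2 * Y E A y - Dℓ E A - δ * U E A y) * U B C y
            + (2 * Y E B y - Dℓ E B - δ * U E B y) * U A C y) / 2) :=
  (hψ.isTransverseMap_localExpr hφ hχ).constraint_pullback (D.isSmoothNullOn_inChart hD hφ)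
    ⟨hy, hyφ⟩ A B
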